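/- Let $\Gamma\subset\mathbb C$ be a lattice with dual lattice $\Gamma^*=\{\gamma\in\mathbb C:\langle\gamma,\Gamma\rangle\subset\mathbb Z\}$ for the dot product of $\mathbb C=\mathbb R^2$. Let $E^4$ be Euclidean 4-space with complex structure $L_i(x^1,x^2,x^3,x^4)=(-x^2,x^1,-x^4,x^3)$ and symplectic form $\omega(v,w)=\langle L_iv,w\rangle$. Let $\mathcal G$ be the group of affine isometries of $E^4$ preserving $\omega$, and $\mathcal G_2=\{p^1+p^2L_i:(p^1)^2+(p^2)^2=1\}$. Maps of $\mathbb C/\Gamma$ are identified with $\Gamma$-periodic maps of $\mathbb C$. A weakly conformal Lagrangian map with Lagrangian angle $\beta$ is a smooth map $X:\mathbb C\to E^4$ with a smooth function $\beta:\mathbb C\to\mathbb R$ such that everywhere $|X_x|=|X_y|$, $\langle X_x,X_y\rangle=0$, $\omega(X_x,X_y)=0$ and $(dx^1+i\,dx^2)\wedge(dx^3+i\,dx^4)(X_x,X_y)=|X_x||X_y|e^{i\beta}$ (zeros of $dX$ are allowed). It is Hamiltonian stationary if on $\{dX\neq0\}$ it is a critical point of the area under all Hamiltonian variations (smooth fields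 $V$ along $X$ with compact support in $\{dX\ne0\}$ and $\omega(V,dX\,\cdot)=d\varphi$ for some $\varphi\in C_c^\infty(\mathbb C,\mathbb R)$), and $\Delta\beta=0$ at the zeros of $dX$, if there are any. For $\beta_0\in\Gamma^*$ let $\Gamma^*_{\beta_0}=\{\gamma\in\frac{\beta_0}{2}+\Gamma^*:\ |\gamma|^2=|\frac{\beta_0}{2}|^2,\ \gamma^2\neq(\frac{\beta_0}{2})^2\}$ and, for $\gamma\in\Gamma^*_{\beta_0}$, let $$A_\gamma(z)=\frac{4e^{\pi\langle\beta_0,z\rangle L_i}}{\pi}\,\mathrm{Re}\left[\frac{e^{-2i\pi\langle\gamma,z\rangle}}{\beta_0^2-4\gamma^2}\begin{pmatrix}-i\gamma\\-\beta_0/2\\\gamma\\-i\beta_0/2\end{pmatrix}\right],$$ and let $B_\gamma$ be given by the same formula with $\mathrm{Im}$ instead of $\mathrm{Re}$. (i) If $X$ is a nonconstant Hamiltonian stationary weakly conformal Lagrangian map of $\mathbb C/\Gamma$ with Lagrangian angle $\beta$, then $\frac1\pi\frac{\partial\beta}{\partial\bar z}$ is a constant $\beta_0$, and $\beta_0\in\Gamma^*$.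 (ii) For each $\beta_0\in\Gamma^*$, the set of Hamiltonian stationary weakly conformal Lagrangian maps of $\mathbb C/\Gamma$ that have a Lagrangian angle $\beta$ with $\frac1\pi\frac{\partial\beta}{\partial\bar z}=\beta_0$ (constant maps included) is the $\mathcal G_2$-orbit $\{gY: g\in\mathcal G_2,\ Y\in V\}$ of the real vector space $V$ spanned by the $A_\gamma,B_\gamma$ ($\gamma\in\Gamma^*_{\beta_0}$) and the constant maps. The set $\Gamma^*_{\beta_0}$ is finite (possibly empty), and $\dim V=2\,\mathrm{Card}(\Gamma^*_{\beta_0})+4$. (iii) If $\Gamma^*_{\beta_0}\neq\emptyset$, then the set of nonconstant solutions in (ii), with the topology of pointwise convergence (equivalently, that of any Hausdorff vector topology on the finite-dimensional space of maps spanned by it), is nonempty and locally homeomorphic to $\mathbb R^{N}$ with $N=2\,\mathrm{Card}(\Gamma^*_{\beta_0})+5$; and the quotient of this set in which solutions in the same $\mathcal G$-orbit are identified, with the quotient topology, is nonempty and locally homeomorphic to $\mathbb R^{N-8}$, $N-8=2\,\mathrm{Card}(\Gamma^*_{\beta_0})-3$. -/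

import Mathlib

open scoped ContDiff

noncomputable section

namespace HamStat

/-! ### Symplectic Euclidean 4-space -/

/-- Euclidean 4-space with coordinates `x¹, x², x³, x⁴`. -/
abbrev E4 : Type := EuclideanSpace ℝ (Fin 4)

/-- The complex structure `J = L_i`: `J ε₁ = ε₂`, `J ε₃ = ε₄`, `J² = -1`. -/
def J (v : E4) : E4 := !₂[-(v 1), v 0, -(v 3), v 2]

/-- The symplectic form `ω(v, w) = ⟨J v, w⟩`, that is `dx¹ ∧ dx² + dx³ ∧ dx⁴`. -/
def omega (v w : E4) : ℝ := inner ℝ (J v) w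

/-- The complex area form `(dx¹ + i dx²) ∧ (dx³ + i dx⁴)`. -/
def dzdz (v w : E4) : ℂ :=
  ((v 0 : ℂ) + Complex.I * (v 1 : ℂ)) * ((w 2 : ℂ) + Complex.I * (w 3 : ℂ)) -
    ((v 2 : ℂ) + Complex.I * (v 3 : ℂ)) * ((w 0 : ℂ) + Complex.I * (w 1 : ℂ))

/-- The rotation `p¹ + p² L_i` of `E4` given by `p = p¹ + i p²`; the group `G₂` consists of these
maps for `‖p‖ = 1`. -/
def Lmul (p : ℂ) (v : E4) : E4 := p.re • v + p.im • J v

/-- The symmetry group: all affine isometries of `E4` that preserve the symplectic form. -/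
def symmetryGroup : Subgroup (E4 ≃ᵃⁱ[ℝ] E4) where
  carrier := {g | ∀ v w : E4,
    omega (g.linearIsometryEquiv v) (g.linearIsometryEquiv w) = omega v w}
  mul_mem' := by
    intro g h hg hh v w
    exact (hg (h.linearIsometryEquiv v) (h.linearIsometryEquiv w)).trans (hh v w)
  one_mem' := fun _ _ => rfl
  inv_mem' := by
    intro g hg v w
    have h := hg (g.linearIsometryEquiv.symm v) (g.linearIsometryEquiv.symm w)
    rw [LinearIsometryEquiv.apply_symm_apply, LinearIsometryEquiv.apply_symm_apply] at h
    exact h.symm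

/-! ### Hamiltonian stationary weakly conformal Lagrangian maps of the plane -/

/-- The partial derivative `∂X/∂x`, where `z = x + iy`. -/
def dx (X : ℂ → E4) (z : ℂ) : E4 := fderiv ℝ X z 1

/-- The partial derivative `∂X/∂y`, where `z = x + iy`. -/
def dy (X : ℂ → E4) (z : ℂ) : E4 := fderiv ℝ X z Complex.I

/-- The set of points at which `dX ≠ 0`; if `X` is weakly conformal, this is the set of points at
which `X` is an immersion. -/
def regularSet (X : ℂ → E4) : Set ℂ := {z | fderiv ℝ X z ≠ 0}

/-- `X` is a smooth weakly conformal Lagrangian map and the smooth function `β` is a lift to `ℝ` of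
its Lagrangian angle. At a point of the regular set the last field says that
`(dz¹ ∧ dz²)(e₁, e₃) = e^{iβ}` for the orthonormal basis `e₁ = X_x / |X_x|`, `e₃ = X_y / |X_y|` of
the tangent plane; at the other points all fields on `X` are void. -/
structure IsWeaklyConformalLagrangian (X : ℂ → E4) (β : ℂ → ℝ) : Prop where
  smooth : ContDiff ℝ ∞ X
  smooth_angle : ContDiff ℝ ∞ β
  norm_eq : ∀ z, ‖dx X z‖ = ‖dy X z‖
  orthogonal : ∀ z, inner ℝ (dx X z) (dy X z) = 0
  lagrangian : ∀ z, omega (dx X z) (dy X z) = 0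
  angle : ∀ z, dzdz (dx X z) (dy X z) =
    (‖dx X z‖ : ℂ) * (‖dy X z‖ : ℂ) * Complex.exp (Complex.I * (β z : ℂ))

/-- The area of the map `Y` over the set `K`, that is the integral over `K` of the area density
`√(|Y_x|² |Y_y|² - ⟨Y_x, Y_y⟩²)`. -/
def area (K : Set ℂ) (Y : ℂ → E4) : ℝ :=
  ∫ z in K, Real.sqrt (‖dx Y z‖ ^ 2 * ‖dy Y z‖ ^ 2 - (inner ℝ (dx Y z) (dy Y z)) ^ 2)

/-- A Hamiltonian variation of the immersed part of `X`: a smooth vector field `V` along `X`, with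
compact support in the regular set, such that the 1-form `ω(V, dX ·)` is the differential of a
compactly supported smooth function. -/
structure IsHamiltonianVariation (X V : ℂ → E4) : Prop where
  smooth : ContDiff ℝ ∞ V
  compact_support : HasCompactSupport V
  support_subset : tsupport V ⊆ regularSet X
  hamiltonian : ∃ φ : ℂ → ℝ, ContDiff ℝ ∞ φ ∧ HasCompactSupport φ ∧
    ∀ z w : ℂ, omega (V z) (fderiv ℝ X z w) = fderiv ℝ φ z w

/-- A weakly conformal Lagrangian map `X` with Lagrangian angle `β` is Hamiltonian stationary: its
immersed part is a critical point of the area under all Hamiltonian variations and, at the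
points where `X` is not an immersion (if any), the angle function satisfies `Δβ = 0`. For an
immersion the second condition is void. -/
structure IsHamiltonianStationary (X : ℂ → E4) (β : ℂ → ℝ) : Prop
    extends IsWeaklyConformalLagrangian X β where
  critical : ∀ V : ℂ → E4, IsHamiltonianVariation X V →
    HasDerivAt (fun t : ℝ => area (tsupport V) (fun z => X z + t • V z)) 0 0
  harmonic_of_not_mem : ∀ z, z ∉ regularSet X → Laplacian.laplacian β z = 0

/-! ### Tori and the classification -/

/-- `X` is invariant under the lattice `Γ`, that is, it is the lift of a map of `ℂ/Γ`. -/
def IsPeriodic (Γ : Submodule ℤ ℂ) (X : ℂ → E4) : Prop := ∀ g ∈ Γ, ∀ z, X (z + g) = X z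

/-- The dual lattice `Γ* = {γ | ⟨γ, Γ⟩ ⊆ ℤ}`, for the dot product of `ℂ = ℝ²`. -/
def dualLattice (Γ : Submodule ℤ ℂ) : Set ℂ := {γ | ∀ g ∈ Γ, ∃ n : ℤ, inner ℝ γ g = (n : ℝ)}

/-- The derivative `∂β/∂z̄ = (β_x + i β_y) / 2`. -/
def dbar (β : ℂ → ℝ) (z : ℂ) : ℂ :=
  (1 / 2 : ℂ) * ((fderiv ℝ β z 1 : ℂ) + Complex.I * (fderiv ℝ β z Complex.I : ℂ))

/-- The set `Γ*_{β₀}` of all `γ ∈ β₀/2 + Γ*` with `|γ|² = |β₀/2|²` and `γ² ≠ (β₀/2)²`. -/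
def frequencies (Γ : Submodule ℤ ℂ) (β₀ : ℂ) : Set ℂ :=
  {γ | γ - β₀ / 2 ∈ dualLattice Γ ∧ ‖γ‖ ^ 2 = ‖β₀ / 2‖ ^ 2 ∧ γ ^ 2 ≠ (β₀ / 2) ^ 2}

/-- The complex 4-vector valued function
`e^{-2πi⟨γ,z⟩} / (β₀² - 4γ²) * (-iγ, -β₀/2, γ, -iβ₀/2)`. -/
def wave (β₀ γ z : ℂ) : Fin 4 → ℂ :=
  (Complex.exp (-2 * (Real.pi : ℂ) * Complex.I * ((inner ℝ γ z : ℝ) : ℂ)) /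
      (β₀ ^ 2 - 4 * γ ^ 2)) •
    ![-Complex.I * γ, -β₀ / 2, γ, -Complex.I * β₀ / 2]

/-- `A_γ(z) = (4/π) e^{π⟨β₀,z⟩ L_i} Re (wave β₀ γ z)`. -/
def A (β₀ γ : ℂ) (z : ℂ) : E4 :=
  (4 / Real.pi) • Lmul (Complex.exp (Complex.I * ((Real.pi * inner ℝ β₀ z : ℝ) : ℂ)))
    (WithLp.toLp 2 fun k => (wave β₀ γ z k).re)

/-- `B_γ(z) = (4/π) e^{π⟨β₀,z⟩ L_i} Im (wave β₀ γ z)`. -/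
def B (β₀ γ : ℂ) (z : ℂ) : E4 :=
  (4 / Real.pi) • Lmul (Complex.exp (Complex.I * ((Real.pi * inner ℝ β₀ z : ℝ) : ℂ)))
    (WithLp.toLp 2 fun k => (wave β₀ γ z k).im)

/-- The real vector space of maps generated by the maps `A_γ`, `B_γ` for `γ ∈ Γ*_{β₀}` and the
translations (constant maps). -/
def solutionSpace (Γ : Submodule ℤ ℂ) (β₀ : ℂ) : Submodule ℝ (ℂ → E4) :=
  Submodule.span ℝ ({X | ∃ γ ∈ frequencies Γ β₀, X = A β₀ γ ∨ X = B β₀ γ} ∪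
    {X | ∃ c : E4, X = fun _ => c})

/-- The orbit under `G₂` of a set of maps. -/
def orbitG2 (S : Set (ℂ → E4)) : Set (ℂ → E4) :=
  {X | ∃ p : ℂ, ‖p‖ = 1 ∧ ∃ Y ∈ S, X = fun z => Lmul p (Y z)}

/-- The set of all Hamiltonian stationary weakly conformal Lagrangian maps of `ℂ/Γ` with a
Lagrangian angle function `β` such that `(1/π) ∂β/∂z̄ = β₀`. -/
def solutions (Γ : Submodule ℤ ℂ) (β₀ : ℂ) : Set (ℂ → E4) :=
  {X | IsPeriodic Γ X ∧ ∃ β : ℂ → ℝ, IsHamiltonianStationary X β ∧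
    ∀ z, (1 / (Real.pi : ℂ)) * dbar β z = β₀}

/-- `X` is a constant map. -/
def IsConstant (X : ℂ → E4) : Prop := ∃ c : E4, ∀ z, X z = c

/-- The set of nonconstant solutions. As a subtype of `ℂ → E4` it carries the topology of pointwise
convergence; the solutions for a fixed `β₀` lie in a finite-dimensional vector space of maps, on
which all Hausdorff vector space topologies agree. -/
def nonconstantSolutions (Γ : Submodule ℤ ℂ) (β₀ : ℂ) : Set (ℂ → E4) :=
  {X | X ∈ solutions Γ β₀ ∧ ¬ IsConstant X}

/-- Two nonconstant solutions are identified if they lie in the same orbit of the symmetry group of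
`E4`. -/
def SameOrbit (Γ : Submodule ℤ ℂ) (β₀ : ℂ) (X Y : nonconstantSolutions Γ β₀) : Prop :=
  ∃ g ∈ symmetryGroup, ∀ z, (Y : ℂ → E4) z = g ((X : ℂ → E4) z)

/-- The nonconstant solutions modulo the symmetry group, with the quotient topology. -/
abbrev ModuliSpace (Γ : Submodule ℤ ℂ) (β₀ : ℂ) : Type := Quot (SameOrbit Γ β₀)

/-- The topological space `M` has dimension `n` (everywhere): it is nonempty and each of its points
has an open neighbourhood that is homeomorphic to an open subset of `ℝⁿ`. -/
def HasManifoldDim (n : ℕ) (M : Type) [TopologicalSpace M] : Prop :=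
  Nonempty M ∧ Nonempty (ChartedSpace (EuclideanSpace ℝ (Fin n)) M)

end HamStat

end

open scoped ContDiff

noncomputable section

namespace HamStat

/-! ### Complex and quaternionic structure of `E4` -/

/-! Identify `E4` with ℂ², `J` being multiplication by i, and let `K` be the antilinear isometry
with `K² = -1`. For v ≠ 0 the vectors v and `K v` are Hermitian-orthogonal of equal length, and
`dzdz v w` is the Hermitian product of `K v` with w. So conformality, the Lagrangian condition and
the angle amount to the single equation X_y = e^{iβ} K X_x, also at zeros of dX
(`conformal_lagrangian_iff`). Differentiating it gives ΔX = J(β_x X_x + β_y X_y), and two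
integrations by parts turn the first variation of area into -∫ φ Δβ (`first_variation`). Hence
stationary means that β is harmonic.

On a torus e^{iβ} is periodic where dX ≠ 0, so the entire function β_x - iβ_y is periodic and
bounded, and Liouville makes it constant (`dbar_angle_const`): β = 2π⟨β₀, z⟩ + c. Since `K` is
antilinear, a rotation by e^{-ic/2} removes c. What remains is the real linear system Y_y =
e^{2πi⟨β₀,z⟩} K Y_x. Its second order consequence puts all Fourier frequencies η on the circle |η|²
= ⟨β₀, η⟩, so they are finite in number (`exists_coeff_of_laplace`), and the system itself ties the
coefficient at β₀ - η to the one at η. Writing η = β₀/2 - γ, the solutions are sums of constants and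
of `mode β₀ γ u` with an arbitrary u in `E4` for each pair ±γ; `A` and `B` are modes with u in the
complex line of `vec0`, and -γ supplies the complementary line. This gives `solutions_eq` and
`finrank_solutionSpace`.

With h pairs ±γ, a nonconstant solution is described uniquely by the coefficients u ≠ 0 (4h real
parameters), a phase q = p² on the unit circle coming from the rotation p, and a constant term (4
parameters). A symmetry acts on all Fourier coefficients by one unitary map of ℂ², and its
translation affects only the constant term. If u_j ≠ 0, exactly one symmetry brings the frame u_j, q
K u_j to standard position and the constant term to 0. The norm of u_j and the Hermitian products of
the other u_k with this frame are then coordinates on the quotient, 1 + 4(h - 1) in number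
(`moduliChart`). -/

lemma E4.ext {v w : E4} (h0 : v 0 = w 0) (h1 : v 1 = w 1) (h2 : v 2 = w 2) (h3 : v 3 = w 3) :
    v = w := by
  ext i; fin_cases i <;> assumption

lemma inner_E4 (v w : E4) : inner ℝ v w = v 0 * w 0 + v 1 * w 1 + v 2 * w 2 + v 3 * w 3 := by
  simp [PiLp.inner_apply, Fin.sum_univ_four, mul_comm]

lemma norm_sq_E4 (v : E4) : ‖v‖ ^ 2 = v 0 ^ 2 + v 1 ^ 2 + v 2 ^ 2 + v 3 ^ 2 := by
  rw [← real_inner_self_eq_norm_sq, inner_E4]; ring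

@[simp] lemma J_zero (v : E4) : J v 0 = -(v 1) := rfl
@[simp] lemma J_one (v : E4) : J v 1 = v 0 := rfl
@[simp] lemma J_two (v : E4) : J v 2 = -(v 3) := rfl
@[simp] lemma J_three (v : E4) : J v 3 = v 2 := rfl

/-- The antilinear map `(z¹, z²) ↦ (-conj z², conj z¹)` of `E4 = ℂ²`. -/
def K (v : E4) : E4 := !₂[-(v 2), v 3, v 0, -(v 1)]

@[simp] lemma K_zero (v : E4) : K v 0 = -(v 2) := rfl
@[simp] lemma K_one (v : E4) : K v 1 = v 3 := rfl
@[simp] lemma K_two (v : E4) : K v 2 = v 0 := rfl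
@[simp] lemma K_three (v : E4) : K v 3 = -(v 1) := rfl

@[simp] lemma Lmul_zero' (p : ℂ) (v : E4) : Lmul p v 0 = p.re * v 0 - p.im * v 1 := by
  simp [Lmul]; ring
@[simp] lemma Lmul_one' (p : ℂ) (v : E4) : Lmul p v 1 = p.re * v 1 + p.im * v 0 := by
  simp [Lmul]
@[simp] lemma Lmul_two' (p : ℂ) (v : E4) : Lmul p v 2 = p.re * v 2 - p.im * v 3 := by
  simp [Lmul]; ring
@[simp] lemma Lmul_three' (p : ℂ) (v : E4) : Lmul p v 3 = p.re * v 3 + p.im * v 2 := by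
  simp [Lmul]

/-- `K` as a continuous linear map. -/
def KL : E4 →L[ℝ] E4 :=
  LinearMap.toContinuousLinearMap
    { toFun := K
      map_add' := fun v w => by apply E4.ext <;> simp <;> ring
      map_smul' := fun r v => by apply E4.ext <;> simp }

@[simp] lemma KL_apply (v : E4) : KL v = K v := rfl

/-- Complex multiplication on `E4 = ℂ²` as a continuous bilinear map. -/
def LmulL : ℂ →L[ℝ] E4 →L[ℝ] E4 :=
  LinearMap.toContinuousLinearMap
    { toFun := fun p => LinearMap.toContinuousLinearMap
        { toFun := Lmul p
          map_add' := fun v w => by apply E4.ext <;> simp <;> ring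
          map_smul' := fun r v => by apply E4.ext <;> simp <;> ring }
      map_add' := fun p q => by ext1 v; apply E4.ext <;> simp <;> ring
      map_smul' := fun r p => by ext1 v; apply E4.ext <;> simp <;> ring }

@[simp] lemma LmulL_apply (p : ℂ) (v : E4) : LmulL p v = Lmul p v := rfl

lemma Lmul_add (p : ℂ) (v w : E4) : Lmul p (v + w) = Lmul p v + Lmul p w := (LmulL p).map_add v w
lemma Lmul_sub (p : ℂ) (v w : E4) : Lmul p (v - w) = Lmul p v - Lmul p w := (LmulL p).map_sub v w
lemma Lmul_neg (p : ℂ) (v : E4) : Lmul p (-v) = -Lmul p v := (LmulL p).map_neg v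
lemma Lmul_smul (p : ℂ) (r : ℝ) (v : E4) : Lmul p (r • v) = r • Lmul p v := (LmulL p).map_smul r v
@[simp] lemma Lmul_zero (p : ℂ) : Lmul p 0 = 0 := (LmulL p).map_zero
lemma Lmul_sum {ι : Type*} (p : ℂ) (s : Finset ι) (f : ι → E4) :
    Lmul p (∑ i ∈ s, f i) = ∑ i ∈ s, Lmul p (f i) := map_sum (LmulL p) f s
lemma add_Lmul (p q : ℂ) (v : E4) : Lmul (p + q) v = Lmul p v + Lmul q v := by
  rw [← LmulL_apply, map_add]; rfl
lemma neg_Lmul (p : ℂ) (v : E4) : Lmul (-p) v = -Lmul p v := by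
  rw [← LmulL_apply, map_neg]; rfl
lemma smul_Lmul (r : ℝ) (p : ℂ) (v : E4) : Lmul (r • p) v = r • Lmul p v := by
  rw [← LmulL_apply, map_smul]; rfl
@[simp] lemma zero_Lmul (v : E4) : Lmul 0 v = 0 := by
  rw [← LmulL_apply, map_zero]; rfl
@[simp] lemma one_Lmul (v : E4) : Lmul 1 v = v := by simp [Lmul]
lemma I_Lmul (v : E4) : Lmul Complex.I v = J v := by simp [Lmul]
lemma ofReal_Lmul (r : ℝ) (v : E4) : Lmul (r : ℂ) v = r • v := by simp [Lmul]
lemma Lmul_Lmul (p q : ℂ) (v : E4) : Lmul p (Lmul q v) = Lmul (p * q) v := by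
  apply E4.ext <;> simp <;> ring

lemma K_add (v w : E4) : K (v + w) = K v + K w := KL.map_add v w
lemma K_smul (r : ℝ) (v : E4) : K (r • v) = r • K v := KL.map_smul r v
lemma K_neg (v : E4) : K (-v) = -K v := KL.map_neg v
@[simp] lemma K_map_zero : K 0 = 0 := KL.map_zero
lemma K_sum {ι : Type*} (s : Finset ι) (f : ι → E4) : K (∑ i ∈ s, f i) = ∑ i ∈ s, K (f i) :=
  map_sum KL f s
@[simp] lemma K_K (v : E4) : K (K v) = -v := by apply E4.ext <;> simp
lemma K_Lmul (p : ℂ) (v : E4) : K (Lmul p v) = Lmul (star p) (K v) := by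
  apply E4.ext <;> simp <;> ring

lemma norm_sq_Lmul (p : ℂ) (v : E4) : ‖Lmul p v‖ ^ 2 = (‖p‖ * ‖v‖) ^ 2 := by
  rw [mul_pow, ← Complex.normSq_eq_norm_sq, Complex.normSq_apply, norm_sq_E4, norm_sq_E4]
  simp; ring
lemma norm_Lmul (p : ℂ) (v : E4) : ‖Lmul p v‖ = ‖p‖ * ‖v‖ :=
  (sq_eq_sq₀ (norm_nonneg _) (by positivity)).1 (norm_sq_Lmul p v)
@[simp] lemma norm_K (v : E4) : ‖K v‖ = ‖v‖ := by
  rw [← sq_eq_sq₀ (norm_nonneg _) (norm_nonneg _), norm_sq_E4, norm_sq_E4]; simp; ring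
lemma Lmul_eq_zero {p : ℂ} {v : E4} : Lmul p v = 0 ↔ p = 0 ∨ v = 0 := by
  rw [← norm_eq_zero, norm_Lmul]; simp
lemma K_eq_zero {v : E4} : K v = 0 ↔ v = 0 := by
  rw [← norm_eq_zero, norm_K, norm_eq_zero]
lemma Lmul_left_injective {p : ℂ} (hp : p ≠ 0) : Function.Injective (Lmul p) := fun v w h => by
  have : Lmul p (v - w) = 0 := by rw [Lmul_sub, h, sub_self]
  simpa [Lmul_eq_zero, hp, sub_eq_zero] using this

/-- The Hermitian product of `E4 = ℂ²`, antilinear in the first argument. -/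
def herm (v w : E4) : ℂ := ⟨inner ℝ v w, omega v w⟩

lemma omega_E4 (v w : E4) : omega v w = v 0 * w 1 - v 1 * w 0 + v 2 * w 3 - v 3 * w 2 := by
  rw [omega, inner_E4]; simp; ring

lemma omega_swap (v w : E4) : omega v w = -omega w v := by
  simp only [omega_E4]; ring

/-- `dzdz` is the complex determinant, which is complex linear in w and hence a Hermitian product
with a vector depending antilinearly on v. -/
lemma herm_K_left (v w : E4) : herm (K v) w = dzdz v w := by
  apply Complex.ext <;> simp [herm, dzdz, inner_E4, omega_E4] <;> ring

/-- Expansion of w in the Hermitian-orthogonal frame v, `K v`, with the division by ‖v‖² cleared so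
that v = 0 is allowed. -/
lemma norm_sq_smul_eq (v w : E4) :
    (‖v‖ ^ 2) • w = Lmul (herm v w) v + Lmul (herm (K v) w) (K v) := by
  rw [norm_sq_E4]
  apply E4.ext <;> simp [herm, inner_E4, omega_E4] <;> ring

/-- Conformality, the Lagrangian property and the angle in one linear equation. -/
lemma conformal_lagrangian_iff (v w : E4) (t : ℝ) :
    (‖v‖ = ‖w‖ ∧ inner ℝ v w = (0 : ℝ) ∧ omega v w = 0 ∧
      dzdz v w = (‖v‖ : ℂ) * (‖w‖ : ℂ) * Complex.exp (Complex.I * (t : ℂ))) ↔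
    w = Lmul (Complex.exp (Complex.I * (t : ℂ))) (K v) := by
  constructor
  · rintro ⟨h1, h2, h3, h4⟩
    by_cases hv : v = 0
    · subst hv
      have : w = 0 := by rw [← norm_eq_zero, ← h1, norm_zero]
      simp [this]
    · have h := norm_sq_smul_eq v w
      have hh : herm v w = 0 := by simp [herm, h2, h3]; rfl
      rw [hh, zero_Lmul, zero_add, herm_K_left, h4, ← h1] at h
      have hn : ‖v‖ ^ 2 ≠ 0 := by simpa using hv
      apply smul_right_injective E4 hn
      simp only
      rw [h, ← smul_Lmul]
      congr 1
      simp [pow_two]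
  · intro h
    have hn : ‖Complex.exp (Complex.I * (t : ℂ))‖ = 1 := by
      rw [mul_comm]; exact Complex.norm_exp_ofReal_mul_I t
    set p := Complex.exp (Complex.I * (t : ℂ)) with hp
    have h1 : ‖v‖ = ‖w‖ := by rw [h, norm_Lmul, hn, norm_K, one_mul]
    have h2 : inner ℝ v w = (0 : ℝ) := by rw [h, inner_E4]; simp; ring
    have h3 : omega v w = 0 := by rw [h, omega_E4]; simp; ring
    refine ⟨h1, h2, h3, ?_⟩
    rw [← h1, ← pow_two, ← Complex.ofReal_pow, norm_sq_E4, h]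
    apply Complex.ext <;> simp [dzdz, pow_two] <;> ring

lemma isWeaklyConformalLagrangian_iff (X : ℂ → E4) (β : ℂ → ℝ) :
    IsWeaklyConformalLagrangian X β ↔ ContDiff ℝ ∞ X ∧ ContDiff ℝ ∞ β ∧
      ∀ z, dy X z = Lmul (Complex.exp (Complex.I * (β z : ℂ))) (K (dx X z)) := by
  constructor
  · intro h
    exact ⟨h.smooth, h.smooth_angle, fun z => (conformal_lagrangian_iff _ _ _).1
      ⟨h.norm_eq z, h.orthogonal z, h.lagrangian z, h.angle z⟩⟩
  · rintro ⟨h1, h2, h3⟩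
    have h4 := fun z => (conformal_lagrangian_iff _ _ _).2 (h3 z)
    exact ⟨h1, h2, fun z => (h4 z).1, fun z => (h4 z).2.1, fun z => (h4 z).2.2.1,
      fun z => (h4 z).2.2.2⟩

/-! ### Directional derivatives of maps of the plane -/

section Derivatives

variable {F G : Type*} [NormedAddCommGroup F] [NormedSpace ℝ F]
  [NormedAddCommGroup G] [NormedSpace ℝ G]

/-- The derivative of `f` in the direction `v`. -/
def pd (v : ℂ) (f : ℂ → F) (z : ℂ) : F := fderiv ℝ f z v

lemma dx_eq_pd (X : ℂ → E4) : dx X = pd 1 X := rfl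
lemma dy_eq_pd (X : ℂ → E4) : dy X = pd Complex.I X := rfl

lemma contDiff_pd {f : ℂ → F} (hf : ContDiff ℝ ∞ f) (v : ℂ) : ContDiff ℝ ∞ (pd v f) :=
  (hf.fderiv_right (m := ∞) (by simp)).clm_apply contDiff_const

lemma differentiable_of_smooth {f : ℂ → F} (hf : ContDiff ℝ ∞ f) : Differentiable ℝ f :=
  hf.differentiable (by simp)

lemma pd_pd {f : ℂ → F} (hf : ContDiff ℝ ∞ f) (v w z : ℂ) :
    pd v (pd w f) z = fderiv ℝ (fderiv ℝ f) z v w := by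
  have h : DifferentiableAt ℝ (fderiv ℝ f) z :=
    (hf.fderiv_right (m := ∞) (by simp)).differentiable (by simp) z
  unfold pd
  rw [fderiv_clm_apply h (differentiableAt_const w)]
  simp

lemma pd_comm {f : ℂ → F} (hf : ContDiff ℝ ∞ f) (v w z : ℂ) :
    pd v (pd w f) z = pd w (pd v f) z := by
  rw [pd_pd hf, pd_pd hf]
  have h : IsSymmSndFDerivAt ℝ f z :=
    hf.contDiffAt.isSymmSndFDerivAt (by simp; exact ENat.LEInfty.out)
  exact h v w

lemma pd_clm (L : F →L[ℝ] G) {f : ℂ → F} (hf : Differentiable ℝ f) (v z : ℂ) :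
    pd v (fun z => L (f z)) z = L (pd v f z) := by
  unfold pd
  rw [show (fun z => L (f z)) = L ∘ f from rfl, fderiv_comp z L.differentiableAt (hf z),
    L.fderiv]
  rfl

lemma pd_add {f g : ℂ → F} (hf : Differentiable ℝ f) (hg : Differentiable ℝ g) (v z : ℂ) :
    pd v (fun z => f z + g z) z = pd v f z + pd v g z := by
  unfold pd
  rw [fderiv_fun_add (hf z) (hg z)]; rfl

lemma pd_neg (f : ℂ → F) (v z : ℂ) : pd v (fun z => -f z) z = -pd v f z := by
  unfold pd
  rw [fderiv_fun_neg]; rfl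

lemma pd_bilin {W : Type*} [NormedAddCommGroup W] [NormedSpace ℝ W] (L : F →L[ℝ] G →L[ℝ] W)
    {f : ℂ → F} {g : ℂ → G} (hf : Differentiable ℝ f) (hg : Differentiable ℝ g) (v z : ℂ) :
    pd v (fun z => L (f z) (g z)) z = L (pd v f z) (g z) + L (f z) (pd v g z) := by
  unfold pd
  have := (L.hasFDerivAt_of_bilinear (hf z).hasFDerivAt (hg z).hasFDerivAt).fderiv
  rw [this]
  simp [add_comm]

lemma fderiv_apply_eq (f : ℂ → F) (z w : ℂ) :
    fderiv ℝ f z w = w.re • pd 1 f z + w.im • pd Complex.I f z := by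
  unfold pd
  rw [← map_smul, ← map_smul, ← map_add]
  congr 1
  apply Complex.ext <;> simp

lemma laplacian_eq {f : ℂ → F} (hf : ContDiff ℝ ∞ f) (z : ℂ) :
    Laplacian.laplacian f z = pd 1 (pd 1 f) z + pd Complex.I (pd Complex.I f) z := by
  rw [InnerProductSpace.laplacian_eq_iteratedFDeriv_complexPlane, pd_pd hf, pd_pd hf]
  simp [iteratedFDeriv_two_apply]

end Derivatives

lemma differentiable_expI {β : ℂ → ℝ} (hβ : Differentiable ℝ β) :
    Differentiable ℝ (fun z => Complex.exp (Complex.I * (β z : ℂ))) := fun z =>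
  (((Complex.ofRealCLM.differentiableAt).comp z (hβ z)).const_mul Complex.I).cexp

lemma contDiff_expI {β : ℂ → ℝ} (hβ : ContDiff ℝ ∞ β) :
    ContDiff ℝ ∞ (fun z => Complex.exp (Complex.I * (β z : ℂ))) :=
  (contDiff_const.mul (Complex.ofRealCLM.contDiff.comp hβ)).cexp

lemma pd_expI {β : ℂ → ℝ} (hβ : Differentiable ℝ β) (v z : ℂ) :
    pd v (fun z => Complex.exp (Complex.I * (β z : ℂ))) z =
      Complex.I * ((pd v β z : ℝ) : ℂ) * Complex.exp (Complex.I * (β z : ℂ)) := by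
  have h1 : HasFDerivAt (fun z => (β z : ℂ)) (Complex.ofRealCLM.comp (fderiv ℝ β z)) z :=
    Complex.ofRealCLM.hasFDerivAt.comp z (hβ z).hasFDerivAt
  have h2 := ((h1.const_mul Complex.I).cexp).fderiv
  unfold pd
  rw [h2]
  simp; ring

/-- The second order equation satisfied by a solution of `X_y = e^{iβ} K X_x`. -/
lemma laplace_of_first_order {X : ℂ → E4} {β : ℂ → ℝ} (hX : ContDiff ℝ ∞ X)
    (hβ : ContDiff ℝ ∞ β)
    (h : ∀ z, dy X z = Lmul (Complex.exp (Complex.I * (β z : ℂ))) (K (dx X z))) (z : ℂ) :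
    pd 1 (pd 1 X) z + pd Complex.I (pd Complex.I X) z =
      J (pd 1 β z • dx X z + pd Complex.I β z • dy X z) := by
  have hβ' := differentiable_of_smooth hβ
  have hx := contDiff_pd hX 1
  have hy := contDiff_pd hX Complex.I
  have hKx : Differentiable ℝ (fun z => K (dx X z)) := fun z =>
    (KL.differentiable _).comp z (differentiable_of_smooth hx z)
  have hKy : Differentiable ℝ (fun z => K (dy X z)) := fun z =>
    (KL.differentiable _).comp z (differentiable_of_smooth hy z)
  have e1 : pd Complex.I X = fun z => LmulL (Complex.exp (Complex.I * (β z : ℂ))) (K (dx X z)) :=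
    funext h
  -- Applying e^{iβ} K twice gives -1, so the equation can be solved for X_x as well.
  have h' : ∀ z, dx X z = -Lmul (Complex.exp (Complex.I * (β z : ℂ))) (K (dy X z)) := by
    intro z
    have hn : star (Complex.exp (Complex.I * (β z : ℂ))) =
        Complex.exp (-(Complex.I * (β z : ℂ))) := by
      rw [Complex.star_def, ← Complex.exp_conj]; simp
    rw [h z, K_Lmul, Lmul_Lmul, K_K, hn, ← Complex.exp_add]
    simp
  have e2 : pd 1 X = fun z => -LmulL (Complex.exp (Complex.I * (β z : ℂ))) (K (dy X z)) :=
    funext h'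
  have d1 : pd Complex.I (pd Complex.I X) z =
      J (pd Complex.I β z • dy X z) +
        Lmul (Complex.exp (Complex.I * (β z : ℂ))) (K (pd Complex.I (pd 1 X) z)) := by
    rw [e1, pd_bilin LmulL (differentiable_expI hβ') hKx, pd_expI hβ', h z, ← I_Lmul,
      ← ofReal_Lmul, Lmul_Lmul, Lmul_Lmul]
    congr 1
    exact congrArg _ (pd_clm KL (differentiable_of_smooth hx) _ _)
  have d2 : pd 1 (pd 1 X) z =
      J (pd 1 β z • dx X z) -
        Lmul (Complex.exp (Complex.I * (β z : ℂ))) (K (pd 1 (pd Complex.I X) z)) := by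
    rw [e2, pd_neg, pd_bilin LmulL (differentiable_expI hβ') hKy, pd_expI hβ', h' z, ← I_Lmul,
      ← ofReal_Lmul, Lmul_neg, Lmul_neg, Lmul_Lmul, Lmul_Lmul, neg_add, sub_eq_add_neg]
    congr 2
    exact congrArg _ (pd_clm KL (differentiable_of_smooth hy) _ _)
  -- The two terms with mixed second derivatives cancel by symmetry; only derivatives of β remain.
  rw [d1, d2, pd_comm hX 1 Complex.I, ← I_Lmul, ← I_Lmul, ← I_Lmul, Lmul_add]
  abel

/-! ### The first variation of area -/

-- The integrand is only controlled near t = 0, on an open neighbourhood of {0} × S. The tube lemma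
-- yields one time interval valid for all of S, and compactness gives the dominating constant.
open MeasureTheory Topology in
lemma hasDerivAt_setIntegral_of_isCompact {S : Set ℂ} (hS : IsCompact S) {f f' : ℝ → ℂ → ℝ}
    {U : Set (ℝ × ℂ)} (hU : IsOpen U) (hSU : {(0 : ℝ)} ×ˢ S ⊆ U)
    (hf : ContinuousOn (fun p : ℝ × ℂ => f p.1 p.2) U)
    (hf' : ContinuousOn (fun p : ℝ × ℂ => f' p.1 p.2) U)
    (hd : ∀ p ∈ U, HasDerivAt (fun t => f t p.2) (f' p.1 p.2) p.1) :
    HasDerivAt (fun t => ∫ z in S, f t z) (∫ z in S, f' 0 z) 0 := by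
  obtain ⟨V, W, hV, -, h0V, hSW, hVW⟩ :=
    generalized_tube_lemma (isCompact_singleton (x := (0 : ℝ))) hS hU hSU
  have h0 : (0 : ℝ) ∈ V := h0V rfl
  obtain ⟨ε, hε, hεV⟩ := Metric.nhds_basis_closedBall.mem_iff.1 (hV.mem_nhds h0)
  have hsub : Metric.closedBall (0 : ℝ) ε ×ˢ S ⊆ U :=
    (Set.prod_mono hεV hSW).trans hVW
  obtain ⟨C, hC⟩ := ((isCompact_closedBall (0 : ℝ) ε).prod hS).exists_bound_of_continuousOn
    (hf'.mono hsub)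
  have slice : ∀ {g : ℝ → ℂ → ℝ}, ContinuousOn (fun p : ℝ × ℂ => g p.1 p.2) U →
      ∀ t ∈ Metric.closedBall (0 : ℝ) ε, ContinuousOn (g t) S := by
    intro g hg t ht
    exact (hg.mono hsub).comp (f := fun z : ℂ => (t, z)) (by fun_prop) fun z hz => ⟨ht, hz⟩
  have hmem : (0 : ℝ) ∈ Metric.closedBall (0 : ℝ) ε := Metric.mem_closedBall_self hε.le
  refine (hasDerivAt_integral_of_dominated_loc_of_deriv_le (bound := fun _ => C)
    (Metric.ball_mem_nhds (0 : ℝ) hε) ?_ ?_ ?_ ?_ ?_ ?_).2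
  · filter_upwards [Metric.closedBall_mem_nhds (0 : ℝ) hε] with t ht
    exact (slice hf t ht).aestronglyMeasurable hS.measurableSet
  · exact (slice hf 0 hmem).integrableOn_compact hS
  · exact (slice hf' 0 hmem).aestronglyMeasurable hS.measurableSet
  · refine (ae_restrict_iff' hS.measurableSet).2 (Filter.Eventually.of_forall fun z hz t ht => ?_)
    exact hC (t, z) ⟨Metric.ball_subset_closedBall ht, hz⟩
  · exact integrableOn_const (hS.measure_lt_top.ne)
  · refine (ae_restrict_iff' hS.measurableSet).2 (Filter.Eventually.of_forall fun z hz t ht => ?_)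
    exact hd (t, z) (hsub ⟨Metric.ball_subset_closedBall ht, hz⟩)

/-- The Gram determinant of two vectors. -/
def gram (v w : E4) : ℝ := ‖v‖ ^ 2 * ‖w‖ ^ 2 - (inner ℝ v w) ^ 2

/-- The derivative of `gram (a + t c) (b + t d)` with respect to `t`. -/
def gramDeriv (a b c d : E4) (t : ℝ) : ℝ :=
  2 * inner ℝ (a + t • c) c * ‖b + t • d‖ ^ 2 + ‖a + t • c‖ ^ 2 * (2 * inner ℝ (b + t • d) d) -
    2 * inner ℝ (a + t • c) (b + t • d) *
      (inner ℝ (a + t • c) d + inner ℝ c (b + t • d))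

lemma hasDerivAt_gram (a b c d : E4) (t : ℝ) :
    HasDerivAt (fun t : ℝ => gram (a + t • c) (b + t • d)) (gramDeriv a b c d t) t := by
  have h1 : ∀ a c : E4, HasDerivAt (fun t : ℝ => a + t • c) c t := fun a c => by
    simpa using ((hasDerivAt_id t).smul_const c).const_add a
  have h2 := (h1 a c).norm_sq
  have h3 := (h1 b d).norm_sq
  have h4 := (h1 a c).inner ℝ (h1 b d)
  have h5 := (h2.mul h3).sub (h4.pow 2)
  refine h5.congr_deriv ?_
  unfold gramDeriv
  simp

lemma dx_add_smul {X V : ℂ → E4} (hX : Differentiable ℝ X) (hV : Differentiable ℝ V) (t : ℝ)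
    (z : ℂ) : dx (fun z => X z + t • V z) z = dx X z + t • dx V z := by
  unfold dx
  rw [fderiv_fun_add (g := fun z => t • V z) (hX z) ((hV z).const_smul t), fderiv_fun_const_smul (hV z)]
  rfl

lemma dy_add_smul {X V : ℂ → E4} (hX : Differentiable ℝ X) (hV : Differentiable ℝ V) (t : ℝ)
    (z : ℂ) : dy (fun z => X z + t • V z) z = dy X z + t • dy V z := by
  unfold dy
  rw [fderiv_fun_add (g := fun z => t • V z) (hX z) ((hV z).const_smul t), fderiv_fun_const_smul (hV z)]
  rfl

lemma mem_regularSet_iff {X : ℂ → E4} {β : ℂ → ℝ} (h : IsWeaklyConformalLagrangian X β) (z : ℂ) :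
    z ∈ regularSet X ↔ dx X z ≠ 0 := by
  refine not_congr ⟨fun h0 => by simp [dx, h0], fun h0 => ?_⟩
  have h1 : dy X z = 0 := by rw [← norm_eq_zero, ← h.norm_eq z, h0, norm_zero]
  ext1 w
  rw [fderiv_apply_eq, ← dx_eq_pd, ← dy_eq_pd, h0, h1]
  simp

lemma isOpen_regularSet {X : ℂ → E4} (hX : ContDiff ℝ ∞ X) : IsOpen (regularSet X) :=
  isOpen_ne_fun (hX.continuous_fderiv (by simp)) continuous_const

/-- At a conformal map, area and Dirichlet energy have the same first variation: the cross term is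
quadratic in ⟨X_x, X_y⟩ = 0. On the support of V the Gram determinant at t = 0 is |X_x|⁴ > 0, so the
square root is differentiable nearby. -/
lemma hasDerivAt_area {X V : ℂ → E4} {β : ℂ → ℝ} (h : IsWeaklyConformalLagrangian X β)
    (hV : ContDiff ℝ ∞ V) (hc : HasCompactSupport V) (hs : tsupport V ⊆ regularSet X) :
    HasDerivAt (fun t : ℝ => area (tsupport V) (fun z => X z + t • V z))
      (∫ z in tsupport V, (inner ℝ (dx X z) (dx V z) + inner ℝ (dy X z) (dy V z) : ℝ)) 0 := by
  have hX' := differentiable_of_smooth h.smooth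
  have hV' := differentiable_of_smooth hV
  have c1 : Continuous (dx X) := (contDiff_pd h.smooth 1).continuous
  have c2 : Continuous (dy X) := (contDiff_pd h.smooth Complex.I).continuous
  have c3 : Continuous (dx V) := (contDiff_pd hV 1).continuous
  have c4 : Continuous (dy V) := (contDiff_pd hV Complex.I).continuous
  have hg : Continuous (fun p : ℝ × ℂ =>
      gram (dx X p.2 + p.1 • dx V p.2) (dy X p.2 + p.1 • dy V p.2)) := by
    unfold gram; fun_prop
  have hg' : Continuous (fun p : ℝ × ℂ =>
      gramDeriv (dx X p.2) (dy X p.2) (dx V p.2) (dy V p.2) p.1) := by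
    unfold gramDeriv; fun_prop
  have hU : IsOpen {p : ℝ × ℂ | 0 < gram (dx X p.2 + p.1 • dx V p.2) (dy X p.2 + p.1 • dy V p.2)} :=
    isOpen_lt continuous_const hg
  have e2 : ∀ z, gram (dx X z + (0 : ℝ) • dx V z) (dy X z + (0 : ℝ) • dy V z) =
      (‖dx X z‖ ^ 2) ^ 2 := by
    intro z
    simp only [zero_smul, add_zero, gram, h.orthogonal z, ← h.norm_eq z]; ring
  have key := hasDerivAt_setIntegral_of_isCompact hc.isCompact
    (f := fun t z => Real.sqrt (gram (dx X z + t • dx V z) (dy X z + t • dy V z)))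
    (f' := fun t z => gramDeriv (dx X z) (dy X z) (dx V z) (dy V z) t /
      (2 * Real.sqrt (gram (dx X z + t • dx V z) (dy X z + t • dy V z)))) hU ?_ ?_ ?_ ?_
  · have e1 : (fun t : ℝ => area (tsupport V) (fun z => X z + t • V z)) = fun t =>
        ∫ z in tsupport V, Real.sqrt (gram (dx X z + t • dx V z) (dy X z + t • dy V z)) := by
      funext t
      unfold area gram
      simp only [dx_add_smul hX' hV', dy_add_smul hX' hV']
    rw [e1]
    refine key.congr_deriv ?_
    refine MeasureTheory.setIntegral_congr_fun hc.isCompact.measurableSet fun z hz => ?_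
    have hz' : dx X z ≠ 0 := (mem_regularSet_iff h z).1 (hs hz)
    have hn : ‖dx X z‖ ≠ 0 := norm_ne_zero_iff.2 hz'
    rw [e2 z, Real.sqrt_sq (by positivity)]
    simp only [gramDeriv, zero_smul, add_zero, h.orthogonal z, ← h.norm_eq z]
    field_simp
    ring
  · rintro ⟨t, z⟩ ⟨rfl, hz⟩
    have hz' : dx X z ≠ 0 := (mem_regularSet_iff h z).1 (hs hz)
    have hn : 0 < ‖dx X z‖ := norm_pos_iff.2 hz'
    change 0 < gram (dx X z + (0 : ℝ) • dx V z) (dy X z + (0 : ℝ) • dy V z)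
    rw [e2]
    positivity
  · exact hg.sqrt.continuousOn
  · refine hg'.continuousOn.div (continuous_const.mul hg.sqrt).continuousOn ?_
    intro p hp
    have := Real.sqrt_pos.2 hp
    exact (mul_pos two_pos this).ne'
  · intro p hp
    exact (hasDerivAt_gram _ _ _ _ _).sqrt (ne_of_gt hp)

section Parts

variable {F : Type*} [NormedAddCommGroup F] [InnerProductSpace ℝ F]

lemma pd_eq_zero_of_notMem_tsupport {f : ℂ → F} {z : ℂ} (hz : z ∉ tsupport f) (v : ℂ) :
    pd v f z = 0 := by
  have : fderiv ℝ f z = 0 := by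
    by_contra h
    exact hz (support_fderiv_subset ℝ h)
  simp [pd, this]

lemma integrable_inner_of_hasCompactSupport {f g : ℂ → F} (hf : Continuous f) (hg : Continuous g)
    (hc : HasCompactSupport g) : MeasureTheory.Integrable (fun z => (inner ℝ (f z) (g z) : ℝ)) := by
  refine (hf.inner hg).integrable_of_hasCompactSupport (hc.mono ?_)
  intro z hz h0
  exact hz (by simp only [h0, inner_zero_right])

lemma hasCompactSupport_pd {f : ℂ → F} (hc : HasCompactSupport f) (v : ℂ) :
    HasCompactSupport (pd v f) := hc.fderiv_apply ℝ v

lemma integral_inner_pd {f g : ℂ → F} (hf : ContDiff ℝ ∞ f) (hg : ContDiff ℝ ∞ g)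
    (hc : HasCompactSupport g) (v : ℂ) :
    ∫ z, (inner ℝ (f z) (pd v g z) : ℝ) = -∫ z, (inner ℝ (pd v f z) (g z) : ℝ) :=
  integral_bilinear_fderiv_right_eq_neg_left_of_integrable (B := innerSL ℝ) (v := v)
    (integrable_inner_of_hasCompactSupport (contDiff_pd hf v).continuous hg.continuous hc)
    (integrable_inner_of_hasCompactSupport hf.continuous (contDiff_pd hg v).continuous
      (hasCompactSupport_pd hc v))
    (integrable_inner_of_hasCompactSupport hf.continuous hg.continuous hc)
    (fun z _ => differentiable_of_smooth hf z) (fun z _ => differentiable_of_smooth hg z)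

lemma integral_inner_gradient {f g : ℂ → F} (hf : ContDiff ℝ ∞ f) (hg : ContDiff ℝ ∞ g)
    (hc : HasCompactSupport g) :
    ∫ z, (inner ℝ (pd 1 f z) (pd 1 g z) + inner ℝ (pd Complex.I f z) (pd Complex.I g z) : ℝ) =
      -∫ z, (inner ℝ (pd 1 (pd 1 f) z + pd Complex.I (pd Complex.I f) z) (g z) : ℝ) := by
  have h1 := contDiff_pd hf 1
  have h2 := contDiff_pd hf Complex.I
  have i1 := fun (v w : ℂ) => integrable_inner_of_hasCompactSupport (contDiff_pd hf v).continuous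
    (contDiff_pd hg w).continuous (hasCompactSupport_pd hc w)
  have i2 := fun (v w : ℂ) => integrable_inner_of_hasCompactSupport
    (contDiff_pd (contDiff_pd hf v) w).continuous hg.continuous hc
  rw [MeasureTheory.integral_add (i1 _ _) (i1 _ _), integral_inner_pd h1 hg hc,
    integral_inner_pd h2 hg hc, ← neg_add, ← MeasureTheory.integral_add (i2 _ _) (i2 _ _)]
  simp only [inner_add_left]

end Parts

/-- The first variation of area under the Hamiltonian variation generated by `φ`. -/
lemma first_variation {X V : ℂ → E4} {β φ : ℂ → ℝ} (h : IsWeaklyConformalLagrangian X β)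
    (hV : ContDiff ℝ ∞ V) (hc : HasCompactSupport V) (hφ : ContDiff ℝ ∞ φ)
    (hφc : HasCompactSupport φ)
    (hVφ : ∀ z w : ℂ, omega (V z) (fderiv ℝ X z w) = fderiv ℝ φ z w) :
    ∫ z in tsupport V, (inner ℝ (dx X z) (dx V z) + inner ℝ (dy X z) (dy V z) : ℝ) =
      -∫ z, φ z * Laplacian.laplacian β z := by
  rw [MeasureTheory.setIntegral_eq_integral_of_forall_compl_eq_zero]
  swap
  · intro z hz
    rw [dx_eq_pd V, dy_eq_pd V, pd_eq_zero_of_notMem_tsupport hz, pd_eq_zero_of_notMem_tsupport hz]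
    simp
  have e1 := integral_inner_gradient h.smooth hV hc
  have e2 := integral_inner_gradient h.smooth_angle hφ hφc
  have hfo := ((isWeaklyConformalLagrangian_iff X β).1 h).2.2
  simp only [dx_eq_pd, dy_eq_pd]
  have e3 : ∀ z, (inner ℝ (pd 1 (pd 1 X) z + pd Complex.I (pd Complex.I X) z) (V z) : ℝ) =
      -(inner ℝ (pd 1 β z) (pd 1 φ z) + inner ℝ (pd Complex.I β z) (pd Complex.I φ z)) := by
    intro z
    rw [laplace_of_first_order h.smooth h.smooth_angle hfo z]
    -- ⟨J ·, V⟩ is ω by definition, so the Hamiltonian condition converts the pairing with ΔX into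
    -- one of ∇β with ∇φ, ready for a second integration by parts.
    change omega _ _ = _
    rw [omega_swap]
    have h1 := hVφ z 1
    have h2 := hVφ z Complex.I
    have h3 : omega (V z) (pd 1 β z • dx X z + pd Complex.I β z • dy X z) =
        pd 1 β z * omega (V z) (dx X z) + pd Complex.I β z * omega (V z) (dy X z) := by
      simp only [omega, inner_add_right, inner_smul_right]
    rw [h3]
    simp only [dx, dy, h1, h2, pd]
    simp [mul_comm]
  rw [e1]
  simp only [e3]
  rw [MeasureTheory.integral_neg, neg_neg, e2]
  simp only [laplacian_eq h.smooth_angle]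
  rfl

lemma critical_of_harmonic {X : ℂ → E4} {β : ℂ → ℝ} (h : IsWeaklyConformalLagrangian X β)
    (hβ : ∀ z, Laplacian.laplacian β z = 0) : IsHamiltonianStationary X β where
  toIsWeaklyConformalLagrangian := h
  critical := fun V hV => by
    obtain ⟨φ, hφ, hφc, hVφ⟩ := hV.hamiltonian
    have h1 := hasDerivAt_area h hV.smooth hV.compact_support hV.support_subset
    rw [first_variation h hV.smooth hV.compact_support hφ hφc hVφ] at h1
    simpa [hβ] using h1
  harmonic_of_not_mem := fun z _ => hβ z

/-- The Hamiltonian vector field along `X` generated by `φ`. -/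
def hamField (X : ℂ → E4) (φ : ℂ → ℝ) (z : ℂ) : E4 :=
  -((‖dx X z‖ ^ 2)⁻¹ • J (pd 1 φ z • dx X z + pd Complex.I φ z • dy X z))

/-- X_x and X_y are orthogonal of equal length, so dividing by |X_x|² inverts dX on its image. The
division does no harm to smoothness, because the field vanishes off the support of φ, which lies in
the regular set. -/
lemma isHamiltonianVariation_hamField {X : ℂ → E4} {β φ : ℂ → ℝ}
    (h : IsWeaklyConformalLagrangian X β) (hφ : ContDiff ℝ ∞ φ) (hφc : HasCompactSupport φ)
    (hs : tsupport φ ⊆ regularSet X) :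
    IsHamiltonianVariation X (hamField X φ) ∧ ∀ z w : ℂ,
      omega (hamField X φ z) (fderiv ℝ X z w) = fderiv ℝ φ z w := by
  have hsub : Function.support (hamField X φ) ⊆ tsupport φ := by
    intro z hz
    by_contra hz'
    apply hz
    simp [hamField, pd_eq_zero_of_notMem_tsupport hz', ← I_Lmul]
  have hts : tsupport (hamField X φ) ⊆ tsupport φ := closure_minimal hsub (isClosed_tsupport φ)
  have hsm : ContDiff ℝ ∞ (hamField X φ) := by
    rw [contDiff_iff_contDiffAt]
    intro z
    by_cases hz : z ∈ tsupport φ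
    · have hz' := (mem_regularSet_iff h z).1 (hs hz)
      have hn : ‖dx X z‖ ^ 2 ≠ 0 := by simpa using hz'
      have c1 : ContDiff ℝ ∞ (dx X) := contDiff_pd h.smooth 1
      have c2 : ContDiff ℝ ∞ (dy X) := contDiff_pd h.smooth Complex.I
      have c3 := contDiff_pd hφ 1
      have c4 := contDiff_pd hφ Complex.I
      refine (((c1.norm_sq ℝ).contDiffAt.inv hn).smul ?_).neg
      exact ((LmulL Complex.I).contDiff.comp
        ((c3.smul c1).add (c4.smul c2))).contDiffAt.congr_of_eventuallyEq
        (Filter.Eventually.of_forall fun w => (I_Lmul _).symm)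
    · have : hamField X φ =ᶠ[nhds z] fun _ => 0 := by
        filter_upwards [(isClosed_tsupport φ).isOpen_compl.mem_nhds hz] with w hw
        by_contra h0
        exact hw (hsub h0)
      exact contDiffAt_const.congr_of_eventuallyEq this
  have key : ∀ z w : ℂ, omega (hamField X φ z) (fderiv ℝ X z w) = fderiv ℝ φ z w := by
    intro z w
    by_cases hz : z ∈ tsupport φ
    · have hz' := (mem_regularSet_iff h z).1 (hs hz)
      have hn : ‖dx X z‖ ≠ 0 := by simpa using hz'
      have hJ : J (hamField X φ z) =
          (‖dx X z‖ ^ 2)⁻¹ • (pd 1 φ z • dx X z + pd Complex.I φ z • dy X z) := by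
        apply E4.ext <;> simp [hamField] <;> ring
      rw [omega, hJ, fderiv_apply_eq, fderiv_apply_eq, ← dx_eq_pd, ← dy_eq_pd]
      simp only [inner_smul_left, inner_add_left, inner_smul_right, inner_add_right,
        h.orthogonal z, real_inner_comm (dx X z) (dy X z), real_inner_self_eq_norm_sq,
        ← h.norm_eq z]
      simp only [RCLike.conj_to_real, smul_eq_mul, mul_zero, add_zero, zero_add]
      field_simp
    · have h1 : hamField X φ z = 0 := by
        by_contra h0
        exact hz (hsub h0)
      rw [h1, fderiv_apply_eq φ, pd_eq_zero_of_notMem_tsupport hz, pd_eq_zero_of_notMem_tsupport hz]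
      simp [omega_E4]
  exact ⟨⟨hsm, hφc.mono' hsub, hts.trans hs, φ, hφ, hφc, key⟩, key⟩

lemma continuous_laplacian {β : ℂ → ℝ} (hβ : ContDiff ℝ ∞ β) :
    Continuous (Laplacian.laplacian β) := by
  have : Laplacian.laplacian β = fun z => pd 1 (pd 1 β) z + pd Complex.I (pd Complex.I β) z :=
    funext (laplacian_eq hβ)
  rw [this]
  exact (contDiff_pd (contDiff_pd hβ _) _).continuous.add
    (contDiff_pd (contDiff_pd hβ _) _).continuous

/-- Every test function supported in the regular set generates an admissible variation, so Δβ
vanishes there by the fundamental lemma of the calculus of variations; at zeros of dX harmonicity is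
part of the definition. -/
lemma harmonic_of_stationary {X : ℂ → E4} {β : ℂ → ℝ} (h : IsHamiltonianStationary X β) (z : ℂ) :
    Laplacian.laplacian β z = 0 := by
  by_cases hz : z ∈ regularSet X
  swap
  · exact h.harmonic_of_not_mem z hz
  have hw := h.toIsWeaklyConformalLagrangian
  have hcont := continuous_laplacian h.smooth_angle
  have hopen := isOpen_regularSet h.smooth
  have hae := hopen.ae_eq_zero_of_integral_contDiff_smul_eq_zero
    (μ := MeasureTheory.volume) (hcont.locallyIntegrable.locallyIntegrableOn _) (by
      intro φ hφ hφc hs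
      obtain ⟨h1, h2⟩ := isHamiltonianVariation_hamField hw hφ hφc hs
      have h3 := hasDerivAt_area hw h1.smooth h1.compact_support h1.support_subset
      rw [first_variation hw h1.smooth h1.compact_support hφ hφc h2] at h3
      simpa using h3.unique (h.critical _ h1))
  have hrest : ∀ᵐ w ∂(MeasureTheory.volume.restrict (regularSet X)),
      Laplacian.laplacian β w = 0 :=
    (MeasureTheory.ae_restrict_iff' hopen.measurableSet).2 hae
  exact MeasureTheory.Measure.eqOn_open_of_ae_eq (g := fun _ => (0 : ℝ)) hrest hopen
    hcont.continuousOn continuousOn_const hz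

/-! ### Plane waves -/

lemma inner_complex (η z : ℂ) : (inner ℝ η z : ℝ) = η.re * z.re + η.im * z.im := by
  simp [Complex.inner, mul_comm]

/-- The function `e^{2πi⟨η, z⟩}`. -/
def planeWave (η z : ℂ) : ℂ := Complex.exp (Complex.I * ((2 * Real.pi * inner ℝ η z : ℝ) : ℂ))

lemma planeWave_add_left (η ξ z : ℂ) : planeWave (η + ξ) z = planeWave η z * planeWave ξ z := by
  unfold planeWave
  rw [← Complex.exp_add, inner_add_left]
  congr 1; push_cast; ring

lemma planeWave_add_right (η z w : ℂ) : planeWave η (z + w) = planeWave η z * planeWave η w := by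
  unfold planeWave
  rw [← Complex.exp_add, inner_add_right]
  congr 1; push_cast; ring

@[simp] lemma planeWave_zero_left (z : ℂ) : planeWave 0 z = 1 := by simp [planeWave]
@[simp] lemma planeWave_zero_right (z : ℂ) : planeWave z 0 = 1 := by simp [planeWave]

lemma star_planeWave (η z : ℂ) : star (planeWave η z) = planeWave (-η) z := by
  unfold planeWave
  rw [Complex.star_def, ← Complex.exp_conj]
  congr 1
  rw [map_mul, Complex.conj_I, Complex.conj_ofReal, inner_neg_left]
  push_cast; ring

lemma contDiff_inner_left (η : ℂ) (c : ℝ) : ContDiff ℝ ∞ (fun z : ℂ => c * (inner ℝ η z : ℝ)) :=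
  contDiff_const.mul (contDiff_const.inner ℝ contDiff_id)

lemma pd_inner_left (η : ℂ) (c : ℝ) (v z : ℂ) :
    pd v (fun z : ℂ => c * (inner ℝ η z : ℝ)) z = c * inner ℝ η v := by
  have h : HasFDerivAt (fun z : ℂ => c * (inner ℝ η z : ℝ)) (c • innerSL ℝ η) z :=
    ((innerSL ℝ η).hasFDerivAt).const_mul c
  unfold pd
  rw [h.fderiv]; simp

lemma contDiff_planeWave (η : ℂ) : ContDiff ℝ ∞ (planeWave η) :=
  contDiff_expI (contDiff_inner_left η (2 * Real.pi))

lemma pd_planeWave (η v z : ℂ) :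
    pd v (planeWave η) z =
      2 * (Real.pi : ℂ) * Complex.I * ((inner ℝ η v : ℝ) : ℂ) * planeWave η z := by
  have := pd_expI (differentiable_of_smooth (contDiff_inner_left η (2 * Real.pi))) v z
  rw [pd_inner_left] at this
  refine this.trans ?_
  unfold planeWave
  push_cast; ring

lemma planeWave_eq_one_iff (η g : ℂ) :
    planeWave η g = 1 ↔ ∃ n : ℤ, (inner ℝ η g : ℝ) = n := by
  unfold planeWave
  rw [Complex.exp_eq_one_iff]
  have hpi : (Real.pi : ℂ) ≠ 0 := Complex.ofReal_ne_zero.2 Real.pi_ne_zero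
  refine exists_congr fun n => ⟨fun h => ?_, fun h => ?_⟩
  · have h2 : (2 * (Real.pi : ℂ) * Complex.I) * ((inner ℝ η g : ℝ) : ℂ) =
        (2 * (Real.pi : ℂ) * Complex.I) * (n : ℂ) := by
      rw [← mul_comm (n : ℂ), ← h]; push_cast; ring
    exact_mod_cast mul_left_cancel₀ Complex.two_pi_I_ne_zero h2
  · rw [h]; push_cast; ring

lemma planeWave_periodic {Γ : Submodule ℤ ℂ} {η : ℂ} (hη : η ∈ dualLattice Γ) {g : ℂ}
    (hg : g ∈ Γ) (z : ℂ) : planeWave η (z + g) = planeWave η z := by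
  rw [planeWave_add_right, (planeWave_eq_one_iff η g).2 (hη g hg), mul_one]

lemma planeWave_injective : Function.Injective planeWave := by
  intro η ξ h
  have h0 : ∀ v : ℂ, (inner ℝ η v : ℝ) = inner ℝ ξ v := by
    intro v
    have h1 := pd_planeWave η v 0
    rw [h, pd_planeWave] at h1
    simp only [planeWave_zero_right, mul_one] at h1
    have := mul_left_cancel₀ Complex.two_pi_I_ne_zero h1
    exact_mod_cast this.symm
  exact ext_inner_right ℝ h0

/-- Distinct plane waves are linearly independent. -/
lemma linearIndependent_planeWave : LinearIndependent ℂ planeWave := by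
  -- Plane waves are characters of the additive group ℂ, so Dedekind's independence of characters
  -- applies.
  let φ : ℂ → (Multiplicative ℂ →* ℂ) := fun η =>
    { toFun := fun z => planeWave η z.toAdd
      map_one' := planeWave_zero_right η
      map_mul' := fun z w => planeWave_add_right η _ _ }
  have hφ : Function.Injective φ := fun η ξ h =>
    planeWave_injective (funext fun z => DFunLike.congr_fun h (Multiplicative.ofAdd z))
  exact (linearIndependent_monoidHom (Multiplicative ℂ) ℂ).comp φ hφ

/-- The coordinates of `E4 = ℂ²`. -/
def fstC (v : E4) : ℂ := ⟨v 0, v 1⟩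
/-- The second complex coordinate of `E4 = ℂ²`. -/
def sndC (v : E4) : ℂ := ⟨v 2, v 3⟩

lemma fstC_Lmul (p : ℂ) (v : E4) : fstC (Lmul p v) = p * fstC v := by
  apply Complex.ext <;> simp [fstC]
lemma sndC_Lmul (p : ℂ) (v : E4) : sndC (Lmul p v) = p * sndC v := by
  apply Complex.ext <;> simp [sndC]

/-- `fstC` as a continuous linear map. -/
def fstCL : E4 →L[ℝ] ℂ := LinearMap.toContinuousLinearMap
  { toFun := fstC
    map_add' := fun v w => by apply Complex.ext <;> simp [fstC]
    map_smul' := fun r v => by apply Complex.ext <;> simp [fstC] }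
/-- `sndC` as a continuous linear map. -/
def sndCL : E4 →L[ℝ] ℂ := LinearMap.toContinuousLinearMap
  { toFun := sndC
    map_add' := fun v w => by apply Complex.ext <;> simp [sndC]
    map_smul' := fun r v => by apply Complex.ext <;> simp [sndC] }

@[simp] lemma fstCL_apply (v : E4) : fstCL v = fstC v := rfl
@[simp] lemma sndCL_apply (v : E4) : sndCL v = sndC v := rfl

lemma E4.ext_C {v w : E4} (h1 : fstC v = fstC w) (h2 : sndC v = sndC w) : v = w :=
  E4.ext (congrArg Complex.re h1) (congrArg Complex.im h1) (congrArg Complex.re h2)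
    (congrArg Complex.im h2)

/-- The vector of `E4 = ℂ²` with given complex coordinates. -/
def mkC (a b : ℂ) : E4 := !₂[a.re, a.im, b.re, b.im]

@[simp] lemma fstC_mkC (a b : ℂ) : fstC (mkC a b) = a := rfl
@[simp] lemma sndC_mkC (a b : ℂ) : sndC (mkC a b) = b := rfl

/-- Uniqueness of the coefficients of a vector valued trigonometric polynomial. -/
lemma coeff_eq_zero {T : Finset ℂ} {c : ℂ → E4}
    (h : ∀ z, ∑ η ∈ T, Lmul (planeWave η z) (c η) = 0) : ∀ η ∈ T, c η = 0 := by
  have key : ∀ L : E4 →L[ℝ] ℂ, (∀ p v, L (Lmul p v) = p * L v) → ∀ η ∈ T, L (c η) = 0 := by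
    intro L hL
    refine linearIndependent_iff'.1 linearIndependent_planeWave T (fun η => L (c η)) ?_
    funext z
    have := congrArg L (h z)
    simpa [map_sum, hL, mul_comm] using this
  intro η hη
  exact E4.ext_C ((key fstCL fstC_Lmul η hη).trans fstCL.map_zero.symm)
    ((key sndCL sndC_Lmul η hη).trans sndCL.map_zero.symm)

lemma coeff_unique {T : Finset ℂ} {c d : ℂ → E4}
    (h : ∀ z, ∑ η ∈ T, Lmul (planeWave η z) (c η) = ∑ η ∈ T, Lmul (planeWave η z) (d η)) :
    ∀ η ∈ T, c η = d η := by
  intro η hη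
  refine sub_eq_zero.1 (coeff_eq_zero (c := fun η => c η - d η) (T := T) (fun z => ?_) η hη)
  simp only [Lmul_sub, Finset.sum_sub_distrib, h z, sub_self]

/-! ### Periodic functions and their Fourier series -/

section Torus

set_option linter.unusedSectionVars false

open MeasureTheory

attribute [local instance] instMeasureSpaceUnitAddCircle

local instance : Measure.IsAddHaarMeasure (volume : Measure UnitAddCircle) :=
  inferInstanceAs (Measure.IsAddHaarMeasure AddCircle.haarAddCircle)

local instance : IsProbabilityMeasure (volume : Measure UnitAddCircle) :=
  inferInstanceAs (IsProbabilityMeasure AddCircle.haarAddCircle)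

variable {F : Type*} [NormedAddCommGroup F] [NormedSpace ℝ F]

/-- `Γ`-periodic functions with values in an arbitrary type. -/
def Periodic (Γ : Submodule ℤ ℂ) {α : Type*} (f : ℂ → α) : Prop := ∀ g ∈ Γ, ∀ z, f (z + g) = f z

lemma Periodic.pd {Γ : Submodule ℤ ℂ} {f : ℂ → F} (hf : Periodic Γ f) (v : ℂ) :
    Periodic Γ (pd v f) := by
  intro g hg z
  have h : (fun z => f (z + g)) = f := funext (hf g hg)
  unfold HamStat.pd
  conv_rhs => rw [← h, fderiv_comp_add_right]

variable {ι : Type} [Fintype ι]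

/-- A real basis of the plane that is a `ℤ`-basis of `Γ`. -/
def IsLatticeBasis (Γ : Submodule ℤ ℂ) (b : Module.Basis ι ℝ ℂ) : Prop :=
  ∀ g, g ∈ Γ ↔ ∃ n : ι → ℤ, g = b.equivFun.symm (fun i => (n i : ℝ))

lemma exists_isLatticeBasis (Γ : Submodule ℤ ℂ) [DiscreteTopology Γ] [IsZLattice ℝ Γ] :
    ∃ (ι : Type) (_ : Fintype ι) (b : Module.Basis ι ℝ ℂ), IsLatticeBasis Γ b := by
  have : Module.Finite ℤ Γ := ZLattice.module_finite ℝ Γ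
  have : Module.Free ℤ Γ := ZLattice.module_free ℝ Γ
  let b := Module.Free.chooseBasis ℤ Γ
  refine ⟨_, inferInstance, b.ofZLatticeBasis ℝ Γ, fun g => ⟨fun hg => ?_, ?_⟩⟩
  · refine ⟨fun i => b.repr ⟨g, hg⟩ i, ?_⟩
    rw [Module.Basis.equivFun_symm_apply]
    conv_lhs => rw [← (b.ofZLatticeBasis ℝ Γ).sum_repr g]
    refine Finset.sum_congr rfl fun i _ => ?_
    congr 1
    exact b.ofZLatticeBasis_repr_apply ℝ Γ ⟨g, hg⟩ i
  · rintro ⟨n, rfl⟩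
    rw [Module.Basis.equivFun_symm_apply]
    refine Γ.sum_mem fun i _ => ?_
    rw [b.ofZLatticeBasis_apply ℝ Γ, Int.cast_smul_eq_zsmul]
    exact Γ.smul_mem _ (b i).2

/-- The projection of the plane to the standard torus, in coordinates. -/
def toTorus (x : ι → ℝ) : UnitAddTorus ι := fun i => (x i : UnitAddCircle)

/-- The function on the standard torus induced by a function of the plane. -/
def desc (b : Module.Basis ι ℝ ℂ) {α : Type*} (f : ℂ → α) (t : UnitAddTorus ι) : α :=
  f (b.equivFun.symm fun i => Quotient.out (t i))

lemma isOpenQuotientMap_toTorus : IsOpenQuotientMap (toTorus (ι := ι)) :=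
  IsOpenQuotientMap.piMap (fun _ => QuotientAddGroup.isOpenQuotientMap_mk)

variable {Γ : Submodule ℤ ℂ} {b : Module.Basis ι ℝ ℂ}

/-- The chosen representative differs from x by an integer vector, that is, by an element of Γ. -/
lemma desc_toTorus (hb : IsLatticeBasis Γ b) {α : Type*} {f : ℂ → α} (hf : Periodic Γ f)
    (x : ι → ℝ) : desc b f (toTorus x) = f (b.equivFun.symm x) := by
  have h : ∀ i, ∃ n : ℤ, Quotient.out (toTorus x i) = x i + n := by
    intro i
    have h1 : ((Quotient.out (toTorus x i) : ℝ) : UnitAddCircle) = (x i : UnitAddCircle) :=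
      Quotient.out_eq _
    rw [QuotientAddGroup.eq_iff_sub_mem] at h1
    obtain ⟨n, hn⟩ := AddSubgroup.mem_zmultiples_iff.1 h1
    refine ⟨n, ?_⟩
    rw [zsmul_one] at hn
    linarith
  choose n hn using h
  have h2 : (fun i => (Quotient.out (toTorus x i) : ℝ)) = x + fun i => (n i : ℝ) := funext hn
  unfold desc
  rw [h2, map_add]
  exact hf _ ((hb _).2 ⟨n, rfl⟩) _

lemma continuous_desc (hb : IsLatticeBasis Γ b) {α : Type*} [TopologicalSpace α] {f : ℂ → α}
    (hf : Periodic Γ f) (hc : Continuous f) : Continuous (desc b f) := by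
  rw [isOpenQuotientMap_toTorus.isQuotientMap.continuous_iff]
  have : desc b f ∘ toTorus = f ∘ b.equivFun.symm := funext (desc_toTorus hb hf)
  rw [this]
  exact hc.comp (LinearMap.continuous_of_finiteDimensional b.equivFun.symm.toLinearMap)

lemma desc_surjective (z : ℂ) : ∃ x : ι → ℝ, b.equivFun.symm x = z :=
  b.equivFun.symm.surjective z

lemma exists_bound_of_periodic (hb : IsLatticeBasis Γ b) {f : ℂ → F} (hf : Periodic Γ f)
    (hc : Continuous f) : ∃ C, ∀ z, ‖f z‖ ≤ C := by
  obtain ⟨C, hC⟩ := isCompact_univ.exists_bound_of_continuousOn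
    (continuous_desc hb hf hc).continuousOn
  refine ⟨C, fun z => ?_⟩
  obtain ⟨x, rfl⟩ := desc_surjective (b := b) z
  rw [← desc_toTorus hb hf]
  exact hC _ (Set.mem_univ _)

lemma integrable_of_continuous {g : UnitAddTorus ι → ℂ} (hg : Continuous g) : Integrable g := by
  obtain ⟨C, hC⟩ := isCompact_univ.exists_bound_of_continuousOn hg.continuousOn
  exact Integrable.of_bound hg.aestronglyMeasurable C
    (Filter.Eventually.of_forall fun x => hC x (Set.mem_univ x))

/-- The derivative of a periodic function has mean value zero. -/
lemma integral_desc_pd (hb : IsLatticeBasis Γ b) {f : ℂ → ℂ} (hf : Periodic Γ f)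
    (hs : ContDiff ℝ ∞ f) (v : ℂ) : ∫ t, desc b (pd v f) t = 0 := by
  have hshift : ∀ s : ℝ, Periodic Γ (fun z => f (z + s • v)) := fun s g hg z => by
    simp only; rw [add_right_comm]; exact hf g hg _
  have hshift' : ∀ s : ℝ, Periodic Γ (fun z => pd v f (z + s • v)) := fun s g hg z => by
    simp only; rw [add_right_comm]; exact hf.pd v g hg _
  have hcont : ∀ s : ℝ, Continuous (fun z => f (z + s • v)) := fun s =>
    hs.continuous.comp (continuous_id.add continuous_const)
  -- By translation invariance of Haar measure the mean of f(z + s v) does not depend on s;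
  -- differentiating under the integral at s = 0 gives the claim.
  have hconst : ∀ s : ℝ, ∫ t, desc b (fun z => f (z + s • v)) t = ∫ t, desc b f t := by
    intro s
    rw [← integral_add_right_eq_self (desc b f) (toTorus (b.equivFun (s • v)))]
    congr 1
    funext t
    obtain ⟨x, rfl⟩ := isOpenQuotientMap_toTorus.surjective t
    have : toTorus x + toTorus (b.equivFun (s • v)) = toTorus (x + b.equivFun (s • v)) := rfl
    rw [this, desc_toTorus hb (hshift s), desc_toTorus hb hf, map_add,
      LinearEquiv.symm_apply_apply]
  obtain ⟨C, hC⟩ := exists_bound_of_periodic hb (hf.pd v) (contDiff_pd hs v).continuous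
  have key := (hasDerivAt_integral_of_dominated_loc_of_deriv_le
    (μ := (volume : Measure (UnitAddTorus ι))) (x₀ := (0 : ℝ)) (s := Set.univ)
    (F := fun (s : ℝ) t => desc b (fun z => f (z + s • v)) t)
    (F' := fun (s : ℝ) t => desc b (fun z => pd v f (z + s • v)) t) (bound := fun _ => C)
    Filter.univ_mem
    (Filter.Eventually.of_forall fun s =>
      (continuous_desc hb (hshift s) (hcont s)).aestronglyMeasurable)
    (integrable_of_continuous (continuous_desc hb (hshift 0) (hcont 0)))
    (continuous_desc hb (hshift' 0) ((contDiff_pd hs v).continuous.comp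
      (continuous_id.add continuous_const))).aestronglyMeasurable
    (Filter.Eventually.of_forall fun t s _ => hC _)
    (integrable_const C)
    (Filter.Eventually.of_forall fun t s _ => by
      have h1 : HasDerivAt (fun s : ℝ =>
          b.equivFun.symm (fun i => Quotient.out (t i)) + s • v) v s := by
        simpa using ((hasDerivAt_id s).smul_const v).const_add
          (b.equivFun.symm (fun i => Quotient.out (t i)))
      exact (differentiable_of_smooth hs _).hasFDerivAt.comp_hasDerivAt s h1)).2
  simp only [hconst] at key
  have h0 := key.unique (hasDerivAt_const (0 : ℝ) _)
  simpa using h0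

/-- The linear forms `⟨η, b i⟩`, which identify the dual lattice with the integer vectors. -/
def pairing (b : Module.Basis ι ℝ ℂ) (η : ℂ) (i : ι) : ℝ := inner ℝ η (b i)

lemma pairing_injective : Function.Injective (pairing b) := by
  intro η ξ h
  refine ext_inner_right ℝ fun v => ?_
  have h2 : innerSL ℝ η = innerSL ℝ ξ := by
    ext1 v
    exact LinearMap.congr_fun (b.ext (f₁ := (innerSL ℝ η).toLinearMap)
      (f₂ := (innerSL ℝ ξ).toLinearMap) fun i => congrFun h i) v
  exact DFunLike.congr_fun h2 v

lemma inner_equivFun_symm (η : ℂ) (x : ι → ℝ) :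
    (inner ℝ η (b.equivFun.symm x) : ℝ) = ∑ i, x i * pairing b η i := by
  rw [Module.Basis.equivFun_symm_apply, inner_sum]
  simp only [inner_smul_right, pairing]

lemma mem_dualLattice_iff (hb : IsLatticeBasis Γ b) (η : ℂ) :
    η ∈ dualLattice Γ ↔ ∀ i, ∃ n : ℤ, pairing b η i = n := by
  classical
  constructor
  · intro h i
    refine h (b i) ((hb _).2 ⟨Pi.single i 1, ?_⟩)
    rw [Module.Basis.equivFun_symm_apply, Finset.sum_eq_single i]
    · simp
    · intro j _ hj; simp [hj]
    · simp
  · intro h g hg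
    choose m hm using h
    obtain ⟨n, rfl⟩ := (hb g).1 hg
    refine ⟨∑ i, n i * m i, ?_⟩
    rw [inner_equivFun_symm]
    push_cast
    exact Finset.sum_congr rfl fun i _ => by rw [hm i]

/-- A dual vector is determined by its pairings with the lattice basis, which are integers, bounded
when ‖η‖ is. -/
lemma finite_dualLattice_inter_bounded (hb : IsLatticeBasis Γ b) (R : ℝ) :
    {η | η ∈ dualLattice Γ ∧ ‖η‖ ≤ R}.Finite := by
  obtain ⟨N, hN⟩ : ∃ N : ℤ, ∀ i, R * ‖b i‖ ≤ N := by
    obtain ⟨M, hM⟩ := (Set.finite_range fun i => R * ‖b i‖).bddAbove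
    exact ⟨⌈M⌉, fun i => (hM ⟨i, rfl⟩).trans (Int.le_ceil M)⟩
  refine Set.Finite.of_finite_image (f := pairing b) ?_ pairing_injective.injOn
  have hfin : (Set.univ.pi fun _ : ι => Set.Icc (-N) N).Finite :=
    Set.Finite.pi fun _ => Set.finite_Icc _ _
  refine (hfin.image fun n i => (n i : ℝ)).subset ?_
  rintro _ ⟨η, ⟨h1, h2⟩, rfl⟩
  choose n hn using (mem_dualLattice_iff hb η).1 h1
  refine ⟨n, fun i _ => ?_, (funext hn).symm⟩
  have h3 : |(n i : ℝ)| ≤ N := by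
    rw [← hn i]
    exact (abs_real_inner_le_norm _ _).trans
      ((mul_le_mul_of_nonneg_right h2 (norm_nonneg _)).trans (hN i))
  have h4 := abs_le.1 h3
  exact ⟨by exact_mod_cast h4.1, by exact_mod_cast h4.2⟩

/-- The element of the dual lattice with given integral pairings. -/
def dualVec (b : Module.Basis ι ℝ ℂ) (n : ι → ℤ) : ℂ :=
  (InnerProductSpace.toDual ℝ ℂ).symm
    (LinearMap.toContinuousLinearMap (b.constr ℝ fun i => (n i : ℝ)))

lemma pairing_dualVec (n : ι → ℤ) (i : ι) : pairing b (dualVec b n) i = n i := by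
  unfold pairing dualVec
  rw [InnerProductSpace.toDual_symm_apply]
  exact b.constr_basis ℝ _ i

lemma dualVec_mem (hb : IsLatticeBasis Γ b) (n : ι → ℤ) : dualVec b n ∈ dualLattice Γ :=
  (mem_dualLattice_iff hb _).2 fun i => ⟨n i, pairing_dualVec n i⟩

lemma desc_planeWave (hb : IsLatticeBasis Γ b) (n : ι → ℤ) :
    desc b (planeWave (dualVec b n)) = UnitAddTorus.mFourier n := by
  funext t
  obtain ⟨x, rfl⟩ := isOpenQuotientMap_toTorus.surjective t
  rw [desc_toTorus hb (fun g hg z => planeWave_periodic (dualVec_mem hb n) hg z)]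
  unfold planeWave UnitAddTorus.mFourier toTorus
  rw [inner_equivFun_symm]
  simp only [ContinuousMap.coe_mk, fourier_coe_apply, pairing_dualVec]
  rw [← Complex.exp_sum]
  congr 1
  push_cast
  rw [Finset.mul_sum, Finset.mul_sum]
  exact Finset.sum_congr rfl fun i _ => by ring

lemma dualVec_neg (n : ι → ℤ) : dualVec b (-n) = -dualVec b n := by
  apply pairing_injective (b := b)
  funext i
  rw [pairing_dualVec]
  simp only [pairing, inner_neg_left]
  have := pairing_dualVec (b := b) n i
  simp only [pairing] at this
  rw [this]; simp

/-- Fourier expansion of the periodic solutions of `Δf = 2πi⟨β₀, ∇f⟩`. -/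
theorem exists_coeff_of_laplace (hb : IsLatticeBasis Γ b) {f : ℂ → ℂ} (hf : Periodic Γ f)
    (hs : ContDiff ℝ ∞ f) (β₀ : ℂ)
    (hpde : ∀ z, pd 1 (pd 1 f) z + pd Complex.I (pd Complex.I f) z =
      2 * (Real.pi : ℂ) * Complex.I *
        ((β₀.re : ℂ) * pd 1 f z + (β₀.im : ℂ) * pd Complex.I f z))
    (T : Finset ℂ) (hT : ∀ η, η ∈ T ↔ η ∈ dualLattice Γ ∧ ‖η‖ ^ 2 = inner ℝ β₀ η) :
    ∃ c : ℂ → ℂ, ∀ z, f z = ∑ η ∈ T, planeWave η z * c η := by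
  classical
  let g : C(UnitAddTorus ι, ℂ) := ⟨desc b f, continuous_desc hb hf hs.continuous⟩
  have hcoeff : ∀ n, dualVec b n ∉ T → UnitAddTorus.mFourierCoeff g n = 0 := by
    intro n hn
    set η := dualVec b n with hη
    have hηΓ : η ∈ dualLattice Γ := dualVec_mem hb n
    have hne : (‖η‖ ^ 2 - inner ℝ β₀ η : ℝ) ≠ 0 := fun h =>
      hn ((hT η).2 ⟨hηΓ, sub_eq_zero.1 h⟩)
    have hw := contDiff_planeWave (-η)
    have hwp : Periodic Γ (planeWave (-η)) := fun g hg z =>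
      planeWave_periodic (by rw [hη, ← dualVec_neg]; exact dualVec_mem hb _) hg z
    -- The constant α is chosen so that in ∂_v(e^{-2πi⟨η,z⟩}(∂_v f + α_v f)) the coefficient of ∂_v
    -- f is the one in the equation. Summing over v = 1, i leaves (2π)²(|η|² - ⟨β₀, η⟩)
    -- e^{-2πi⟨η,z⟩} f. Derivatives have mean zero, so the Fourier coefficient vanishes unless η
    -- lies on the circle.
    let α : ℂ → ℂ := fun v => 2 * (Real.pi : ℂ) * Complex.I *
      ((inner ℝ η v - inner ℝ β₀ v : ℝ) : ℂ)
    let H : ℂ → ℂ → ℂ := fun v z => planeWave (-η) z * (pd v f z + α v * f z)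
    have hpv : ∀ v, ContDiff ℝ ∞ (pd v f) := contDiff_pd hs
    have hHs : ∀ v, ContDiff ℝ ∞ (H v) := fun v =>
      hw.mul ((hpv v).add (contDiff_const.mul hs))
    have hHp : ∀ v, Periodic Γ (H v) := fun v g hg z => by
      simp only [H]; rw [hwp g hg z, hf.pd v g hg z, hf g hg z]
    have hHd : ∀ v z, pd v (H v) z = planeWave (-η) z * (pd v (pd v f) z -
        2 * (Real.pi : ℂ) * Complex.I * ((inner ℝ β₀ v : ℝ) : ℂ) * pd v f z -
        2 * (Real.pi : ℂ) * Complex.I * ((inner ℝ η v : ℝ) : ℂ) * α v * f z) := by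
      intro v z
      have e1 : ∀ z, pd v (fun z => pd v f z + α v * f z) z = pd v (pd v f) z + α v * pd v f z := by
        intro z
        rw [pd_add (differentiable_of_smooth (hpv v))
          ((differentiable_of_smooth hs).const_mul (α v))]
        congr 1
        exact pd_clm (ContinuousLinearMap.mul ℝ ℂ (α v)) (differentiable_of_smooth hs) v z
      have e2 := pd_bilin (ContinuousLinearMap.mul ℝ ℂ) (differentiable_of_smooth hw)
        (differentiable_of_smooth ((hpv v).add (contDiff_const.mul hs) :
          ContDiff ℝ ∞ (fun z => pd v f z + α v * f z))) v z
      rw [e1] at e2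
      refine e2.trans ?_
      rw [pd_planeWave]
      simp only [ContinuousLinearMap.mul_apply', inner_neg_left, α]
      push_cast
      ring
    have hsum : ∀ z, pd 1 (H 1) z + pd Complex.I (H Complex.I) z =
        ((2 * (Real.pi : ℂ)) ^ 2 * ((‖η‖ ^ 2 - inner ℝ β₀ η : ℝ) : ℂ)) *
          (planeWave (-η) z * f z) := by
      intro z
      rw [hHd, hHd]
      have h1 := hpde z
      have h2 : (‖η‖ ^ 2 : ℝ) = η.re * η.re + η.im * η.im := by
        rw [← Complex.normSq_eq_norm_sq, Complex.normSq_apply]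
      simp only [α, inner_complex, h2, Complex.one_re, Complex.one_im, Complex.I_re,
        Complex.I_im, mul_one, mul_zero, add_zero, zero_add]
      push_cast
      linear_combination (planeWave (-η) z) * h1 -
        (planeWave (-η) z) * f z * (2 * (Real.pi : ℂ)) ^ 2 * (η.re * (η.re - β₀.re) +
          η.im * (η.im - β₀.im)) * Complex.I_sq
    have hint : ∀ v, Integrable (desc b (pd v (H v))) := fun v =>
      integrable_of_continuous (continuous_desc hb ((hHp v).pd v) (contDiff_pd (hHs v) v).continuous)
    have h0 : ∫ t, (desc b (pd 1 (H 1)) t + desc b (pd Complex.I (H Complex.I)) t) = 0 := by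
      rw [integral_add (hint 1) (hint Complex.I), integral_desc_pd hb (hHp 1) (hHs 1),
        integral_desc_pd hb (hHp _) (hHs _), add_zero]
    have h3 : ∀ t, desc b (pd 1 (H 1)) t + desc b (pd Complex.I (H Complex.I)) t =
        ((2 * (Real.pi : ℂ)) ^ 2 * ((‖η‖ ^ 2 - inner ℝ β₀ η : ℝ) : ℂ)) *
          (UnitAddTorus.mFourier (-n) t • g t) := by
      intro t
      rw [← desc_planeWave hb, dualVec_neg]
      exact hsum _
    simp only [h3] at h0
    rw [integral_const_mul] at h0
    refine (mul_eq_zero.1 h0).resolve_left (mul_ne_zero ?_ (Complex.ofReal_ne_zero.2 hne))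
    exact pow_ne_zero _ (mul_ne_zero two_ne_zero (Complex.ofReal_ne_zero.2 Real.pi_ne_zero))
  have hN : ∀ η ∈ T, ∃ n, dualVec b n = η := by
    intro η hη
    choose n hn using (mem_dualLattice_iff hb η).1 ((hT η).1 hη).1
    refine ⟨n, pairing_injective (b := b) (funext fun i => ?_)⟩
    rw [pairing_dualVec, hn]
  choose! N hN using hN
  have hzero : ∀ n ∉ T.image N, UnitAddTorus.mFourierCoeff g n = 0 := by
    intro n hn
    apply hcoeff
    intro hmem
    apply hn
    refine Finset.mem_image.2 ⟨_, hmem, ?_⟩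
    funext i
    have := pairing_dualVec (b := b) (N (dualVec b n)) i
    rw [hN _ hmem, pairing_dualVec] at this
    exact_mod_cast this.symm
  -- Only finitely many Fourier coefficients survive, so convergence is automatic and the series is
  -- a finite sum.
  have hsummable : Summable (UnitAddTorus.mFourierCoeff g) :=
    summable_of_ne_finset_zero (s := T.image N) hzero
  refine ⟨fun η => UnitAddTorus.mFourierCoeff g (N η), fun z => ?_⟩
  obtain ⟨x, rfl⟩ := desc_surjective (b := b) z
  have h1 := UnitAddTorus.hasSum_mFourier_series_apply_of_summable hsummable (toTorus x)
  have h2 : HasSum (fun n => UnitAddTorus.mFourierCoeff g n • UnitAddTorus.mFourier n (toTorus x))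
      (∑ n ∈ T.image N, UnitAddTorus.mFourierCoeff g n • UnitAddTorus.mFourier n (toTorus x)) :=
    hasSum_sum_of_ne_finset_zero (fun n hn => by rw [hzero n hn, zero_smul])
  have h3 := h1.unique h2
  have h4 : g (toTorus x) = f (b.equivFun.symm x) := desc_toTorus hb hf x
  rw [← h4, h3, Finset.sum_image]
  · refine Finset.sum_congr rfl fun η hη => ?_
    rw [← desc_planeWave hb, hN η hη, desc_toTorus hb (fun g hg z =>
      planeWave_periodic ((hT η).1 hη).1 hg z), smul_eq_mul, mul_comm]
  · intro η hη ξ hξ h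
    rw [← hN η hη, ← hN ξ hξ, h]

end Torus

/-! ### The Lagrangian angle of a torus is affine -/

lemma dbar_eq_iff (β : ℂ → ℝ) (β₀ z : ℂ) :
    (1 / (Real.pi : ℂ)) * dbar β z = β₀ ↔
      pd 1 β z = 2 * Real.pi * β₀.re ∧ pd Complex.I β z = 2 * Real.pi * β₀.im := by
  have hpi := Real.pi_ne_zero
  have hpi' : (Real.pi : ℂ) ≠ 0 := Complex.ofReal_ne_zero.2 hpi
  have e : (1 / (Real.pi : ℂ)) * dbar β z = β₀ ↔
      ((pd 1 β z : ℝ) : ℂ) + Complex.I * ((pd Complex.I β z : ℝ) : ℂ) =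
        ((2 * Real.pi : ℝ) : ℂ) * β₀ := by
    unfold dbar pd
    push_cast
    constructor
    · intro h
      rw [← h]; field_simp
    · intro h
      rw [h]; field_simp
  rw [e, Complex.ext_iff]
  simp [Complex.mul_re, Complex.mul_im]

lemma eq_affine_of_dbar {β : ℂ → ℝ} (hβ : Differentiable ℝ β) {β₀ : ℂ}
    (h : ∀ z, (1 / (Real.pi : ℂ)) * dbar β z = β₀) :
    ∃ c : ℝ, ∀ z, β z = 2 * Real.pi * inner ℝ β₀ z + c := by
  have hl := differentiable_of_smooth (contDiff_inner_left β₀ (2 * Real.pi))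
  have hd : ∀ z, fderiv ℝ (fun z => β z - 2 * Real.pi * (inner ℝ β₀ z : ℝ)) z = 0 := by
    intro z
    obtain ⟨h1, h2⟩ := (dbar_eq_iff β β₀ z).1 (h z)
    rw [fderiv_fun_sub (hβ z) (hl z)]
    ext1 w
    rw [sub_apply, fderiv_apply_eq, fderiv_apply_eq, h1, h2, pd_inner_left,
      pd_inner_left]
    simp
  refine ⟨β 0, fun z => ?_⟩
  have h1 : β z - 2 * Real.pi * (inner ℝ β₀ z : ℝ) = β 0 - 2 * Real.pi * (inner ℝ β₀ 0 : ℝ) :=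
    is_const_of_fderiv_eq_zero (hβ.sub hl) hd z 0
  rw [inner_zero_right] at h1
  linarith

lemma dbar_affine (β₀ : ℂ) (c : ℝ) (z : ℂ) :
    (1 / (Real.pi : ℂ)) * dbar (fun z => 2 * Real.pi * (inner ℝ β₀ z : ℝ) + c) z = β₀ := by
  rw [dbar_eq_iff]
  have h : ∀ v, pd v (fun z : ℂ => 2 * Real.pi * (inner ℝ β₀ z : ℝ) + c) z =
      2 * Real.pi * inner ℝ β₀ v := by
    intro v
    rw [← pd_inner_left β₀ (2 * Real.pi) v z]
    unfold pd
    rw [fderiv_add_const]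
  rw [h, h]
  simp

lemma laplacian_affine (β₀ : ℂ) (c : ℝ) (z : ℂ) :
    Laplacian.laplacian (fun z => 2 * Real.pi * (inner ℝ β₀ z : ℝ) + c) z = 0 := by
  have hs : ContDiff ℝ ∞ (fun z => 2 * Real.pi * (inner ℝ β₀ z : ℝ) + c) :=
    (contDiff_inner_left β₀ (2 * Real.pi)).add contDiff_const
  have h : ∀ v, pd v (fun z : ℂ => 2 * Real.pi * (inner ℝ β₀ z : ℝ) + c) =
      fun _ => 2 * Real.pi * inner ℝ β₀ v := by
    intro v
    funext z
    rw [← pd_inner_left β₀ (2 * Real.pi) v z]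
    unfold pd
    rw [fderiv_add_const]
  rw [laplacian_eq hs, h, h]
  simp [pd]

lemma regularSet_nonempty {X : ℂ → E4} (hX : ContDiff ℝ ∞ X) (h : ¬ IsConstant X) :
    (regularSet X).Nonempty := by
  by_contra hne
  rw [Set.not_nonempty_iff_eq_empty] at hne
  refine h ⟨X 0, fun z => is_const_of_fderiv_eq_zero (differentiable_of_smooth hX) (fun w => ?_) z 0⟩
  by_contra hw
  exact (Set.eq_empty_iff_forall_notMem.1 hne) w hw

/-- Where X_x ≠ 0 the first order equation determines e^{iβ}, which therefore inherits the
periodicity of X. The lift β itself need not be periodic. -/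
lemma expI_angle_periodic {Γ : Submodule ℤ ℂ} {X : ℂ → E4} {β : ℂ → ℝ} (hp : IsPeriodic Γ X)
    (h : IsWeaklyConformalLagrangian X β) {g : ℂ} (hg : g ∈ Γ) {z : ℂ} (hz : z ∈ regularSet X) :
    Complex.exp (Complex.I * (β (z + g) : ℂ)) = Complex.exp (Complex.I * (β z : ℂ)) := by
  have hfo := ((isWeaklyConformalLagrangian_iff X β).1 h).2.2
  have hp' : Periodic Γ X := hp
  have h1 := hfo (z + g)
  rw [dx_eq_pd, dy_eq_pd, hp'.pd 1 g hg, hp'.pd Complex.I g hg, ← dx_eq_pd, ← dy_eq_pd, hfo z,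
    ← sub_eq_zero, sub_eq_add_neg, ← neg_Lmul, ← add_Lmul, Lmul_eq_zero] at h1
  have h2 := h1.resolve_right fun h0 => (mem_regularSet_iff h z).1 hz (K_eq_zero.1 h0)
  rw [← sub_eq_add_neg, sub_eq_zero] at h2
  exact h2.symm

/-- Periodicity of dβ is directly available only near an immersed point. Harmonicity makes β_x -
iβ_y entire, so the identity theorem extends the periodicity to the plane and Liouville applies. -/
theorem dbar_angle_const (Γ : Submodule ℤ ℂ) [DiscreteTopology Γ] [IsZLattice ℝ Γ]
    {X : ℂ → E4} {β : ℂ → ℝ} (hp : IsPeriodic Γ X) (hst : IsHamiltonianStationary X β)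
    (hnc : ¬ IsConstant X) :
    ∃ β₀ ∈ dualLattice Γ, ∀ z, (1 / (Real.pi : ℂ)) * dbar β z = β₀ := by
  obtain ⟨ι, _, b, hb⟩ := exists_isLatticeBasis Γ
  have hw := hst.toIsWeaklyConformalLagrangian
  have hβ := hst.smooth_angle
  have hβ' := differentiable_of_smooth hβ
  obtain ⟨z₀, hz₀⟩ := regularSet_nonempty hst.smooth hnc
  have hopen := isOpen_regularSet hst.smooth
  have hpd : ∀ g ∈ Γ, ∀ z ∈ regularSet X, ∀ v, pd v β (z + g) = pd v β z := by
    intro g hg z hz v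
    have h1 : (fun w => Complex.exp (Complex.I * (β (w + g) : ℂ))) =ᶠ[nhds z]
        fun w => Complex.exp (Complex.I * (β w : ℂ)) := by
      filter_upwards [hopen.mem_nhds hz] with w hw'
      exact expI_angle_periodic hp hw hg hw'
    have h2 : pd v (fun w => Complex.exp (Complex.I * (β (w + g) : ℂ))) z =
        pd v (fun w => Complex.exp (Complex.I * (β w : ℂ))) z := by
      unfold pd; rw [h1.fderiv_eq]
    have h3 : Differentiable ℝ (fun w => β (w + g)) :=
      hβ'.comp (differentiable_id.add_const g)
    rw [pd_expI h3, pd_expI hβ', expI_angle_periodic hp hw hg hz] at h2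
    have h4 := mul_left_cancel₀ Complex.I_ne_zero (mul_right_cancel₀ (Complex.exp_ne_zero _) h2)
    have h5 : pd v (fun w => β (w + g)) z = pd v β (z + g) := by
      unfold pd; rw [fderiv_comp_add_right]
    rw [← h5]
    exact_mod_cast h4
  let F : ℂ → ℂ := fun z => fderiv ℝ β z 1 - Complex.I * fderiv ℝ β z Complex.I
  have hF : Differentiable ℂ F := fun z =>
    HarmonicAt.differentiableAt_complex_partial
      ⟨hβ.contDiffAt.of_le ENat.LEInfty.out,
        Filter.Eventually.of_forall fun w => harmonic_of_stationary hst w⟩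
  have hFp : Periodic Γ F := by
    intro g hg
    have hFg : Differentiable ℂ (fun z => F (z + g)) := hF.comp (differentiable_id.add_const g)
    have h1 : (fun z => F (z + g)) =ᶠ[nhds z₀] F := by
      filter_upwards [hopen.mem_nhds hz₀] with z hz
      have e1 := hpd g hg z hz 1
      have e2 := hpd g hg z hz Complex.I
      simp only [pd] at e1 e2
      simp only [F, e1, e2]
    exact fun z => congrFun (AnalyticOnNhd.eq_of_eventuallyEq
      (fun z _ => hFg.analyticAt z) (fun z _ => hF.analyticAt z) h1) z
  obtain ⟨C, hC⟩ := exists_bound_of_periodic hb hFp hF.continuous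
  have hconst : ∀ z, F z = F 0 := fun z =>
    hF.apply_eq_apply_of_bounded
      (isBounded_iff_forall_norm_le.2 ⟨C, by rintro _ ⟨w, rfl⟩; exact hC w⟩) z 0
  have hparts : ∀ z, pd 1 β z = (F 0).re ∧ pd Complex.I β z = -(F 0).im := by
    intro z
    rw [← hconst z]
    simp [F, pd]
  have hpi := Real.pi_ne_zero
  -- F is the complex conjugate of 2 ∂β/∂z̄, hence the sign of the imaginary part.
  let β₀ : ℂ := ⟨(F 0).re / (2 * Real.pi), -(F 0).im / (2 * Real.pi)⟩
  have hβ₀ : ∀ z, (1 / (Real.pi : ℂ)) * dbar β z = β₀ := by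
    intro z
    rw [dbar_eq_iff, (hparts z).1, (hparts z).2]
    constructor <;> simp only [β₀] <;> field_simp
  refine ⟨β₀, fun g hg => ?_, hβ₀⟩
  -- Comparing e^{iβ} at z₀ and z₀ + g gives e^{2πi⟨β₀,g⟩} = 1, that is, ⟨β₀, g⟩ is an integer.
  obtain ⟨c, hc⟩ := eq_affine_of_dbar hβ' hβ₀
  rw [← planeWave_eq_one_iff]
  have h1 := expI_angle_periodic hp hw hg hz₀
  rw [hc, hc, inner_add_right] at h1
  have h2 : Complex.I * ((2 * Real.pi * (inner ℝ β₀ z₀ + inner ℝ β₀ g) + c : ℝ) : ℂ) =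
      Complex.I * ((2 * Real.pi * inner ℝ β₀ z₀ + c : ℝ) : ℂ) +
        Complex.I * ((2 * Real.pi * inner ℝ β₀ g : ℝ) : ℂ) := by
    push_cast; ring
  rw [h2, Complex.exp_add] at h1
  exact mul_left_cancel₀ (Complex.exp_ne_zero _) (h1.trans (mul_one _).symm)

/-! ### The linear first order system -/

/-- The solutions with Lagrangian angle `2π⟨β₀, z⟩`. -/
def IsNormalized (β₀ : ℂ) (Y : ℂ → E4) : Prop :=
  ContDiff ℝ ∞ Y ∧ ∀ z, dy Y z = Lmul (planeWave β₀ z) (K (dx Y z))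

lemma pd_Lmul_const (p : ℂ) {Y : ℂ → E4} (hY : Differentiable ℝ Y) (v z : ℂ) :
    pd v (fun z => Lmul p (Y z)) z = Lmul p (pd v Y z) :=
  pd_clm (LmulL p) hY v z

lemma contDiff_Lmul_const (p : ℂ) {Y : ℂ → E4} (hY : ContDiff ℝ ∞ Y) :
    ContDiff ℝ ∞ (fun z => Lmul p (Y z)) := (LmulL p).contDiff.comp hY

/-- Moving p through the antilinear `K` conjugates it, so the rotation changes the factor in the
equation by p / p̄. For ‖p‖ = 1 this is p²: the angle moves by twice the argument of p. -/
lemma first_order_Lmul {Y : ℂ → E4} (hY : ContDiff ℝ ∞ Y) {p q : ℂ} (z e : ℂ)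
    (hpq : p = q * star p) (h : dy Y z = Lmul e (K (dx Y z))) :
    dy (fun z => Lmul p (Y z)) z = Lmul (q * e) (K (dx (fun z => Lmul p (Y z)) z)) := by
  have hd := differentiable_of_smooth hY
  rw [dy_eq_pd, dx_eq_pd, pd_Lmul_const p hd, pd_Lmul_const p hd, ← dx_eq_pd, ← dy_eq_pd, h,
    K_Lmul, Lmul_Lmul, Lmul_Lmul]
  congr 1
  linear_combination e * hpq

lemma expI_add (a b : ℝ) : Complex.exp (Complex.I * ((a + b : ℝ) : ℂ)) =
    Complex.exp (Complex.I * (b : ℂ)) * Complex.exp (Complex.I * (a : ℂ)) := by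
  rw [← Complex.exp_add]; congr 1; push_cast; ring

lemma norm_expI (a : ℝ) : ‖Complex.exp (Complex.I * (a : ℂ))‖ = 1 := by
  rw [mul_comm]; exact Complex.norm_exp_ofReal_mul_I a

lemma star_expI (a : ℝ) :
    star (Complex.exp (Complex.I * (a : ℂ))) = Complex.exp (Complex.I * ((-a : ℝ) : ℂ)) := by
  rw [Complex.star_def, ← Complex.exp_conj]; simp

lemma expI_mul_star (a : ℝ) : Complex.exp (Complex.I * (a : ℂ)) =
    Complex.exp (Complex.I * ((2 * a : ℝ) : ℂ)) * star (Complex.exp (Complex.I * (a : ℂ))) := by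
  rw [star_expI, ← expI_add, show -a + 2 * a = a by ring]

/-- The angle is 2π⟨β₀, z⟩ + c, and a rotation by e^{-ic/2} removes c. Conversely an affine angle is
harmonic everywhere, so every rotated normalized map is stationary. -/
lemma mem_solutions_iff (Γ : Submodule ℤ ℂ) (β₀ : ℂ) (X : ℂ → E4) :
    X ∈ solutions Γ β₀ ↔ ∃ p : ℂ, ‖p‖ = 1 ∧ ∃ Y : ℂ → E4,
      (IsPeriodic Γ Y ∧ IsNormalized β₀ Y) ∧ X = fun z => Lmul p (Y z) := by
  constructor
  · rintro ⟨hp, β, hst, hβ⟩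
    obtain ⟨hX, hsm, hfo⟩ := (isWeaklyConformalLagrangian_iff X β).1 hst.toIsWeaklyConformalLagrangian
    obtain ⟨c, hc⟩ := eq_affine_of_dbar (differentiable_of_smooth hsm) hβ
    refine ⟨Complex.exp (Complex.I * ((c / 2 : ℝ) : ℂ)), norm_expI _,
      fun z => Lmul (Complex.exp (Complex.I * ((-(c / 2) : ℝ) : ℂ))) (X z),
      ⟨fun g hg z => by simp only [hp g hg z], contDiff_Lmul_const _ hX, fun z => ?_⟩, ?_⟩
    · rw [first_order_Lmul hX z _ (expI_mul_star (-(c / 2))) (hfo z)]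
      congr 1
      rw [← expI_add, hc z]
      unfold planeWave
      congr 3; ring
    · funext z
      rw [Lmul_Lmul, ← expI_add]
      simp
  · rintro ⟨p, hp1, Y, ⟨hper, hY, hfo⟩, rfl⟩
    have hp : p = Complex.exp (Complex.I * (p.arg : ℂ)) := by
      have := Complex.norm_mul_exp_arg_mul_I p
      rw [hp1, Complex.ofReal_one, one_mul, mul_comm] at this
      exact this.symm
    refine ⟨fun g hg z => by simp only [hper g hg z],
      fun z => 2 * Real.pi * (inner ℝ β₀ z : ℝ) + 2 * p.arg, ?_, dbar_affine β₀ _⟩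
    refine critical_of_harmonic ((isWeaklyConformalLagrangian_iff _ _).2
      ⟨contDiff_Lmul_const _ hY, (contDiff_inner_left β₀ (2 * Real.pi)).add contDiff_const,
        fun z => ?_⟩) (laplacian_affine β₀ _)
    have h1 := expI_mul_star p.arg
    rw [← hp] at h1
    rw [first_order_Lmul hY z _ h1 (hfo z), expI_add]
    rfl

/-! ### Modes -/

/-- The real factor between the two Fourier coefficients of a mode. -/
def lam (β₀ γ : ℂ) : ℝ := ((β₀ - 2 * γ) / (β₀ + 2 * γ)).im

section Mode

variable {β₀ γ : ℂ}

lemma add_ne_zero_of_sq_ne (h2 : γ ^ 2 ≠ (β₀ / 2) ^ 2) : β₀ + 2 * γ ≠ 0 := fun h => h2 (by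
  rw [show γ = -(β₀ / 2) by linear_combination h / 2]; ring)

lemma sub_ne_zero_of_sq_ne (h2 : γ ^ 2 ≠ (β₀ / 2) ^ 2) : β₀ - 2 * γ ≠ 0 := fun h => h2 (by
  rw [show γ = β₀ / 2 by linear_combination -h / 2])

/-- Since β₀/2 and γ have equal length, β₀ - 2γ and β₀ + 2γ are the diagonals of a rhombus, hence
perpendicular, and their quotient is purely imaginary. -/
lemma sub_eq_lam_mul (h1 : ‖γ‖ ^ 2 = ‖β₀ / 2‖ ^ 2) (h2 : γ ^ 2 ≠ (β₀ / 2) ^ 2) :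
    β₀ - 2 * γ = Complex.I * (lam β₀ γ : ℂ) * (β₀ + 2 * γ) := by
  have hn := add_ne_zero_of_sq_ne h2
  have hre : ((β₀ - 2 * γ) / (β₀ + 2 * γ)).re = 0 := by
    rw [Complex.div_re, ← add_div]
    rw [← Complex.normSq_eq_norm_sq, ← Complex.normSq_eq_norm_sq, Complex.normSq_apply,
      Complex.normSq_div, Complex.normSq_apply] at h1
    simp only [Complex.normSq_ofNat] at h1
    rw [div_eq_zero_iff]
    left
    simp
    linarith
  have h3 : (β₀ - 2 * γ) / (β₀ + 2 * γ) = Complex.I * (lam β₀ γ : ℂ) := by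
    apply Complex.ext <;> simp [hre, lam]
  rw [← h3, div_mul_cancel₀ _ hn]

lemma lam_re (h1 : ‖γ‖ ^ 2 = ‖β₀ / 2‖ ^ 2) (h2 : γ ^ 2 ≠ (β₀ / 2) ^ 2) :
    β₀.re - 2 * γ.re = -(lam β₀ γ * (β₀.im + 2 * γ.im)) := by
  have := congrArg Complex.re (sub_eq_lam_mul h1 h2)
  simpa using this

lemma lam_im (h1 : ‖γ‖ ^ 2 = ‖β₀ / 2‖ ^ 2) (h2 : γ ^ 2 ≠ (β₀ / 2) ^ 2) :
    β₀.im - 2 * γ.im = lam β₀ γ * (β₀.re + 2 * γ.re) := by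
  have := congrArg Complex.im (sub_eq_lam_mul h1 h2)
  simpa using this

/-- Changing the sign of γ inverts the quotient, so (i λ)(i λ') = 1. -/
lemma lam_mul_lam_neg (h1 : ‖γ‖ ^ 2 = ‖β₀ / 2‖ ^ 2) (h2 : γ ^ 2 ≠ (β₀ / 2) ^ 2) :
    lam β₀ γ * lam β₀ (-γ) = -1 := by
  have e1 := sub_eq_lam_mul h1 h2
  have e2 := sub_eq_lam_mul (γ := -γ) (by rw [norm_neg]; exact h1) (by rw [neg_sq]; exact h2)
  have hn := add_ne_zero_of_sq_ne h2
  have h3 : ((lam β₀ γ * lam β₀ (-γ) : ℝ) : ℂ) * (β₀ + 2 * γ) = ((-1 : ℝ) : ℂ) * (β₀ + 2 * γ) := by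
    push_cast
    linear_combination e2 + Complex.I * (lam β₀ (-γ) : ℂ) * e1 +
      (lam β₀ γ : ℂ) * (lam β₀ (-γ) : ℂ) * (β₀ + 2 * γ) * Complex.I_sq
  exact_mod_cast mul_right_cancel₀ hn h3

lemma lam_ne_zero (h1 : ‖γ‖ ^ 2 = ‖β₀ / 2‖ ^ 2) (h2 : γ ^ 2 ≠ (β₀ / 2) ^ 2) :
    lam β₀ γ ≠ 0 := fun h => by
  have := lam_mul_lam_neg h1 h2
  simp [h] at this

variable (β₀ γ) in
/-- The solution with frequencies `±γ` and given Fourier coefficient at `γ`. -/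
def mode : E4 →ₗ[ℝ] (ℂ → E4) where
  toFun v z := Lmul (planeWave (β₀ / 2 - γ) z) v +
    lam β₀ γ • Lmul (planeWave (β₀ / 2 + γ) z) (K v)
  map_add' v w := by
    funext z
    simp only [Pi.add_apply, Lmul_add, K_add, smul_add]; abel
  map_smul' r v := by
    funext z
    simp only [Pi.smul_apply, Lmul_smul, K_smul, smul_add, RingHom.id_apply, smul_comm r]

lemma mode_apply (v : E4) (z : ℂ) : mode β₀ γ v z = Lmul (planeWave (β₀ / 2 - γ) z) v +
    lam β₀ γ • Lmul (planeWave (β₀ / 2 + γ) z) (K v) := rfl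

/-- The sign change swaps the two Fourier terms; the signs from `K² = -1` and λλ' = -1 cancel. Hence
±γ yield the same family of maps, and one coefficient vector per pair suffices. -/
lemma mode_neg (h1 : ‖γ‖ ^ 2 = ‖β₀ / 2‖ ^ 2) (h2 : γ ^ 2 ≠ (β₀ / 2) ^ 2) (v : E4) :
    mode β₀ (-γ) (lam β₀ γ • K v) = mode β₀ γ v := by
  funext z
  rw [mode_apply, mode_apply, sub_neg_eq_add, ← sub_eq_add_neg, K_smul, K_K, Lmul_smul, Lmul_smul,
    smul_smul, mul_comm (lam β₀ (-γ)), lam_mul_lam_neg h1 h2, Lmul_neg, smul_neg, neg_smul,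
    one_smul, neg_neg, add_comm]

lemma contDiff_Lmul_planeWave (η : ℂ) (v : E4) :
    ContDiff ℝ ∞ (fun z => Lmul (planeWave η z) v) :=
  (LmulL.flip v).contDiff.comp (contDiff_planeWave η)

lemma pd_Lmul_planeWave (η : ℂ) (v : E4) (d z : ℂ) :
    pd d (fun z => Lmul (planeWave η z) v) z =
      (2 * Real.pi * inner ℝ η d) • J (Lmul (planeWave η z) v) := by
  have h := pd_clm (LmulL.flip v) (differentiable_of_smooth (contDiff_planeWave η)) d z
  refine h.trans ?_
  rw [pd_planeWave]
  simp only [ContinuousLinearMap.flip_apply, LmulL_apply]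
  rw [← I_Lmul, ← ofReal_Lmul, Lmul_Lmul, Lmul_Lmul]
  congr 1
  push_cast; ring

end Mode

/-- The operator e^{2πi⟨β₀,z⟩} K exchanges the frequencies β₀/2 - γ and β₀/2 + γ. Matching
coefficients leaves two real relations, which are the real and imaginary parts of β₀ - 2γ = iλ(β₀ +
2γ). -/
lemma isNormalized_mode {β₀ γ : ℂ} (h1 : ‖γ‖ ^ 2 = ‖β₀ / 2‖ ^ 2) (h2 : γ ^ 2 ≠ (β₀ / 2) ^ 2)
    (v : E4) : IsNormalized β₀ (mode β₀ γ v) := by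
  have hs1 := contDiff_Lmul_planeWave (β₀ / 2 - γ) v
  have hs2 := contDiff_Lmul_planeWave (β₀ / 2 + γ) (lam β₀ γ • K v)
  have he : mode β₀ γ v = fun z => Lmul (planeWave (β₀ / 2 - γ) z) v +
      Lmul (planeWave (β₀ / 2 + γ) z) (lam β₀ γ • K v) := by
    funext z; rw [mode_apply, Lmul_smul]
  rw [he]
  refine ⟨hs1.add hs2, fun z => ?_⟩
  have hd := fun d => pd_add (differentiable_of_smooth hs1) (differentiable_of_smooth hs2) d z
  rw [dx_eq_pd, dy_eq_pd, hd, hd]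
  simp only [pd_Lmul_planeWave]
  have e1 := lam_re h1 h2
  have e2 := lam_im h1 h2
  have p1 : planeWave β₀ z * star (planeWave (β₀ / 2 - γ) z) = planeWave (β₀ / 2 + γ) z := by
    rw [star_planeWave, ← planeWave_add_left]; congr 1; ring
  have p2 : planeWave β₀ z * star (planeWave (β₀ / 2 + γ) z) = planeWave (β₀ / 2 - γ) z := by
    rw [star_planeWave, ← planeWave_add_left]; congr 1; ring
  have i1 : (inner ℝ (β₀ / 2 - γ) Complex.I : ℝ) = lam β₀ γ * inner ℝ (β₀ / 2 + γ) 1 := by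
    rw [inner_complex, inner_complex]; simp; linarith
  have i2 : (inner ℝ (β₀ / 2 - γ) 1 : ℝ) = -(lam β₀ γ * inner ℝ (β₀ / 2 + γ) Complex.I) := by
    rw [inner_complex, inner_complex]; simp; linarith
  rw [i1, i2]
  simp only [← I_Lmul, K_add, K_smul, K_Lmul, K_K, Lmul_add, Lmul_smul, Lmul_neg, Lmul_Lmul,
    smul_neg, star_mul']
  have q1 : planeWave β₀ z * (star Complex.I * star (planeWave (β₀ / 2 - γ) z)) =
      -(Complex.I * planeWave (β₀ / 2 + γ) z) := by
    rw [← p1, Complex.star_def, Complex.conj_I]; ring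
  have q2 : planeWave β₀ z * (star Complex.I * star (planeWave (β₀ / 2 + γ) z)) =
      -(Complex.I * planeWave (β₀ / 2 - γ) z) := by
    rw [← p2, Complex.star_def, Complex.conj_I]; ring
  rw [q1, q2, neg_Lmul, neg_Lmul]
  module

lemma isNormalized_const (β₀ : ℂ) (c : E4) : IsNormalized β₀ (fun _ => c) :=
  ⟨contDiff_const, fun z => by simp [dx, dy]⟩

/-- The periodic solutions with Lagrangian angle `2π⟨β₀, z⟩` form a vector space. -/
def normalizedSpace (Γ : Submodule ℤ ℂ) (β₀ : ℂ) : Submodule ℝ (ℂ → E4) where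
  carrier := {Y | IsPeriodic Γ Y ∧ IsNormalized β₀ Y}
  add_mem' := by
    rintro Y Z ⟨hY, hYs, hY'⟩ ⟨hZ, hZs, hZ'⟩
    refine ⟨fun g hg z => by simp only [Pi.add_apply, hY g hg z, hZ g hg z], hYs.add hZs,
      fun z => ?_⟩
    have h := fun v => pd_add (differentiable_of_smooth hYs) (differentiable_of_smooth hZs) v z
    change pd _ (fun z => Y z + Z z) z = Lmul _ (K (pd _ (fun z => Y z + Z z) z))
    rw [h, h, K_add, Lmul_add]
    exact congrArg₂ _ (hY' z) (hZ' z)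
  zero_mem' := ⟨fun _ _ _ => rfl, isNormalized_const β₀ 0⟩
  smul_mem' := by
    rintro r Y ⟨hY, hYs, hY'⟩
    refine ⟨fun g hg z => by simp only [Pi.smul_apply, hY g hg z], contDiff_const.smul hYs,
      fun z => ?_⟩
    have h : ∀ v, pd v (r • Y) z = r • pd v Y z := fun v =>
      pd_clm (r • ContinuousLinearMap.id ℝ E4) (differentiable_of_smooth hYs) v z
    change pd _ (r • Y) z = Lmul _ (K (pd _ (r • Y) z))
    rw [h, h, K_smul, Lmul_smul]
    exact congrArg _ (hY' z)

lemma neg_mem_dualLattice {Γ : Submodule ℤ ℂ} {η : ℂ} (h : η ∈ dualLattice Γ) :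
    -η ∈ dualLattice Γ := fun g hg => by
  obtain ⟨n, hn⟩ := h g hg
  exact ⟨-n, by rw [inner_neg_left, hn]; simp⟩

lemma add_mem_dualLattice {Γ : Submodule ℤ ℂ} {η ξ : ℂ} (h : η ∈ dualLattice Γ)
    (h' : ξ ∈ dualLattice Γ) : η + ξ ∈ dualLattice Γ := fun g hg => by
  obtain ⟨n, hn⟩ := h g hg
  obtain ⟨m, hm⟩ := h' g hg
  exact ⟨n + m, by rw [inner_add_left, hn, hm]; simp⟩

lemma sub_mem_dualLattice {Γ : Submodule ℤ ℂ} {β₀ γ : ℂ} (hγ : γ - β₀ / 2 ∈ dualLattice Γ) :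
    β₀ / 2 - γ ∈ dualLattice Γ := by simpa using neg_mem_dualLattice hγ

lemma add_mem_dualLattice' {Γ : Submodule ℤ ℂ} {β₀ γ : ℂ} (hβ : β₀ ∈ dualLattice Γ)
    (hγ : γ - β₀ / 2 ∈ dualLattice Γ) : β₀ / 2 + γ ∈ dualLattice Γ := by
  convert! add_mem_dualLattice hβ hγ using 1; ring

lemma mode_mem_normalizedSpace {Γ : Submodule ℤ ℂ} {β₀ γ : ℂ} (hβ : β₀ ∈ dualLattice Γ)
    (hγ : γ ∈ frequencies Γ β₀) (v : E4) : mode β₀ γ v ∈ normalizedSpace Γ β₀ := by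
  refine ⟨fun g hg z => ?_, isNormalized_mode hγ.2.1 hγ.2.2 v⟩
  rw [mode_apply, mode_apply, planeWave_periodic (sub_mem_dualLattice hγ.1) hg,
    planeWave_periodic (add_mem_dualLattice' hβ hγ.1) hg]

lemma neg_mem_frequencies {Γ : Submodule ℤ ℂ} {β₀ γ : ℂ} (hβ : β₀ ∈ dualLattice Γ)
    (hγ : γ ∈ frequencies Γ β₀) : -γ ∈ frequencies Γ β₀ := by
  refine ⟨?_, by rw [norm_neg]; exact hγ.2.1, by rw [neg_sq]; exact hγ.2.2⟩
  convert! neg_mem_dualLattice (add_mem_dualLattice' hβ hγ.1) using 1; ring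

/-! ### The basic solutions as modes -/

/-- The vector `(-i, 1)` of `ℂ² = E4`. -/
def vec0 : E4 := !₂[0, -1, 1, 0]

/-- The real part splits into a term complex linear in s and one antilinear in s, now for the
complex structure `J`. With s proportional to e^{-2πi⟨γ,z⟩} and the prefactor e^{πi⟨β₀,z⟩}, these
are the two frequencies of a mode. -/
lemma re_wave_eq {β₀ γ : ℂ} (h1 : ‖γ‖ ^ 2 = ‖β₀ / 2‖ ^ 2) (h2 : γ ^ 2 ≠ (β₀ / 2) ^ 2) (s : ℂ) :
    (4 / Real.pi) • (WithLp.toLp 2 fun k =>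
      ((s • ![-Complex.I * γ, -β₀ / 2, γ, -Complex.I * β₀ / 2] : Fin 4 → ℂ) k).re : E4) =
      Lmul ((2 / Real.pi : ℂ) * (γ + β₀ / 2) * s) vec0 +
        lam β₀ γ • Lmul (star ((2 / Real.pi : ℂ) * (γ + β₀ / 2) * s)) (K vec0) := by
  have e1 := lam_re h1 h2
  have e2 := lam_im h1 h2
  have hc : (2 / Real.pi : ℂ) = ((2 / Real.pi : ℝ) : ℂ) := by push_cast; rfl
  rw [hc]
  apply E4.ext
  · simp [vec0]
    linear_combination -(s.re / Real.pi) * e2 - (s.im / Real.pi) * e1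
  · simp [vec0]
    linear_combination -(s.re / Real.pi) * e1 + (s.im / Real.pi) * e2
  · simp [vec0]
    linear_combination -(s.re / Real.pi) * e1 + (s.im / Real.pi) * e2
  · simp [vec0]
    linear_combination (s.re / Real.pi) * e2 + (s.im / Real.pi) * e1

/-- The Fourier coefficient at `γ` of the map `A β₀ γ` in the direction `vec0`. -/
def coeffA (β₀ γ : ℂ) : ℂ := (2 / Real.pi : ℂ) * (γ + β₀ / 2) * (β₀ ^ 2 - 4 * γ ^ 2)⁻¹

section Basic

variable {β₀ γ : ℂ}

lemma coeffA_ne_zero (h2 : γ ^ 2 ≠ (β₀ / 2) ^ 2) : coeffA β₀ γ ≠ 0 := by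
  have h3 := add_ne_zero_of_sq_ne h2
  refine mul_ne_zero (mul_ne_zero (div_ne_zero two_ne_zero
    (Complex.ofReal_ne_zero.2 Real.pi_ne_zero)) ?_) (inv_ne_zero ?_)
  · intro h; exact h3 (by linear_combination 2 * h)
  · intro h; exact h2 (by linear_combination -h / 4)

/-- The free factor w treats both families at once: w = 1 gives `A`, and w = -i gives `B` because Im
x = Re(-i x). -/
lemma mode_eq_of_re_wave (h1 : ‖γ‖ ^ 2 = ‖β₀ / 2‖ ^ 2) (h2 : γ ^ 2 ≠ (β₀ / 2) ^ 2) (w z : ℂ) :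
    (4 / Real.pi) • Lmul (Complex.exp (Complex.I * ((Real.pi * inner ℝ β₀ z : ℝ) : ℂ)))
      (WithLp.toLp 2 fun k => (((w * Complex.exp (-2 * (Real.pi : ℂ) * Complex.I *
        ((inner ℝ γ z : ℝ) : ℂ)) / (β₀ ^ 2 - 4 * γ ^ 2)) •
          ![-Complex.I * γ, -β₀ / 2, γ, -Complex.I * β₀ / 2] : Fin 4 → ℂ) k).re) =
      mode β₀ γ (Lmul (w * coeffA β₀ γ) vec0) z := by
  set E := Complex.exp (Complex.I * ((Real.pi * inner ℝ β₀ z : ℝ) : ℂ)) with hE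
  have hu : Complex.exp (-2 * (Real.pi : ℂ) * Complex.I * ((inner ℝ γ z : ℝ) : ℂ)) =
      planeWave (-γ) z := by
    unfold planeWave
    rw [inner_neg_left]
    congr 1; push_cast; ring
  have hE1 : E = planeWave (β₀ / 2) z := by
    rw [hE]; unfold planeWave
    congr 3
    rw [inner_complex, inner_complex]; simp; ring
  have p1 : planeWave (β₀ / 2 - γ) z = E * planeWave (-γ) z := by
    rw [hE1, ← planeWave_add_left, ← sub_eq_add_neg]
  have p2 : planeWave (β₀ / 2 + γ) z = E * star (planeWave (-γ) z) := by
    rw [hE1, star_planeWave, neg_neg, ← planeWave_add_left]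
  rw [hu, ← Lmul_smul, re_wave_eq h1 h2, mode_apply, p1, p2, Lmul_add, Lmul_smul, K_Lmul]
  simp only [Lmul_Lmul]
  unfold coeffA
  congr 2
  · ring
  · simp only [star_mul', star_div₀, star_inv₀]
    congr 1; ring

lemma A_eq_mode (h1 : ‖γ‖ ^ 2 = ‖β₀ / 2‖ ^ 2) (h2 : γ ^ 2 ≠ (β₀ / 2) ^ 2) :
    A β₀ γ = mode β₀ γ (Lmul (coeffA β₀ γ) vec0) := by
  funext z
  have := mode_eq_of_re_wave h1 h2 1 z
  rw [one_mul, one_mul] at this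
  exact this

lemma B_eq_mode (h1 : ‖γ‖ ^ 2 = ‖β₀ / 2‖ ^ 2) (h2 : γ ^ 2 ≠ (β₀ / 2) ^ 2) :
    B β₀ γ = mode β₀ γ (Lmul (-Complex.I * coeffA β₀ γ) vec0) := by
  funext z
  rw [← mode_eq_of_re_wave h1 h2]
  unfold B wave
  congr 3
  funext k
  rw [mul_div_assoc (-Complex.I) (Complex.exp _)]
  have h : ∀ x y : ℂ, (x * y).im = (-Complex.I * x * y).re := fun x y => by simp
  exact h _ _

end Basic

lemma vec_decomp (v : E4) : ∃ s t : ℂ, v = Lmul s vec0 + K (Lmul t vec0) := by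
  refine ⟨⟨(v 2 - v 1) / 2, (v 0 + v 3) / 2⟩, ⟨-(v 0 - v 3) / 2, (v 1 + v 2) / 2⟩, ?_⟩
  apply E4.ext <;> simp [vec0] <;> ring

lemma mode_vec0_mem {Γ : Submodule ℤ ℂ} {β₀ γ : ℂ} (hγ : γ ∈ frequencies Γ β₀) (s : ℂ) :
    mode β₀ γ (Lmul s vec0) ∈ solutionSpace Γ β₀ := by
  have ha := coeffA_ne_zero hγ.2.2
  set w := s / coeffA β₀ γ with hw
  have hs : Lmul s vec0 = w.re • Lmul (coeffA β₀ γ) vec0 +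
      (-w.im) • Lmul (-Complex.I * coeffA β₀ γ) vec0 := by
    rw [← smul_Lmul, ← smul_Lmul, ← add_Lmul]
    congr 1
    have h1 : s = w * coeffA β₀ γ := (div_mul_cancel₀ _ ha).symm
    rw [h1]
    conv_lhs => rw [← Complex.re_add_im w]
    rw [Complex.real_smul, Complex.real_smul]
    push_cast; ring
  rw [hs, map_add, map_smul, map_smul, ← A_eq_mode hγ.2.1 hγ.2.2, ← B_eq_mode hγ.2.1 hγ.2.2]
  exact add_mem (Submodule.smul_mem _ _ (Submodule.subset_span (Or.inl ⟨γ, hγ, Or.inl rfl⟩)))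
    (Submodule.smul_mem _ _ (Submodule.subset_span (Or.inl ⟨γ, hγ, Or.inr rfl⟩)))

/-- `A` and `B` at γ only supply coefficients in the complex line of `vec0`; the complementary line,
spanned by `K vec0`, comes from the frequency -γ through `mode_neg`. -/
lemma mode_mem_solutionSpace {Γ : Submodule ℤ ℂ} {β₀ γ : ℂ} (hβ : β₀ ∈ dualLattice Γ)
    (hγ : γ ∈ frequencies Γ β₀) (v : E4) : mode β₀ γ v ∈ solutionSpace Γ β₀ := by
  obtain ⟨s, t, rfl⟩ := vec_decomp v
  rw [map_add]
  refine add_mem (mode_vec0_mem hγ s) ?_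
  rw [← mode_neg hγ.2.1 hγ.2.2, K_K, smul_neg, map_neg, map_smul]
  exact neg_mem (Submodule.smul_mem _ _ (mode_vec0_mem (neg_mem_frequencies hβ hγ) t))

lemma const_mem_solutionSpace (Γ : Submodule ℤ ℂ) (β₀ : ℂ) (c : E4) :
    (fun _ => c) ∈ solutionSpace Γ β₀ := Submodule.subset_span (Or.inr ⟨c, rfl⟩)

lemma solutionSpace_le {Γ : Submodule ℤ ℂ} {β₀ : ℂ} (hβ : β₀ ∈ dualLattice Γ) :
    solutionSpace Γ β₀ ≤ normalizedSpace Γ β₀ := by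
  refine Submodule.span_le.2 ?_
  rintro _ (⟨γ, hγ, rfl | rfl⟩ | ⟨c, rfl⟩)
  · rw [A_eq_mode hγ.2.1 hγ.2.2]; exact mode_mem_normalizedSpace hβ hγ _
  · rw [B_eq_mode hγ.2.1 hγ.2.2]; exact mode_mem_normalizedSpace hβ hγ _
  · exact ⟨fun _ _ _ => rfl, isNormalized_const β₀ c⟩

/-! ### All periodic solutions are combinations of modes -/

lemma norm_sq_complex (η : ℂ) : ‖η‖ ^ 2 = η.re * η.re + η.im * η.im := by
  rw [← Complex.normSq_eq_norm_sq, Complex.normSq_apply]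

@[simp] lemma inner_one_right (η : ℂ) : (inner ℝ η 1 : ℝ) = η.re := by simp
@[simp] lemma inner_I_right (η : ℂ) : (inner ℝ η Complex.I : ℝ) = η.im := by simp

/-- The condition describes the circle with diameter from 0 to β₀, a bounded set. -/
lemma finite_resonant (Γ : Submodule ℤ ℂ) [DiscreteTopology Γ] [IsZLattice ℝ Γ] (β₀ : ℂ) :
    {η | η ∈ dualLattice Γ ∧ ‖η‖ ^ 2 = (inner ℝ β₀ η : ℝ)}.Finite := by
  obtain ⟨ι, _, b, hb⟩ := exists_isLatticeBasis Γ
  refine (finite_dualLattice_inter_bounded hb ‖β₀‖).subset ?_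
  rintro η ⟨h1, h2⟩
  refine ⟨h1, ?_⟩
  have h3 : ‖η‖ ^ 2 ≤ ‖β₀‖ * ‖η‖ := h2 ▸ real_inner_le_norm β₀ η
  rcases (norm_nonneg η).eq_or_lt with h | h
  · rw [← h]; exact norm_nonneg _
  · rw [pow_two] at h3; exact le_of_mul_le_mul_right h3 h

lemma resonant_of_frequency {Γ : Submodule ℤ ℂ} {β₀ γ : ℂ} (hγ : γ ∈ frequencies Γ β₀) :
    β₀ / 2 - γ ∈ {η | η ∈ dualLattice Γ ∧ ‖η‖ ^ 2 = (inner ℝ β₀ η : ℝ)} := by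
  refine ⟨sub_mem_dualLattice hγ.1, ?_⟩
  have h := hγ.2.1
  rw [norm_sq_complex, norm_sq_complex] at h
  rw [norm_sq_complex, inner_complex]
  simp at h ⊢
  linarith

/-- Recentring the circle at β₀/2 gives |γ| = |β₀/2|. The points η = 0 and η = β₀ are exactly those
with γ² = (β₀/2)². -/
lemma frequency_of_resonant {Γ : Submodule ℤ ℂ} {β₀ η : ℂ} (h1 : η ∈ dualLattice Γ)
    (h2 : ‖η‖ ^ 2 = (inner ℝ β₀ η : ℝ)) (h0 : η ≠ 0) (hβ : η ≠ β₀) :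
    β₀ / 2 - η ∈ frequencies Γ β₀ := by
  refine ⟨by simpa using neg_mem_dualLattice h1, ?_, fun h => ?_⟩
  · rw [norm_sq_complex, inner_complex] at h2
    rw [norm_sq_complex, norm_sq_complex]
    simp
    linarith
  · have h3 : η * (η - β₀) = 0 := by linear_combination h
    rcases mul_eq_zero.1 h3 with h4 | h4
    · exact h0 h4
    · exact hβ (sub_eq_zero.1 h4)

lemma finite_frequencies (Γ : Submodule ℤ ℂ) [DiscreteTopology Γ] [IsZLattice ℝ Γ] (β₀ : ℂ) :
    (frequencies Γ β₀).Finite :=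
  Set.Finite.of_finite_image ((finite_resonant Γ β₀).subset (by
    rintro _ ⟨γ, hγ, rfl⟩; exact resonant_of_frequency hγ)) (f := fun γ => β₀ / 2 - γ)
    (fun _ _ _ _ h => by simpa using h)

lemma resonant_sub {Γ : Submodule ℤ ℂ} {β₀ η : ℂ} (hβ : β₀ ∈ dualLattice Γ)
    (h : η ∈ {η | η ∈ dualLattice Γ ∧ ‖η‖ ^ 2 = (inner ℝ β₀ η : ℝ)}) :
    β₀ - η ∈ {η | η ∈ dualLattice Γ ∧ ‖η‖ ^ 2 = (inner ℝ β₀ η : ℝ)} := by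
  obtain ⟨h1, h2⟩ := h
  refine ⟨by simpa [sub_eq_add_neg] using add_mem_dualLattice hβ (neg_mem_dualLattice h1), ?_⟩
  rw [norm_sq_complex, inner_complex] at h2 ⊢
  simp
  linarith

lemma laplace_component {β₀ : ℂ} {Y : ℂ → E4} (hY : IsNormalized β₀ Y) (L : E4 →L[ℝ] ℂ)
    (hL : ∀ p v, L (Lmul p v) = p * L v) (z : ℂ) :
    pd 1 (pd 1 fun z => L (Y z)) z + pd Complex.I (pd Complex.I fun z => L (Y z)) z =
      2 * (Real.pi : ℂ) * Complex.I * ((β₀.re : ℂ) * pd 1 (fun z => L (Y z)) z +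
        (β₀.im : ℂ) * pd Complex.I (fun z => L (Y z)) z) := by
  have h1 := laplace_of_first_order hY.1 (contDiff_inner_left β₀ (2 * Real.pi)) hY.2 z
  have e1 : ∀ v, pd v (fun z => L (Y z)) = fun z => L (pd v Y z) := fun v =>
    funext (pd_clm L (differentiable_of_smooth hY.1) v)
  have e2 := fun v => pd_clm L (differentiable_of_smooth (contDiff_pd hY.1 v)) v z
  rw [e1, e1, e2, e2, ← map_add, h1, pd_inner_left, pd_inner_left, ← I_Lmul, hL, map_add, map_smul,
    map_smul, dx_eq_pd, dy_eq_pd, Complex.real_smul, Complex.real_smul]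
  simp
  ring

/-- Fourier expansion of a normalized periodic solution. -/
lemma exists_expansion (Γ : Submodule ℤ ℂ) [DiscreteTopology Γ] [IsZLattice ℝ Γ] {β₀ : ℂ}
    {Y : ℂ → E4} (hY : Y ∈ normalizedSpace Γ β₀) {T : Finset ℂ}
    (hT : ∀ η, η ∈ T ↔ η ∈ dualLattice Γ ∧ ‖η‖ ^ 2 = (inner ℝ β₀ η : ℝ)) :
    ∃ c : ℂ → E4, ∀ z, Y z = ∑ η ∈ T, Lmul (planeWave η z) (c η) := by
  obtain ⟨ι, _, b, hb⟩ := exists_isLatticeBasis Γ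
  have h : ∀ L : E4 →L[ℝ] ℂ, (∀ p v, L (Lmul p v) = p * L v) →
      ∃ c : ℂ → ℂ, ∀ z, L (Y z) = ∑ η ∈ T, planeWave η z * c η := fun L hL =>
    exists_coeff_of_laplace hb (fun g hg z => congrArg L (hY.1 g hg z))
      (L.contDiff.comp hY.2.1) β₀ (laplace_component hY.2 L hL) T hT
  obtain ⟨c, hc⟩ := h fstCL fstC_Lmul
  obtain ⟨d, hd⟩ := h sndCL sndC_Lmul
  refine ⟨fun η => mkC (c η) (d η), fun z => E4.ext_C ?_ ?_⟩
  · change fstCL _ = fstCL _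
    rw [map_sum, hc]
    exact Finset.sum_congr rfl fun η _ => by rw [fstCL_apply, fstC_Lmul, fstC_mkC]
  · change sndCL _ = sndCL _
    rw [map_sum, hd]
    exact Finset.sum_congr rfl fun η _ => by rw [sndCL_apply, sndC_Lmul, sndC_mkC]

lemma pd_sum {F : Type*} [NormedAddCommGroup F] [NormedSpace ℝ F] {κ : Type*} (T : Finset κ)
    {f : κ → ℂ → F} (hf : ∀ i ∈ T, Differentiable ℝ (f i)) (v z : ℂ) :
    pd v (fun z => ∑ i ∈ T, f i z) z = ∑ i ∈ T, pd v (f i) z := by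
  unfold pd
  rw [fderiv_fun_sum fun i hi => hf i hi z]
  simp

/-- The first order system in terms of Fourier coefficients. -/
lemma coeff_relation {β₀ : ℂ} {T : Finset ℂ} (hT : ∀ η ∈ T, β₀ - η ∈ T) {c : ℂ → E4}
    (h : ∀ z, dy (fun z => ∑ η ∈ T, Lmul (planeWave η z) (c η)) z =
      Lmul (planeWave β₀ z) (K (dx (fun z => ∑ η ∈ T, Lmul (planeWave η z) (c η)) z))) :
    ∀ η ∈ T, η.im • c η = -((β₀ - η).re • K (c (β₀ - η))) := by
  have hd : ∀ v z, pd v (fun z => ∑ η ∈ T, Lmul (planeWave η z) (c η)) z =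
      ∑ η ∈ T, (2 * Real.pi * inner ℝ η v) • J (Lmul (planeWave η z) (c η)) := by
    intro v z
    rw [pd_sum T fun η _ => differentiable_of_smooth (contDiff_Lmul_planeWave η (c η))]
    simp only [pd_Lmul_planeWave]
  have h2 := coeff_unique (T := T) (c := fun η => Lmul Complex.I ((2 * Real.pi * η.im) • c η))
    (d := fun η => Lmul Complex.I
      (-((2 * Real.pi * (β₀ - η).re) • K (c (β₀ - η))))) (fun z => by
        have h1 := h z
        rw [dx_eq_pd, dy_eq_pd, hd, hd] at h1
        have e1 : ∀ η ∈ T, Lmul (planeWave η z) (Lmul Complex.I ((2 * Real.pi * η.im) • c η)) =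
            (2 * Real.pi * inner ℝ η Complex.I) • J (Lmul (planeWave η z) (c η)) := by
          intro η _
          rw [← I_Lmul, Lmul_smul, Lmul_smul, Lmul_Lmul, Lmul_Lmul,
            mul_comm Complex.I (planeWave η z), inner_I_right]
        rw [Finset.sum_congr rfl e1, h1, K_sum, Lmul_sum]
        -- Because `K` conjugates plane waves, e^{2πi⟨β₀,z⟩} K carries the frequency η to β₀ - η;
        -- reindexing restores a common frequency.
        refine Finset.sum_nbij' (fun η => β₀ - η) (fun η => β₀ - η) hT hT (by simp) (by simp) ?_
        intro η _
        have e2 : planeWave β₀ z * star Complex.I * star (planeWave η z) =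
            -(planeWave (β₀ - η) z * Complex.I) := by
          rw [star_planeWave, sub_eq_add_neg, planeWave_add_left, Complex.star_def,
            Complex.conj_I]
          ring
        rw [← I_Lmul, K_smul, Lmul_smul, K_Lmul, K_Lmul, Lmul_Lmul, Lmul_Lmul, e2, sub_sub_cancel,
          Lmul_neg, Lmul_neg, Lmul_Lmul, Lmul_smul, neg_Lmul,
          inner_one_right, smul_neg])
  intro η hη
  have h3 := Lmul_left_injective Complex.I_ne_zero (h2 η hη)
  have hpi : (2 * Real.pi : ℝ) ≠ 0 := mul_ne_zero two_ne_zero Real.pi_ne_zero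
  apply smul_right_injective E4 hpi
  simp only [mul_smul (2 * Real.pi)] at h3
  simpa only [smul_neg] using h3

/-- The system couples only η and β₀ - η, so Y splits into such pairs. Each pair is a mode, or a
constant when η is 0 or β₀. -/
theorem normalizedSpace_le (Γ : Submodule ℤ ℂ) [DiscreteTopology Γ] [IsZLattice ℝ Γ] {β₀ : ℂ}
    (hβ : β₀ ∈ dualLattice Γ) : normalizedSpace Γ β₀ ≤ solutionSpace Γ β₀ := by
  intro Y hY
  set T := (finite_resonant Γ β₀).toFinset with hTdef
  have hT : ∀ η, η ∈ T ↔ η ∈ dualLattice Γ ∧ ‖η‖ ^ 2 = (inner ℝ β₀ η : ℝ) := by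
    intro η; rw [hTdef, Set.Finite.mem_toFinset]; rfl
  have hTs : ∀ η ∈ T, β₀ - η ∈ T := fun η hη =>
    (hT _).2 (resonant_sub hβ ((hT η).1 hη))
  obtain ⟨c, hc⟩ := exists_expansion Γ hY hT
  have hrel := coeff_relation (β₀ := β₀) hTs (c := c) (by rw [← funext hc]; exact hY.2.2)
  let term : ℂ → ℂ → E4 := fun η z =>
    Lmul (planeWave η z) (c η) + Lmul (planeWave (β₀ - η) z) (c (β₀ - η))
  -- Averaging over the involution η ↦ β₀ - η avoids choosing a representative of each pair.
  have hY2 : Y = (1 / 2 : ℝ) • ∑ η ∈ T, term η := by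
    funext z
    rw [Pi.smul_apply, Finset.sum_apply]
    simp only [term]
    rw [Finset.sum_add_distrib, ← hc z]
    have : ∑ η ∈ T, Lmul (planeWave (β₀ - η) z) (c (β₀ - η)) = Y z := by
      rw [hc z]
      exact Finset.sum_nbij' (fun η => β₀ - η) (fun η => β₀ - η) hTs hTs (by simp) (by simp)
        (fun _ _ => rfl)
    rw [this]; module
  rw [hY2]
  refine Submodule.smul_mem _ _ (Submodule.sum_mem _ fun η hη => ?_)
  have r1 := hrel η hη
  have r2 := hrel _ (hTs η hη)
  rw [sub_sub_cancel] at r2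
  -- The relations at 0 and at β₀ say that the real and imaginary parts of β₀ annihilate this
  -- coefficient, so no term of frequency β₀ ≠ 0 occurs.
  have hzero : β₀ ≠ 0 → (0 : ℂ) ∈ T → c β₀ = 0 := by
    intro hne h0
    have q1 := hrel 0 h0
    have q2 := hrel β₀ (by simpa using hTs 0 h0)
    simp only [sub_zero, sub_self, Complex.zero_im, Complex.zero_re, zero_smul, neg_zero,
      eq_comm (a := (0 : E4)), neg_eq_zero, smul_eq_zero, K_eq_zero] at q1 q2
    by_contra hcne
    exact hne (Complex.ext (q1.resolve_right hcne) (q2.resolve_right hcne))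
  by_cases hη0 : η = 0
  · subst hη0
    have : term 0 = fun _ => if β₀ = 0 then c 0 + c 0 else c 0 := by
      funext z
      split_ifs with hb
      · simp [term, hb]
      · simp [term, hzero hb hη]
    rw [this]
    exact const_mem_solutionSpace _ _ _
  by_cases hηβ : η = β₀
  · subst hηβ
    have : term η = fun _ => c 0 := by
      funext z
      simp [term, hzero hη0 (by simpa using hTs η hη)]
    rw [this]
    exact const_mem_solutionSpace _ _ _
  have hγ := frequency_of_resonant ((hT η).1 hη).1 ((hT η).1 hη).2 hη0 hηβ
  have e1 := lam_re hγ.2.1 hγ.2.2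
  have e2 := lam_im hγ.2.1 hγ.2.2
  have e3 := add_ne_zero_of_sq_ne hγ.2.2
  set l := lam β₀ (β₀ / 2 - η) with hl
  have f1 : η.re = -(l * (β₀ - η).im) := by simp at e1 ⊢; linarith
  have f2 : η.im = l * (β₀ - η).re := by simp at e2 ⊢; linarith
  have f3 : β₀ - η ≠ 0 := fun h => e3 (by linear_combination 2 * h)
  -- The relations at η and at β₀ - η are this identity multiplied by the real and the imaginary
  -- part of β₀ - η, one of which is nonzero.
  have hcoef : c (β₀ - η) = l • K (c η) := by
    have g1 : (β₀ - η).re • c (β₀ - η) = (β₀ - η).re • (l • K (c η)) := by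
      have := congrArg K r1
      rw [K_smul, K_neg, K_smul, K_K, smul_neg, neg_neg, f2] at this
      rw [← this]; module
    have g2 : (β₀ - η).im • c (β₀ - η) = (β₀ - η).im • (l • K (c η)) := by
      rw [r2, f1]; module
    by_cases h0 : (β₀ - η).re = 0
    · have h1 : (β₀ - η).im ≠ 0 := fun h1 => f3 (Complex.ext h0 h1)
      exact smul_right_injective E4 h1 g2
    · exact smul_right_injective E4 h0 g1
  have : term η = mode β₀ (β₀ / 2 - η) (c η) := by
    funext z
    simp only [term]
    rw [mode_apply, hcoef, Lmul_smul]
    congr 3 <;> ring_nf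
  rw [this]
  exact mode_mem_solutionSpace hβ hγ _

theorem solutions_eq (Γ : Submodule ℤ ℂ) [DiscreteTopology Γ] [IsZLattice ℝ Γ] {β₀ : ℂ}
    (hβ : β₀ ∈ dualLattice Γ) :
    solutions Γ β₀ = orbitG2 (solutionSpace Γ β₀ : Set (ℂ → E4)) := by
  have h : normalizedSpace Γ β₀ = solutionSpace Γ β₀ :=
    le_antisymm (normalizedSpace_le Γ hβ) (solutionSpace_le hβ)
  rw [← h]
  exact Set.ext fun X => mem_solutions_iff Γ β₀ X

section

/-! ### Fourier parametrization of the solutions -/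

lemma eq_zero_of_sum_planeWave_eq_zero {κ : Type*} [Fintype κ] {f : κ → ℂ}
    (hf : Function.Injective f) {c : κ → E4} (h : ∀ z, ∑ k, Lmul (planeWave (f k) z) (c k) = 0) :
    c = 0 := by
  have key : ∀ L : E4 →L[ℝ] ℂ, (∀ p v, L (Lmul p v) = p * L v) → ∀ k, L (c k) = 0 := by
    intro L hL
    refine Fintype.linearIndependent_iff.1 (linearIndependent_planeWave.comp f hf)
      (fun k => L (c k)) ?_
    funext z
    have := congrArg L (h z)
    simpa [map_sum, hL, mul_comm] using this
  funext k
  exact E4.ext_C ((key fstCL fstC_Lmul k).trans fstCL.map_zero.symm)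
    ((key sndCL sndC_Lmul k).trans sndCL.map_zero.symm)

/-- One frequency out of each pair `±γ`. -/
def halfFrequencies (Γ : Submodule ℤ ℂ) (β₀ : ℂ) : Set ℂ :=
  {γ | γ ∈ frequencies Γ β₀ ∧ (0 < γ.re ∨ γ.re = 0 ∧ 0 < γ.im)}

lemma ne_zero_of_mem_frequencies {Γ : Submodule ℤ ℂ} {β₀ γ : ℂ} (hγ : γ ∈ frequencies Γ β₀) :
    γ ≠ 0 := by
  rintro rfl
  have h1 : β₀ / 2 = 0 := by simpa using hγ.2.1.symm
  exact hγ.2.2 (by rw [h1])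

lemma mem_half_or {Γ : Submodule ℤ ℂ} {β₀ γ : ℂ} (hβ : β₀ ∈ dualLattice Γ)
    (hγ : γ ∈ frequencies Γ β₀) :
    γ ∈ halfFrequencies Γ β₀ ∨ -γ ∈ halfFrequencies Γ β₀ := by
  rcases lt_trichotomy γ.re 0 with h | h | h
  · exact Or.inr ⟨neg_mem_frequencies hβ hγ, Or.inl (by simpa using h)⟩
  · rcases lt_trichotomy γ.im 0 with h' | h' | h'
    · exact Or.inr ⟨neg_mem_frequencies hβ hγ, Or.inr (by simpa using ⟨h, h'⟩)⟩
    · exact absurd (Complex.ext h h') (ne_zero_of_mem_frequencies hγ)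
    · exact Or.inl ⟨hγ, Or.inr ⟨h, h'⟩⟩
  · exact Or.inl ⟨hγ, Or.inl h⟩

lemma add_ne_zero_of_mem_half {Γ : Submodule ℤ ℂ} {β₀ γ δ : ℂ} (hγ : γ ∈ halfFrequencies Γ β₀)
    (hδ : δ ∈ halfFrequencies Γ β₀) : γ + δ ≠ 0 := by
  intro h
  have h1 := congrArg Complex.re h
  have h2 := congrArg Complex.im h
  simp only [Complex.add_re, Complex.add_im, Complex.zero_re, Complex.zero_im] at h1 h2
  rcases hγ.2 with a | ⟨a, a'⟩ <;> rcases hδ.2 with b | ⟨b, b'⟩ <;> linarith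

lemma finite_halfFrequencies (Γ : Submodule ℤ ℂ) [DiscreteTopology Γ] [IsZLattice ℝ Γ] (β₀ : ℂ) :
    (halfFrequencies Γ β₀).Finite := (finite_frequencies Γ β₀).subset fun _ h => h.1

lemma ncard_frequencies (Γ : Submodule ℤ ℂ) [DiscreteTopology Γ] [IsZLattice ℝ Γ] {β₀ : ℂ}
    (hβ : β₀ ∈ dualLattice Γ) :
    (frequencies Γ β₀).ncard = 2 * (halfFrequencies Γ β₀).ncard := by
  have h1 : frequencies Γ β₀ =
      halfFrequencies Γ β₀ ∪ (fun γ : ℂ => -γ) '' halfFrequencies Γ β₀ := by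
    ext γ
    constructor
    · intro hγ
      rcases mem_half_or hβ hγ with h | h
      · exact Or.inl h
      · exact Or.inr ⟨_, h, neg_neg γ⟩
    · rintro (h | ⟨δ, h, rfl⟩)
      · exact h.1
      · exact neg_mem_frequencies hβ h.1
  have hfin := finite_halfFrequencies Γ β₀
  rw [h1, Set.ncard_union_eq ?_ hfin (hfin.image _), Set.ncard_image_of_injective _ neg_injective,
    two_mul]
  rw [Set.disjoint_left]
  rintro γ hγ ⟨δ, hδ, h⟩
  exact add_ne_zero_of_mem_half hγ hδ (by rw [← h]; ring)

variable (Γ : Submodule ℤ ℂ) (β₀ : ℂ)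

/-- The index set for the Fourier coefficients of solutions. -/
abbrev Idx : Type := halfFrequencies Γ β₀ ⊕ halfFrequencies Γ β₀ ⊕ Unit

/-- The frequency that belongs to an index. -/
def idxFreq : Idx Γ β₀ → ℂ :=
  Sum.elim (fun γ => β₀ / 2 - γ) (Sum.elim (fun γ => β₀ / 2 + γ) fun _ => 0)

/-- Coincidence with the frequency 0 is ruled out by γ² ≠ (β₀/2)², and coincidence of the two blocks
by γ + δ ≠ 0 in the half set. Fourier coefficients are therefore well defined. -/
lemma idxFreq_injective : Function.Injective (idxFreq Γ β₀) := by
  have e1 : ∀ γ : halfFrequencies Γ β₀, β₀ / 2 - (γ : ℂ) ≠ 0 := fun γ h =>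
    sub_ne_zero_of_sq_ne γ.2.1.2.2 (by linear_combination 2 * h)
  have e2 : ∀ γ : halfFrequencies Γ β₀, β₀ / 2 + (γ : ℂ) ≠ 0 := fun γ h =>
    add_ne_zero_of_sq_ne γ.2.1.2.2 (by linear_combination 2 * h)
  have e3 : ∀ γ δ : halfFrequencies Γ β₀, β₀ / 2 - (γ : ℂ) ≠ β₀ / 2 + (δ : ℂ) := fun γ δ h =>
    add_ne_zero_of_mem_half γ.2 δ.2 (by linear_combination -h)
  rintro (γ | γ | γ) (δ | δ | δ) h <;> simp only [idxFreq, Sum.elim_inl, Sum.elim_inr] at h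
  · rw [Subtype.ext (by linear_combination -h : (γ : ℂ) = δ)]
  · exact absurd h (e3 γ δ)
  · exact absurd h (e1 γ)
  · exact absurd h.symm (e3 δ γ)
  · rw [Subtype.ext (by linear_combination h : (γ : ℂ) = δ)]
  · exact absurd h (e2 γ)
  · exact absurd h.symm (e1 δ)
  · exact absurd h.symm (e2 δ)
  · rfl

set_option linter.unusedSectionVars false

variable [DiscreteTopology Γ] [IsZLattice ℝ Γ]

instance : Fintype (halfFrequencies Γ β₀) := (finite_halfFrequencies Γ β₀).fintype

/-- The map with given Fourier coefficients. -/
def synth : (Idx Γ β₀ → E4) →ₗ[ℝ] (ℂ → E4) where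
  toFun c z := ∑ k, Lmul (planeWave (idxFreq Γ β₀ k) z) (c k)
  map_add' c d := by
    funext z
    simp only [Pi.add_apply, Lmul_add, Finset.sum_add_distrib]
  map_smul' r c := by
    funext z
    simp only [Pi.smul_apply, Lmul_smul, Finset.smul_sum, RingHom.id_apply]

lemma synth_apply (c : Idx Γ β₀ → E4) (z : ℂ) :
    synth Γ β₀ c z = ∑ k, Lmul (planeWave (idxFreq Γ β₀ k) z) (c k) := rfl

lemma synth_injective : Function.Injective (synth Γ β₀) := by
  rw [injective_iff_map_eq_zero]
  intro c hc
  exact eq_zero_of_sum_planeWave_eq_zero (idxFreq_injective Γ β₀) fun z => congrFun hc z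

/-- The Fourier coefficients of the solution with coefficients `u` at the frequencies
`β₀ / 2 - γ`, phase `q` and constant term `v`. -/
def coeffs (u : halfFrequencies Γ β₀ → E4) (q : ℂ) (v : E4) : Idx Γ β₀ → E4 :=
  Sum.elim u (Sum.elim (fun γ => Lmul q (lam β₀ γ • K (u γ))) fun _ => v)

lemma synth_coeffs_one (u : halfFrequencies Γ β₀ → E4) (v : E4) :
    synth Γ β₀ (coeffs Γ β₀ u 1 v) =
      (∑ γ : halfFrequencies Γ β₀, mode β₀ (γ : ℂ) (u γ)) + fun _ => v := by
  funext z
  rw [synth_apply, Fintype.sum_sum_type, Fintype.sum_sum_type, Pi.add_apply, Finset.sum_apply]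
  simp only [mode_apply, coeffs, idxFreq, Sum.elim_inl, Sum.elim_inr, Finset.sum_add_distrib,
    one_Lmul, Lmul_smul, planeWave_zero_left, Finset.univ_unique, Finset.sum_singleton, add_assoc]

/-- The parametrization of the solutions with angle `2π⟨β₀, z⟩`. -/
def synthOne : ((halfFrequencies Γ β₀ → E4) × E4) →ₗ[ℝ] (ℂ → E4) where
  toFun x := synth Γ β₀ (coeffs Γ β₀ x.1 1 x.2)
  map_add' x y := by
    rw [← map_add]; congr 1
    funext k
    rcases k with k | k | k <;> simp [coeffs, K_add]
  map_smul' r x := by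
    rw [RingHom.id_apply, ← map_smul]; congr 1
    funext k
    rcases k with k | k | k <;> simp [coeffs, K_smul, smul_comm r]

lemma synthOne_apply (x : (halfFrequencies Γ β₀ → E4) × E4) :
    synthOne Γ β₀ x = synth Γ β₀ (coeffs Γ β₀ x.1 1 x.2) := rfl

lemma synthOne_injective : Function.Injective (synthOne Γ β₀) := by
  intro x y h
  have h1 := synth_injective Γ β₀ h
  exact Prod.ext (funext fun γ => congrFun h1 (Sum.inl γ)) (congrFun h1 (Sum.inr (Sum.inr ())))

variable {Γ β₀}

lemma range_synthOne (hβ : β₀ ∈ dualLattice Γ) :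
    LinearMap.range (synthOne Γ β₀) = solutionSpace Γ β₀ := by
  classical
  apply le_antisymm
  · rintro _ ⟨x, rfl⟩
    rw [synthOne_apply, synth_coeffs_one]
    exact add_mem (Submodule.sum_mem _ fun γ _ => mode_mem_solutionSpace hβ γ.2.1 _)
      (const_mem_solutionSpace _ _ _)
  · have hhalf : ∀ γ ∈ halfFrequencies Γ β₀, ∀ v, mode β₀ γ v ∈ LinearMap.range (synthOne Γ β₀) := by
      intro γ hγ v
      refine ⟨(Pi.single ⟨γ, hγ⟩ v, 0), ?_⟩
      rw [synthOne_apply, synth_coeffs_one, Finset.sum_eq_single ⟨γ, hγ⟩]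
      · simp only [Pi.single_eq_same]
        exact add_zero _
      · intro δ _ hδ
        simp [hδ]
      · simp
    have hall : ∀ γ ∈ frequencies Γ β₀, ∀ v, mode β₀ γ v ∈ LinearMap.range (synthOne Γ β₀) := by
      intro γ hγ v
      rcases mem_half_or hβ hγ with h | h
      · exact hhalf γ h v
      · rw [← mode_neg hγ.2.1 hγ.2.2]
        exact hhalf _ h _
    refine Submodule.span_le.2 ?_
    rintro _ (⟨γ, hγ, rfl | rfl⟩ | ⟨c, rfl⟩)
    · rw [A_eq_mode hγ.2.1 hγ.2.2]; exact hall γ hγ _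
    · rw [B_eq_mode hγ.2.1 hγ.2.2]; exact hall γ hγ _
    · refine ⟨(0, c), ?_⟩
      rw [synthOne_apply, synth_coeffs_one]
      simp

lemma card_half : Fintype.card (halfFrequencies Γ β₀) = (halfFrequencies Γ β₀).ncard := by
  rw [← Nat.card_coe_set_eq, Nat.card_eq_fintype_card]

theorem finrank_solutionSpace (hβ : β₀ ∈ dualLattice Γ) :
    Module.finrank ℝ (solutionSpace Γ β₀) = 2 * (frequencies Γ β₀).ncard + 4 := by
  rw [← range_synthOne hβ, LinearMap.finrank_range_of_inj (synthOne_injective Γ β₀),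
    Module.finrank_prod, Module.finrank_pi_fintype]
  simp [ncard_frequencies Γ hβ]
  ring

lemma Lmul_synth (p : ℂ) (c : Idx Γ β₀ → E4) :
    (fun z => Lmul p (synth Γ β₀ c z)) = synth Γ β₀ fun k => Lmul p (c k) := by
  funext z
  rw [synth_apply, synth_apply, Lmul_sum]
  simp only [Lmul_Lmul, mul_comm p]

lemma mul_star_of_norm_one {p : ℂ} (hp : ‖p‖ = 1) : p * star p = 1 := by
  rw [Complex.star_def, Complex.mul_conj, Complex.normSq_eq_norm_sq, hp]; simp

/-- In the second block p = p² p̄, and the factor p̄ is absorbed by the antilinear `K`. -/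
lemma Lmul_coeffs {p : ℂ} (hp : ‖p‖ = 1) (u : halfFrequencies Γ β₀ → E4) (v : E4) :
    (fun k => Lmul p (coeffs Γ β₀ u 1 v k)) =
      coeffs Γ β₀ (fun γ => Lmul p (u γ)) (p ^ 2) (Lmul p v) := by
  funext k
  rcases k with k | k | k
  · rfl
  · simp only [coeffs, Sum.elim_inl, Sum.elim_inr, one_Lmul, K_Lmul, Lmul_smul, Lmul_Lmul]
    congr 2
    linear_combination -p * mul_star_of_norm_one hp
  · rfl

/-- A rotation p and its negative give the same orbit of the linear space, so p is a redundant
parameter. Passing to q = p² and the actual Fourier coefficients removes the ambiguity; conversely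
any unit q has a square root. -/
theorem mem_solutions_iff_coeffs (hβ : β₀ ∈ dualLattice Γ) (X : ℂ → E4) :
    X ∈ solutions Γ β₀ ↔ ∃ u q v, ‖q‖ = 1 ∧ X = synth Γ β₀ (coeffs Γ β₀ u q v) := by
  rw [solutions_eq Γ hβ, ← range_synthOne hβ]
  constructor
  · rintro ⟨p, hp, _, ⟨x, rfl⟩, rfl⟩
    exact ⟨_, p ^ 2, _, by rw [norm_pow, hp, one_pow],
      (Lmul_synth p _).trans (congrArg _ (Lmul_coeffs hp x.1 x.2))⟩
  · rintro ⟨u, q, v, hq, rfl⟩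
    have hq' : q = Complex.exp (Complex.I * ((q.arg / 2 : ℝ) : ℂ)) ^ 2 := by
      have := Complex.norm_mul_exp_arg_mul_I q
      rw [hq, Complex.ofReal_one, one_mul] at this
      conv_lhs => rw [← this]
      rw [← Complex.exp_nat_mul]
      congr 1; push_cast; ring
    set p := Complex.exp (Complex.I * ((q.arg / 2 : ℝ) : ℂ))
    have hp : ‖p‖ = 1 := norm_expI _
    have hps : ∀ w, Lmul p (Lmul (star p) w) = w := fun w => by
      rw [Lmul_Lmul, mul_star_of_norm_one hp, one_Lmul]
    refine ⟨p, hp, _, ⟨(fun γ => Lmul (star p) (u γ), Lmul (star p) v), rfl⟩, ?_⟩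
    rw [synthOne_apply, Lmul_synth, Lmul_coeffs hp, ← hq']
    simp only [hps]

lemma isConstant_synth_iff (c : Idx Γ β₀ → E4) :
    IsConstant (synth Γ β₀ c) ↔ ∀ k, k ≠ Sum.inr (Sum.inr ()) → c k = 0 := by
  classical
  have hsingle : ∀ v : E4, synth Γ β₀ (Pi.single (Sum.inr (Sum.inr ())) v) = fun _ => v := by
    intro v
    funext z
    rw [synth_apply, Finset.sum_eq_single (Sum.inr (Sum.inr ()))]
    · simp [idxFreq]
    · intro k _ hk
      rw [Pi.single_eq_of_ne hk, Lmul_zero]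
    · simp
  constructor
  · rintro ⟨v, hv⟩ k hk
    have h1 : c = Pi.single (Sum.inr (Sum.inr ())) v :=
      synth_injective Γ β₀ ((funext hv).trans (hsingle v).symm)
    rw [h1, Pi.single_eq_of_ne hk]
  · intro h
    have h1 : c = Pi.single (Sum.inr (Sum.inr ())) (c (Sum.inr (Sum.inr ()))) := by
      funext k
      by_cases hk : k = Sum.inr (Sum.inr ())
      · subst hk; simp
      · rw [h k hk, Pi.single_eq_of_ne hk]
    exact ⟨_, fun z => by rw [h1, hsingle]⟩

lemma isConstant_coeffs_iff (u : halfFrequencies Γ β₀ → E4) (q : ℂ) (v : E4) :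
    IsConstant (synth Γ β₀ (coeffs Γ β₀ u q v)) ↔ u = 0 := by
  rw [isConstant_synth_iff]
  constructor
  · intro h
    funext γ
    exact h (Sum.inl γ) (by simp)
  · rintro rfl (k | k | k) hk
    · rfl
    · simp [coeffs]
    · exact absurd rfl hk

theorem mem_nonconstantSolutions_iff (hβ : β₀ ∈ dualLattice Γ) (X : ℂ → E4) :
    X ∈ nonconstantSolutions Γ β₀ ↔
      ∃ u q v, u ≠ 0 ∧ ‖q‖ = 1 ∧ X = synth Γ β₀ (coeffs Γ β₀ u q v) := by
  constructor
  · rintro ⟨h1, h2⟩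
    obtain ⟨u, q, v, hq, rfl⟩ := (mem_solutions_iff_coeffs hβ X).1 h1
    exact ⟨u, q, v, fun h => h2 ((isConstant_coeffs_iff u q v).2 h), hq, rfl⟩
  · rintro ⟨u, q, v, hu, hq, rfl⟩
    exact ⟨(mem_solutions_iff_coeffs hβ _).2 ⟨u, q, v, hq, rfl⟩,
      fun h => hu ((isConstant_coeffs_iff u q v).1 h)⟩

end

section

/-! ### The manifold of nonconstant solutions -/

lemma HasManifoldDim.of_charts {n : ℕ} {H M : Type} [TopologicalSpace H] [TopologicalSpace M]
    [Nonempty M] (φ : H ≃ₜ EuclideanSpace ℝ (Fin n))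
    (h : ∀ x : M, ∃ e : OpenPartialHomeomorph M H, x ∈ e.source) : HasManifoldDim n M := by
  choose e he using h
  refine ⟨inferInstance, ⟨⟨Set.univ, fun x => (e x).transHomeomorph φ, fun x => ?_, fun _ => trivial⟩⟩⟩
  exact he x

lemma herm_eq (v w : E4) : herm v w = ((inner ℝ v w : ℝ) : ℂ) + ((omega v w : ℝ) : ℂ) * Complex.I := by
  apply Complex.ext <;> simp [herm]

lemma continuous_J : Continuous J := by
  have : J = LmulL Complex.I := funext fun v => (I_Lmul v).symm
  rw [this]; exact (LmulL Complex.I).continuous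

lemma continuous_K : Continuous K := KL.continuous

lemma Continuous.herm' {α : Type*} [TopologicalSpace α] {f g : α → E4} (hf : Continuous f)
    (hg : Continuous g) : Continuous fun x => herm (f x) (g x) := by
  simp only [herm_eq, omega]
  exact (Complex.continuous_ofReal.comp (hf.inner hg)).add
    ((Complex.continuous_ofReal.comp ((continuous_J.comp hf).inner hg)).mul continuous_const)

lemma Continuous.Lmul' {α : Type*} [TopologicalSpace α] {f : α → ℂ} {g : α → E4}
    (hf : Continuous f) (hg : Continuous g) : Continuous fun x => Lmul (f x) (g x) :=
  (LmulL.continuous.comp hf).clm_apply hg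

lemma herm_Lmul_self (q : ℂ) (v : E4) : herm v (Lmul q v) = q * ((‖v‖ ^ 2 : ℝ) : ℂ) := by
  rw [norm_sq_E4]
  apply Complex.ext <;> simp [herm, inner_E4, omega_E4, pow_two] <;> ring

variable (Γ : Submodule ℤ ℂ) (β₀ : ℂ)

set_option linter.unusedSectionVars false

variable [DiscreteTopology Γ] [IsZLattice ℝ Γ]

/-- The Fourier coefficients of the nonconstant solutions. -/
def coeffSet : Set (Idx Γ β₀ → E4) :=
  {c | ∃ u q v, u ≠ 0 ∧ ‖q‖ = 1 ∧ c = coeffs Γ β₀ u q v}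

variable {Γ β₀}

lemma continuous_coeffs {α : Type*} [TopologicalSpace α] {u : α → halfFrequencies Γ β₀ → E4}
    {q : α → ℂ} {v : α → E4} (hu : Continuous u) (hq : Continuous q) (hv : Continuous v) :
    Continuous fun x => coeffs Γ β₀ (u x) (q x) (v x) := by
  refine continuous_pi fun k => ?_
  rcases k with k | k | k
  · exact (continuous_apply k).comp hu
  · exact Continuous.Lmul' hq
      ((continuous_K.comp ((continuous_apply k).comp hu)).const_smul (lam β₀ (k : ℂ)))
  · exact hv

/-- The phase of a family of Fourier coefficients. -/
def phase (c : Idx Γ β₀ → E4) : ℂ :=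
  (∑ γ : halfFrequencies Γ β₀,
    herm (lam β₀ (γ : ℂ) • K (c (Sum.inl γ))) (c (Sum.inr (Sum.inl γ)))) /
  ((∑ γ : halfFrequencies Γ β₀, ‖lam β₀ (γ : ℂ) • K (c (Sum.inl γ))‖ ^ 2 : ℝ) : ℂ)

lemma sum_norm_ne_zero {u : halfFrequencies Γ β₀ → E4} (hu : u ≠ 0) :
    (∑ γ : halfFrequencies Γ β₀, ‖lam β₀ (γ : ℂ) • K (u γ)‖ ^ 2 : ℝ) ≠ 0 := by
  intro h
  apply hu
  funext γ
  have h1 := (Finset.sum_eq_zero_iff_of_nonneg fun γ _ => by positivity).1 h γ (Finset.mem_univ γ)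
  have h2 := (smul_eq_zero.1 (norm_eq_zero.1 (pow_eq_zero_iff two_ne_zero |>.1 h1))).resolve_left
    (lam_ne_zero γ.2.1.2.1 γ.2.1.2.2)
  exact K_eq_zero.1 h2

/-- Summing over all γ before dividing gives one formula valid for every u ≠ 0, although no
particular component of u need be nonzero. -/
lemma phase_coeffs {u : halfFrequencies Γ β₀ → E4} (hu : u ≠ 0) (q : ℂ) (v : E4) :
    phase (coeffs Γ β₀ u q v) = q := by
  have h : ∀ γ : halfFrequencies Γ β₀,
      herm (lam β₀ (γ : ℂ) • K (u γ)) (Lmul q (lam β₀ (γ : ℂ) • K (u γ))) =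
        q * ((‖lam β₀ (γ : ℂ) • K (u γ)‖ ^ 2 : ℝ) : ℂ) := fun γ => herm_Lmul_self _ _
  unfold phase
  simp only [coeffs, Sum.elim_inl, Sum.elim_inr, h]
  rw [← Finset.mul_sum, ← Complex.ofReal_sum, mul_div_assoc, div_self, mul_one]
  exact Complex.ofReal_ne_zero.2 (sum_norm_ne_zero hu)

lemma continuous_phase : Continuous fun c : coeffSet Γ β₀ => phase c.1 := by
  have hc : ∀ k : Idx Γ β₀, Continuous fun c : coeffSet Γ β₀ => c.1 k := fun k =>
    (continuous_apply k).comp continuous_subtype_val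
  have hK : ∀ γ : halfFrequencies Γ β₀, Continuous fun c : coeffSet Γ β₀ =>
      lam β₀ (γ : ℂ) • K (c.1 (Sum.inl γ)) := fun γ =>
    (continuous_K.comp (hc _)).const_smul (lam β₀ (γ : ℂ))
  unfold phase
  refine Continuous.div ?_ ?_ ?_
  · exact continuous_finsetSum _ fun γ _ => Continuous.herm' (hK γ) (hc _)
  · exact Complex.continuous_ofReal.comp
      (continuous_finsetSum _ fun γ _ => (hK γ).norm.pow 2)
  · rintro ⟨_, u, q, v, hu, -, rfl⟩
    exact Complex.ofReal_ne_zero.2 (sum_norm_ne_zero hu)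

variable (Γ β₀) in
/-- The nonconstant solutions in terms of coefficients, phase and constant term. -/
def coeffHomeomorph :
    {u : halfFrequencies Γ β₀ → E4 // u ≠ 0} × Metric.sphere (0 : ℂ) 1 × E4 ≃ₜ coeffSet Γ β₀ where
  toFun x := ⟨coeffs Γ β₀ x.1.1 x.2.1.1 x.2.2, x.1.1, x.2.1.1, x.2.2, x.1.2,
    mem_sphere_zero_iff_norm.1 x.2.1.2, rfl⟩
  invFun c := (⟨fun γ => c.1 (Sum.inl γ), by
      obtain ⟨_, u, q, v, hu, hq, rfl⟩ := c; exact hu⟩,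
    ⟨phase c.1, by
      obtain ⟨_, u, q, v, hu, hq, rfl⟩ := c
      rw [mem_sphere_zero_iff_norm, phase_coeffs hu, hq]⟩,
    c.1 (Sum.inr (Sum.inr ())))
  left_inv := by
    rintro ⟨⟨u, hu⟩, ⟨q, hq⟩, v⟩
    simp only [phase_coeffs hu]
    rfl
  right_inv := by
    rintro ⟨_, u, q, v, hu, hq, rfl⟩
    simp only [phase_coeffs hu]
    rfl
  continuous_toFun := by
    refine Continuous.subtype_mk (continuous_coeffs ?_ ?_ ?_) _ <;> fun_prop
  continuous_invFun := by
    refine Continuous.prodMk ?_ (Continuous.prodMk ?_ ?_)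
    · refine Continuous.subtype_mk ?_ _
      exact continuous_pi fun γ => (continuous_apply _).comp continuous_subtype_val
    · exact Continuous.subtype_mk continuous_phase _
    · exact (continuous_apply _).comp continuous_subtype_val

/-- An injective linear map from a finite-dimensional space into a Hausdorff topological vector
space is an embedding, so pointwise convergence of solutions is convergence of their coefficients.
-/
lemma isEmbedding_synth : Topology.IsEmbedding (synth Γ β₀) :=
  (LinearMap.isClosedEmbedding_of_injective
    (LinearMap.ker_eq_bot.2 (synth_injective Γ β₀))).isEmbedding

lemma image_coeffSet (hβ : β₀ ∈ dualLattice Γ) :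
    synth Γ β₀ '' coeffSet Γ β₀ = nonconstantSolutions Γ β₀ := by
  ext X
  rw [mem_nonconstantSolutions_iff hβ]
  constructor
  · rintro ⟨_, ⟨u, q, v, hu, hq, rfl⟩, rfl⟩
    exact ⟨u, q, v, hu, hq, rfl⟩
  · rintro ⟨u, q, v, hu, hq, rfl⟩
    exact ⟨_, ⟨u, q, v, hu, hq, rfl⟩, rfl⟩

/-- A nonconstant solution corresponds to its Fourier coefficients. -/
def synthHomeomorph (hβ : β₀ ∈ dualLattice Γ) : coeffSet Γ β₀ ≃ₜ nonconstantSolutions Γ β₀ :=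
  (isEmbedding_synth.homeomorphImage (coeffSet Γ β₀)).trans (Homeomorph.setCongr (image_coeffSet hβ))

lemma synthHomeomorph_apply (hβ : β₀ ∈ dualLattice Γ) (c : coeffSet Γ β₀) :
    (synthHomeomorph hβ c : ℂ → E4) = synth Γ β₀ c.1 := rfl

lemma nonempty_halfFrequencies (hβ : β₀ ∈ dualLattice Γ) (h : (frequencies Γ β₀).Nonempty) :
    Nonempty (halfFrequencies Γ β₀) := by
  obtain ⟨γ, hγ⟩ := h
  rcases mem_half_or hβ hγ with h | h
  · exact ⟨⟨_, h⟩⟩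
  · exact ⟨⟨_, h⟩⟩

lemma exists_vec_ne_zero : ∃ v : E4, v ≠ 0 := ⟨vec0, fun h => by
  have := congrArg (fun v : E4 => v 2) h
  simp [vec0] at this⟩

theorem hasManifoldDim_nonconstantSolutions (hβ : β₀ ∈ dualLattice Γ)
    (h : (frequencies Γ β₀).Nonempty) :
    HasManifoldDim (2 * (frequencies Γ β₀).ncard + 5) (nonconstantSolutions Γ β₀) := by
  have := nonempty_halfFrequencies hβ h
  obtain ⟨w, hw⟩ := exists_vec_ne_zero
  have hu0 : (fun _ : halfFrequencies Γ β₀ => w) ≠ 0 := fun h0 =>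
    hw (congrFun h0 (Classical.arbitrary _))
  let Φ := (coeffHomeomorph Γ β₀).trans (synthHomeomorph hβ)
  have : Nonempty {u : halfFrequencies Γ β₀ → E4 // u ≠ 0} := ⟨⟨_, hu0⟩⟩
  have : Nonempty (nonconstantSolutions Γ β₀) :=
    ⟨Φ (⟨_, hu0⟩, ⟨1, by simp⟩, 0)⟩
  have hopen : IsOpen {u : halfFrequencies Γ β₀ → E4 | u ≠ 0} := isOpen_ne
  have hemb : Topology.IsOpenEmbedding
      (Subtype.val : {u : halfFrequencies Γ β₀ → E4 // u ≠ 0} → _) :=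
    hopen.isOpenEmbedding_subtypeVal
  let s : OpenPartialHomeomorph {u : halfFrequencies Γ β₀ → E4 // u ≠ 0}
      (halfFrequencies Γ β₀ → E4) := hemb.toOpenPartialHomeomorph _
  have hdim : Module.finrank ℝ ((halfFrequencies Γ β₀ → E4) × EuclideanSpace ℝ (Fin 1) × E4) =
      Module.finrank ℝ (EuclideanSpace ℝ (Fin (2 * (frequencies Γ β₀).ncard + 5))) := by
    rw [Module.finrank_prod, Module.finrank_prod, Module.finrank_pi_fintype]
    simp [ncard_frequencies Γ hβ]
    ring
  -- This makes the stereographic charts of the unit circle available; the other two factors are an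
  -- open subset of a vector space and a vector space.
  have : Fact (Module.finrank ℝ ℂ = 1 + 1) := ⟨by simp⟩
  refine HasManifoldDim.of_charts (ContinuousLinearEquiv.ofFinrankEq hdim).toHomeomorph fun X => ?_
  refine ⟨Φ.symm.toOpenPartialHomeomorph.trans
    (s.prod ((chartAt (EuclideanSpace ℝ (Fin 1)) (Φ.symm X).2.1).prod
      (OpenPartialHomeomorph.refl E4))), ?_⟩
  simp [s]

end

section

/-! ### The symmetry group -/

/-- The linear part of an element of the symmetry group is complex linear. -/
lemma linear_Lmul {g : E4 ≃ᵃⁱ[ℝ] E4} (hg : g ∈ symmetryGroup) (p : ℂ) (v : E4) :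
    g.linearIsometryEquiv (Lmul p v) = Lmul p (g.linearIsometryEquiv v) := by
  have hJ : g.linearIsometryEquiv (J v) = J (g.linearIsometryEquiv v) := by
    refine ext_inner_right ℝ fun w => ?_
    obtain ⟨w, rfl⟩ := g.linearIsometryEquiv.surjective w
    rw [LinearIsometryEquiv.inner_map_map]
    exact (hg v w).symm
  simp only [Lmul, map_add, map_smul, hJ]

lemma apply_eq_linear_add (g : E4 ≃ᵃⁱ[ℝ] E4) (v : E4) :
    g v = g.linearIsometryEquiv v + g 0 := by
  have := g.map_vadd 0 v
  simpa using this

lemma herm_map {g : E4 ≃ᵃⁱ[ℝ] E4} (hg : g ∈ symmetryGroup) (v w : E4) :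
    herm (g.linearIsometryEquiv v) (g.linearIsometryEquiv w) = herm v w := by
  rw [herm, herm, LinearIsometryEquiv.inner_map_map]
  congr 1
  exact hg v w

/-- The unitary map of `ℂ² = E4` with `(1, 0) ↦ e` and `(0, 1) ↦ q K e`. -/
def unitaryMap (e : E4) (q : ℂ) (he : ‖e‖ = 1) (hq : ‖q‖ = 1) : E4 →ₗᵢ[ℝ] E4 where
  toFun v := Lmul (fstC v) e + Lmul (sndC v) (Lmul q (K e))
  map_add' v w := by
    apply E4.ext <;> simp [fstC, sndC] <;> ring
  map_smul' r v := by
    apply E4.ext <;> simp [fstC, sndC] <;> ring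
  norm_map' v := by
    have h1 : ‖e‖ ^ 2 = 1 := by rw [he, one_pow]
    have h2 : q.re * q.re + q.im * q.im = 1 := by
      rw [← Complex.normSq_apply, Complex.normSq_eq_norm_sq, hq, one_pow]
    rw [← sq_eq_sq₀ (norm_nonneg _) (norm_nonneg _)]
    have h3 : ‖Lmul (fstC v) e + Lmul (sndC v) (Lmul q (K e))‖ ^ 2 =
        ‖e‖ ^ 2 * (v 0 ^ 2 + v 1 ^ 2 + (q.re * q.re + q.im * q.im) * (v 2 ^ 2 + v 3 ^ 2)) := by
      rw [norm_sq_E4, norm_sq_E4]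
      simp [fstC, sndC]
      ring
    change ‖Lmul (fstC v) e + Lmul (sndC v) (Lmul q (K e))‖ ^ 2 = _
    rw [h3, h1, h2, norm_sq_E4]; ring

lemma unitaryMap_apply (e : E4) (q : ℂ) (he : ‖e‖ = 1) (hq : ‖q‖ = 1) (v : E4) :
    unitaryMap e q he hq v = Lmul (fstC v) e + Lmul (sndC v) (Lmul q (K e)) := rfl

lemma unitaryMap_Lmul (e : E4) (q : ℂ) (he : ‖e‖ = 1) (hq : ‖q‖ = 1) (p : ℂ) (v : E4) :
    unitaryMap e q he hq (Lmul p v) = Lmul p (unitaryMap e q he hq v) := by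
  rw [unitaryMap_apply, unitaryMap_apply, fstC_Lmul, sndC_Lmul, Lmul_add, ← Lmul_Lmul, ← Lmul_Lmul]

/-- Here q is the complex determinant of the map. This commutation rule is what carries a solution
with phase 1 to one with phase q. -/
lemma unitaryMap_K (e : E4) (q : ℂ) (he : ‖e‖ = 1) (hq : ‖q‖ = 1) (v : E4) :
    unitaryMap e q he hq (K v) = Lmul q (K (unitaryMap e q he hq v)) := by
  have h1 : fstC (K v) = -star (sndC v) := by apply Complex.ext <;> simp [fstC, sndC]
  have h2 : sndC (K v) = star (fstC v) := by apply Complex.ext <;> simp [fstC, sndC]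
  have h3 := mul_star_of_norm_one hq
  rw [unitaryMap_apply, unitaryMap_apply, h1, h2, K_add, Lmul_add, K_Lmul, K_Lmul, K_Lmul, K_K]
  simp only [Lmul_Lmul, Lmul_neg, neg_Lmul]
  rw [show q * (star (sndC v) * star q) = star (sndC v) by linear_combination star (sndC v) * h3,
    mul_comm q (star (fstC v))]
  abel

/-- The element of the symmetry group with linear part `unitaryMap e q` and translation `t`. -/
def unitaryAffine (e : E4) (q : ℂ) (he : ‖e‖ = 1) (hq : ‖q‖ = 1) (t : E4) : E4 ≃ᵃⁱ[ℝ] E4 :=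
  ((unitaryMap e q he hq).toLinearIsometryEquiv rfl).toAffineIsometryEquiv.trans
    (AffineIsometryEquiv.constVAdd ℝ E4 t)

lemma unitaryAffine_apply (e : E4) (q : ℂ) (he : ‖e‖ = 1) (hq : ‖q‖ = 1) (t v : E4) :
    unitaryAffine e q he hq t v = t + unitaryMap e q he hq v := rfl

lemma unitaryAffine_mem (e : E4) (q : ℂ) (he : ‖e‖ = 1) (hq : ‖q‖ = 1) (t : E4) :
    unitaryAffine e q he hq t ∈ symmetryGroup := by
  intro v w
  have h : ∀ v, (unitaryAffine e q he hq t).linearIsometryEquiv v = unitaryMap e q he hq v := by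
    intro v
    have h1 := apply_eq_linear_add (unitaryAffine e q he hq t) v
    rw [unitaryAffine_apply, unitaryAffine_apply, map_zero, add_zero, add_comm] at h1
    exact (add_right_cancel h1).symm
  rw [h, h, omega, omega, ← I_Lmul, ← I_Lmul, ← unitaryMap_Lmul, LinearIsometry.inner_map_map]

/-! ### The moduli space -/

set_option linter.unusedSectionVars false

variable {Γ : Submodule ℤ ℂ} {β₀ : ℂ} [DiscreteTopology Γ] [IsZLattice ℝ Γ]

/-- The effect of a symmetry on Fourier coefficients. -/
lemma map_synth {M : E4 →L[ℝ] E4} (hM : ∀ p v, M (Lmul p v) = Lmul p (M v)) (t : E4)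
    (c : Idx Γ β₀ → E4) (z : ℂ) :
    M (synth Γ β₀ c z) + t =
      synth Γ β₀ (Sum.elim (fun γ => M (c (Sum.inl γ))) (Sum.elim
        (fun γ => M (c (Sum.inr (Sum.inl γ)))) fun i => M (c (Sum.inr (Sum.inr i))) + t)) z := by
  rw [synth_apply, synth_apply, Fintype.sum_sum_type, Fintype.sum_sum_type, Fintype.sum_sum_type,
    Fintype.sum_sum_type]
  simp only [map_add, map_sum, hM, Sum.elim_inl, Sum.elim_inr, Finset.univ_unique,
    Finset.sum_singleton, idxFreq, planeWave_zero_left, one_Lmul, add_assoc]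

/-- The Fourier coefficients of a nonconstant solution. -/
def fourierCoeffs (hβ : β₀ ∈ dualLattice Γ) (X : nonconstantSolutions Γ β₀) : Idx Γ β₀ → E4 :=
  ((synthHomeomorph hβ).symm X).1

lemma synth_fourierCoeffs (hβ : β₀ ∈ dualLattice Γ) (X : nonconstantSolutions Γ β₀) :
    synth Γ β₀ (fourierCoeffs hβ X) = X := by
  have := synthHomeomorph_apply hβ ((synthHomeomorph hβ).symm X)
  rw [Homeomorph.apply_symm_apply] at this
  exact this.symm

lemma continuous_fourierCoeffs (hβ : β₀ ∈ dualLattice Γ) :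
    Continuous (fourierCoeffs hβ) :=
  continuous_subtype_val.comp (synthHomeomorph hβ).symm.continuous

lemma exists_coeffs_eq (hβ : β₀ ∈ dualLattice Γ) (X : nonconstantSolutions Γ β₀) :
    ∃ u q v, u ≠ 0 ∧ ‖q‖ = 1 ∧ fourierCoeffs hβ X = coeffs Γ β₀ u q v :=
  ((synthHomeomorph hβ).symm X).2

lemma fourierCoeffs_synthHomeomorph (hβ : β₀ ∈ dualLattice Γ) (c : coeffSet Γ β₀) :
    fourierCoeffs hβ (synthHomeomorph hβ c) = c.1 := by
  unfold fourierCoeffs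
  rw [Homeomorph.symm_apply_apply]

/-- The model space of the moduli space. -/
abbrev ModuliModel (j : halfFrequencies Γ β₀) : Type :=
  ℝ × ({k : halfFrequencies Γ β₀ // k ≠ j} → ℂ × ℂ)

/-- Invariants of a nonconstant solution under the symmetry group. -/
def invariants (hβ : β₀ ∈ dualLattice Γ) (j : halfFrequencies Γ β₀)
    (X : nonconstantSolutions Γ β₀) : ModuliModel j :=
  (‖fourierCoeffs hβ X (Sum.inl j)‖, fun k =>
    (herm (fourierCoeffs hβ X (Sum.inl j)) (fourierCoeffs hβ X (Sum.inl k.1)),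
      -- This coefficient is q λ K u_j. Together with u_j it spans ℂ² when u_j ≠ 0, so the two
      -- products determine u_k relative to a frame that moves with the symmetry.
      herm (fourierCoeffs hβ X (Sum.inr (Sum.inl j))) (fourierCoeffs hβ X (Sum.inl k.1))))

lemma continuous_invariants (hβ : β₀ ∈ dualLattice Γ) (j : halfFrequencies Γ β₀) :
    Continuous (invariants hβ j) := by
  have hc : ∀ k, Continuous fun X => fourierCoeffs hβ X k := fun k =>
    (continuous_apply k).comp (continuous_fourierCoeffs hβ)
  exact (hc _).norm.prodMk (continuous_pi fun k =>
    (Continuous.herm' (hc _) (hc _)).prodMk (Continuous.herm' (hc _) (hc _)))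

/-- The linear part of a symmetry is complex linear, so it commutes with the plane waves and acts on
each coefficient separately, preserving Hermitian products; the translation only enters the constant
term. -/
lemma invariants_eq_of_sameOrbit (hβ : β₀ ∈ dualLattice Γ) (j : halfFrequencies Γ β₀)
    {X Y : nonconstantSolutions Γ β₀} (h : SameOrbit Γ β₀ X Y) :
    invariants hβ j X = invariants hβ j Y := by
  obtain ⟨g, hg, h⟩ := h
  have h1 : fourierCoeffs hβ Y = Sum.elim
      (fun γ => g.linearIsometryEquiv (fourierCoeffs hβ X (Sum.inl γ))) (Sum.elim
        (fun γ => g.linearIsometryEquiv (fourierCoeffs hβ X (Sum.inr (Sum.inl γ))))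
        fun i => g.linearIsometryEquiv (fourierCoeffs hβ X (Sum.inr (Sum.inr i))) + g 0) := by
    apply synth_injective Γ β₀
    funext z
    rw [synth_fourierCoeffs, h z, apply_eq_linear_add, ← synth_fourierCoeffs hβ X]
    exact map_synth (M := g.linearIsometryEquiv.toContinuousLinearEquiv.toContinuousLinearMap)
      (linear_Lmul hg) (g 0) (fourierCoeffs hβ X) z
  unfold invariants
  rw [h1]
  simp only [Sum.elim_inl, Sum.elim_inr]
  refine Prod.ext ?_ (funext fun k => Prod.ext ?_ ?_)
  · exact (g.linearIsometryEquiv.norm_map _).symm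
  · exact (herm_map hg _ _).symm
  · exact (herm_map hg _ _).symm

/-- The coefficients of the normal form of a solution with `‖c j‖ = e^s` and the given
invariants. -/
def normalForm (j : halfFrequencies Γ β₀) (s : ℝ)
    (f : {k : halfFrequencies Γ β₀ // k ≠ j} → ℂ × ℂ) (k : halfFrequencies Γ β₀) : E4 :=
  open Classical in
  -- The divisors solve the equations for the two Hermitian products with (e^s, 0) and with its
  -- second-block partner λ (0, e^s). Using e^s keeps the form nonzero for all real s.
  if h : k = j then mkC (Real.exp s : ℂ) 0 else
    mkC ((f ⟨k, h⟩).1 / (Real.exp s : ℂ)) ((f ⟨k, h⟩).2 / ((lam β₀ (j : ℂ) : ℂ) * (Real.exp s : ℂ)))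

lemma exp_ofReal_ne_zero (s : ℝ) : ((Real.exp s : ℝ) : ℂ) ≠ 0 :=
  Complex.ofReal_ne_zero.2 (Real.exp_pos s).ne'

lemma norm_sq_mkC (a b : ℂ) : ‖mkC a b‖ ^ 2 = ‖a‖ ^ 2 + ‖b‖ ^ 2 := by
  rw [norm_sq_E4, norm_sq_complex, norm_sq_complex]
  simp [mkC]; ring

lemma norm_normalForm_self (j : halfFrequencies Γ β₀) (s : ℝ)
    (f : {k : halfFrequencies Γ β₀ // k ≠ j} → ℂ × ℂ) : ‖normalForm j s f j‖ = Real.exp s := by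
  unfold normalForm
  rw [dif_pos rfl, ← sq_eq_sq₀ (norm_nonneg _) (Real.exp_pos s).le, norm_sq_mkC,
    Complex.norm_real, norm_zero, Real.norm_eq_abs, sq_abs]
  ring

lemma normalForm_ne_zero (j : halfFrequencies Γ β₀) (s : ℝ)
    (f : {k : halfFrequencies Γ β₀ // k ≠ j} → ℂ × ℂ) : normalForm j s f ≠ 0 := fun h => by
  have h1 := norm_normalForm_self j s f
  rw [h] at h1
  simp only [Pi.zero_apply, norm_zero] at h1
  exact (Real.exp_pos s).ne h1

lemma continuous_mkC : Continuous fun x : ℂ × ℂ => mkC x.1 x.2 := by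
  have : (fun x : ℂ × ℂ => mkC x.1 x.2) =
      fun x => Lmul x.1 (mkC 1 0) + Lmul x.2 (mkC 0 1) := by
    funext x
    apply E4.ext <;> simp [mkC]
  rw [this]
  exact (Continuous.Lmul' continuous_fst continuous_const).add
    (Continuous.Lmul' continuous_snd continuous_const)

lemma continuous_normalForm (j : halfFrequencies Γ β₀) :
    Continuous fun x : ModuliModel j => normalForm j x.1 x.2 := by
  have hexp : Continuous fun x : ModuliModel j => ((Real.exp x.1 : ℝ) : ℂ) :=
    Complex.continuous_ofReal.comp (Real.continuous_exp.comp continuous_fst)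
  refine continuous_pi fun k => ?_
  unfold normalForm
  by_cases h : k = j
  · simp only [dif_pos h]
    exact continuous_mkC.comp (hexp.prodMk continuous_const)
  · simp only [dif_neg h]
    have hf : Continuous fun x : ModuliModel j => x.2 ⟨k, h⟩ :=
      (continuous_apply (⟨k, h⟩ : {k : halfFrequencies Γ β₀ // k ≠ j})).comp continuous_snd
    refine continuous_mkC.comp (Continuous.prodMk ?_ ?_)
    · exact (continuous_fst.comp hf).div hexp fun x => exp_ofReal_ne_zero _
    · refine (continuous_snd.comp hf).div (continuous_const.mul hexp) fun x => ?_
      exact mul_ne_zero (Complex.ofReal_ne_zero.2 (lam_ne_zero j.2.1.2.1 j.2.1.2.2))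
        (exp_ofReal_ne_zero _)

/-- The normal form as a solution. -/
def normalSolution (hβ : β₀ ∈ dualLattice Γ) (j : halfFrequencies Γ β₀) (x : ModuliModel j) :
    nonconstantSolutions Γ β₀ :=
  synthHomeomorph hβ ⟨coeffs Γ β₀ (normalForm j x.1 x.2) 1 0, _, _, _, normalForm_ne_zero j _ _,
    norm_one, rfl⟩

lemma continuous_normalSolution (hβ : β₀ ∈ dualLattice Γ) (j : halfFrequencies Γ β₀) :
    Continuous (normalSolution hβ j) :=
  (synthHomeomorph hβ).continuous.comp (Continuous.subtype_mk
    (continuous_coeffs (continuous_normalForm j) continuous_const continuous_const) _)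

lemma fourierCoeffs_normalSolution (hβ : β₀ ∈ dualLattice Γ) (j : halfFrequencies Γ β₀)
    (x : ModuliModel j) : fourierCoeffs hβ (normalSolution hβ j x) =
      coeffs Γ β₀ (normalForm j x.1 x.2) 1 0 := fourierCoeffs_synthHomeomorph hβ _

lemma herm_mkC_fst (a b : ℂ) (r : ℝ) : herm (mkC (r : ℂ) 0) (mkC a b) = r * a := by
  apply Complex.ext <;> simp [herm, inner_E4, omega_E4, mkC]

lemma herm_mkC_snd (a b : ℂ) (r l : ℝ) :
    herm (l • K (mkC (r : ℂ) 0)) (mkC a b) = l * r * b := by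
  apply Complex.ext <;> simp [herm, inner_E4, omega_E4, mkC]

lemma invariants_normalSolution (hβ : β₀ ∈ dualLattice Γ) (j : halfFrequencies Γ β₀)
    (x : ModuliModel j) :
    invariants hβ j (normalSolution hβ j x) = (Real.exp x.1, x.2) := by
  have hl : (lam β₀ (j : ℂ) : ℂ) ≠ 0 :=
    Complex.ofReal_ne_zero.2 (lam_ne_zero j.2.1.2.1 j.2.1.2.2)
  have he := exp_ofReal_ne_zero x.1
  have hj : normalForm j x.1 x.2 j = mkC (Real.exp x.1 : ℂ) 0 := dif_pos rfl
  unfold invariants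
  rw [fourierCoeffs_normalSolution]
  refine Prod.ext (norm_normalForm_self j _ _) (funext fun k => ?_)
  have hk : normalForm j x.1 x.2 k.1 = mkC ((x.2 k).1 / (Real.exp x.1 : ℂ))
      ((x.2 k).2 / ((lam β₀ (j : ℂ) : ℂ) * (Real.exp x.1 : ℂ))) := dif_neg k.2
  simp only [coeffs, Sum.elim_inl, Sum.elim_inr, one_Lmul]
  rw [hj, hk]
  refine Prod.ext ?_ ?_
  · simp only [herm_mkC_fst]
    field_simp
  · simp only [herm_mkC_snd]
    field_simp

/-- Every solution with `c j ≠ 0` is equivalent to its normal form. -/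
lemma sameOrbit_normalSolution (hβ : β₀ ∈ dualLattice Γ) (j : halfFrequencies Γ β₀)
    (X : nonconstantSolutions Γ β₀) (hX : 0 < (invariants hβ j X).1) :
    SameOrbit Γ β₀ (normalSolution hβ j (Real.log (invariants hβ j X).1, (invariants hβ j X).2))
      X := by
  obtain ⟨u, q, v, hu, hq, hc⟩ := exists_coeffs_eq hβ X
  have hr1 : (invariants hβ j X).1 = ‖u j‖ := by unfold invariants; rw [hc]; rfl
  set r := ‖u j‖ with hr
  have hr0 : 0 < r := hr1 ▸ hX
  have hrC : (r : ℂ) ≠ 0 := Complex.ofReal_ne_zero.2 hr0.ne'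
  have hl : (lam β₀ (j : ℂ) : ℂ) ≠ 0 :=
    Complex.ofReal_ne_zero.2 (lam_ne_zero j.2.1.2.1 j.2.1.2.2)
  -- The unitary map sends the standard basis to e and q K e, so (r, 0) goes to u_j.
  let e : E4 := r⁻¹ • u j
  have he : ‖e‖ = 1 := by
    rw [norm_smul, norm_inv, Real.norm_eq_abs, abs_of_pos hr0, ← hr, inv_mul_cancel₀ hr0.ne']
  set s := Real.log (invariants hβ j X).1 with hs
  have hexp : Real.exp s = r := by rw [hs, hr1, Real.exp_log hr0]
  set f := (invariants hβ j X).2 with hf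
  have hfk : ∀ k, f k = (herm (u j) (u k.1), herm (Lmul q (lam β₀ (j : ℂ) • K (u j))) (u k.1)) := by
    intro k
    rw [hf]; unfold invariants; rw [hc]; rfl
  have hmap : ∀ k, unitaryMap e q he hq (normalForm j s f k) = u k := by
    intro k
    by_cases hk : k = j
    · subst hk
      have : normalForm k s f k = mkC (r : ℂ) 0 := by rw [← hexp]; exact dif_pos rfl
      rw [this, unitaryMap_apply, fstC_mkC, sndC_mkC, zero_Lmul, add_zero, ofReal_Lmul,
        smul_inv_smul₀ hr0.ne']
    · have : normalForm j s f k = mkC ((f ⟨k, hk⟩).1 / (r : ℂ))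
          ((f ⟨k, hk⟩).2 / ((lam β₀ (j : ℂ) : ℂ) * (r : ℂ))) := by rw [← hexp]; exact dif_neg hk
      rw [this, unitaryMap_apply, fstC_mkC, sndC_mkC, hfk]
      -- The expansion of u_k in the frame u_j, `K u_j` identifies it with the image of its normal
      -- form; the phase cancels through q q̄ = 1.
      have h1 := norm_sq_smul_eq (u j) (u k)
      have h2 : herm (Lmul q (lam β₀ (j : ℂ) • K (u j))) (u k) =
          star q * (lam β₀ (j : ℂ) : ℂ) * herm (K (u j)) (u k) := by
        apply Complex.ext <;> simp [herm, inner_E4, omega_E4] <;> ring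
      have h3 := mul_star_of_norm_one hq
      have hrr : (r ^ 2 : ℝ) ≠ 0 := pow_ne_zero 2 hr0.ne'
      apply smul_right_injective E4 hrr
      simp only
      rw [h1, h2, K_smul, Lmul_smul, Lmul_smul, Lmul_smul, ← smul_Lmul, ← smul_Lmul, smul_add,
        ← smul_Lmul, ← smul_Lmul, Lmul_Lmul]
      congr 2
      · rw [Complex.real_smul, Complex.real_smul]
        push_cast
        field_simp
      · rw [Complex.real_smul, Complex.real_smul]
        push_cast
        field_simp
        linear_combination (herm (K (u j)) (u k)) * h3
  -- The normal form has constant term 0, so the translation is the constant term of X.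
  refine ⟨unitaryAffine e q he hq v, unitaryAffine_mem e q he hq v, fun z => ?_⟩
  rw [unitaryAffine_apply, ← synth_fourierCoeffs hβ (normalSolution hβ j (s, f)),
    fourierCoeffs_normalSolution, ← synth_fourierCoeffs hβ X, hc, add_comm]
  have h4 := map_synth (M := (unitaryMap e q he hq).toContinuousLinearMap)
    (unitaryMap_Lmul e q he hq) v (coeffs Γ β₀ (normalForm j s f) 1 0) z
  refine Eq.trans ?_ h4.symm
  refine congrArg (fun c => synth Γ β₀ c z) (funext fun k => ?_)
  rcases k with k | k | k
  · exact (hmap k).symm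
  · simp only [coeffs, Sum.elim_inl, Sum.elim_inr, one_Lmul]
    change _ = unitaryMap e q he hq (lam β₀ (k : ℂ) • K (normalForm j s f k))
    rw [map_smul, unitaryMap_K, hmap k, Lmul_smul]
  · simp [coeffs]

/-- The invariants as functions on the moduli space. -/
def moduliInvariants (hβ : β₀ ∈ dualLattice Γ) (j : halfFrequencies Γ β₀) :
    ModuliSpace Γ β₀ → ModuliModel j :=
  Quot.lift (invariants hβ j) fun _ _ h => invariants_eq_of_sameOrbit hβ j h

lemma continuous_moduliInvariants (hβ : β₀ ∈ dualLattice Γ) (j : halfFrequencies Γ β₀) :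
    Continuous (moduliInvariants hβ j) :=
  continuous_quot_lift _ (continuous_invariants hβ j)

/-- The chart of the moduli space given by the invariants. -/
def moduliChart (hβ : β₀ ∈ dualLattice Γ) (j : halfFrequencies Γ β₀) :
    OpenPartialHomeomorph (ModuliSpace Γ β₀) (ModuliModel j) where
  toFun := moduliInvariants hβ j
  invFun x := Quot.mk _ (normalSolution hβ j (Real.log x.1, x.2))
  source := {X | 0 < (moduliInvariants hβ j X).1}
  target := {x | 0 < x.1}
  map_source' := fun _ h => h
  map_target' := by
    intro x hx
    have : moduliInvariants hβ j (Quot.mk _ (normalSolution hβ j (Real.log x.1, x.2))) = _ :=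
      invariants_normalSolution hβ j (Real.log x.1, x.2)
    change 0 < (moduliInvariants hβ j _).1
    rw [this]
    exact Real.exp_pos _
  left_inv' := by
    rintro ⟨X⟩ hX
    exact Quot.sound (sameOrbit_normalSolution hβ j X hX)
  right_inv' := by
    intro x hx
    have : moduliInvariants hβ j (Quot.mk _ (normalSolution hβ j (Real.log x.1, x.2))) = _ :=
      invariants_normalSolution hβ j (Real.log x.1, x.2)
    rw [this]
    exact Prod.ext (Real.exp_log hx) rfl
  open_source := isOpen_lt continuous_const
    (continuous_fst.comp (continuous_moduliInvariants hβ j))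
  open_target := isOpen_lt continuous_const continuous_fst
  continuousOn_toFun := (continuous_moduliInvariants hβ j).continuousOn
  continuousOn_invFun := by
    -- The inverse is the projection of a continuous family of normal forms, so the quotient
    -- topology needs no further analysis.
    refine (continuous_quot_mk.comp (continuous_normalSolution hβ j)).comp_continuousOn ?_
    exact (continuousOn_fst.log fun x hx => ne_of_gt hx).prodMk continuousOn_snd

/-- Every nonconstant solution has some u_j ≠ 0 and so lies in the domain of a chart. With h = m + 1
pairs, each chart has dimension 1 + 4m, and (1 + 4m) + 3 = 4h is twice the number of frequencies. -/
theorem hasManifoldDim_moduliSpace (hβ : β₀ ∈ dualLattice Γ) (h : (frequencies Γ β₀).Nonempty) :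
    ∃ d : ℕ, d + 3 = 2 * (frequencies Γ β₀).ncard ∧ HasManifoldDim d (ModuliSpace Γ β₀) := by
  classical
  obtain ⟨j₀⟩ := nonempty_halfFrequencies hβ h
  obtain ⟨⟨X₀⟩, -⟩ := hasManifoldDim_nonconstantSolutions hβ h
  have : Nonempty (ModuliSpace Γ β₀) := ⟨Quot.mk _ X₀⟩
  have hpos : 0 < (halfFrequencies Γ β₀).ncard := by
    rw [← card_half]; exact Fintype.card_pos_iff.2 ⟨j₀⟩
  obtain ⟨m, hm⟩ : ∃ m, (halfFrequencies Γ β₀).ncard = m + 1 :=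
    ⟨_, (Nat.succ_pred_eq_of_pos hpos).symm⟩
  have hdim : ∀ j : halfFrequencies Γ β₀, Module.finrank ℝ (ModuliModel j) = 4 * m + 1 := by
    intro j
    have hcard : Fintype.card {k : halfFrequencies Γ β₀ // k ≠ j} = m := by
      have := Fintype.card_subtype_compl (fun k : halfFrequencies Γ β₀ => k = j)
      rw [Fintype.card_subtype_eq, card_half, hm] at this
      simpa using this
    rw [Module.finrank_prod, Module.finrank_pi_fintype]
    simp [hcard]
    ring
  refine ⟨4 * m + 1, by rw [ncard_frequencies Γ hβ, hm]; ring, inferInstance, ?_⟩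
  let φ : ∀ j : halfFrequencies Γ β₀, ModuliModel j ≃ₜ EuclideanSpace ℝ (Fin (4 * m + 1)) :=
    fun j => (ContinuousLinearEquiv.ofFinrankEq ((hdim j).trans
      (by simp : _ = Module.finrank ℝ (EuclideanSpace ℝ (Fin (4 * m + 1)))))).toHomeomorph
  refine (HasManifoldDim.of_charts (Homeomorph.refl (EuclideanSpace ℝ (Fin (4 * m + 1)))) ?_).2
  rintro ⟨X⟩
  obtain ⟨u, q, v, hu, hq, hc⟩ := exists_coeffs_eq hβ X
  obtain ⟨j, hj⟩ := Function.ne_iff.1 hu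
  refine ⟨(moduliChart hβ j).transHomeomorph (φ j), ?_⟩
  change 0 < ‖fourierCoeffs hβ X (Sum.inl j)‖
  rw [hc]
  exact norm_pos_iff.2 hj

end

end HamStat

end

theorem theorem4 (Γ : Submodule ℤ ℂ) [DiscreteTopology Γ] [IsZLattice ℝ Γ] :
    -- the angle of a nonconstant solution is affine, with frequency in the dual lattice
    (∀ (X : ℂ → HamStat.E4) (β : ℂ → ℝ), HamStat.IsPeriodic Γ X →
      HamStat.IsHamiltonianStationary X β → ¬ HamStat.IsConstant X →
      ∃ β₀ ∈ HamStat.dualLattice Γ, ∀ z, (1 / (Real.pi : ℂ)) * HamStat.dbar β z = β₀) ∧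
    ∀ β₀ ∈ HamStat.dualLattice Γ,
      -- the solutions for a given frequency
      HamStat.solutions Γ β₀ =
        HamStat.orbitG2 (HamStat.solutionSpace Γ β₀ : Set (ℂ → HamStat.E4)) ∧
      -- the dimensions
      (HamStat.frequencies Γ β₀).Finite ∧
      Module.finrank ℝ (HamStat.solutionSpace Γ β₀) =
        2 * (HamStat.frequencies Γ β₀).ncard + 4 ∧
      ((HamStat.frequencies Γ β₀).Nonempty →
        HamStat.HasManifoldDim (2 * (HamStat.frequencies Γ β₀).ncard + 5)
          (HamStat.nonconstantSolutions Γ β₀) ∧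
        ∃ d : ℕ, d + 3 = 2 * (HamStat.frequencies Γ β₀).ncard ∧
          HamStat.HasManifoldDim d (HamStat.ModuliSpace Γ β₀)) := by
  refine ⟨fun X β hp hst hnc => HamStat.dbar_angle_const Γ hp hst hnc, fun β₀ hβ => ?_⟩
  exact ⟨HamStat.solutions_eq Γ hβ, HamStat.finite_frequencies Γ β₀,
    HamStat.finrank_solutionSpace hβ, fun h =>
      ⟨HamStat.hasManifoldDim_nonconstantSolutions hβ h, HamStat.hasManifoldDim_moduliSpace hβ h⟩⟩
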